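/- Let $K,T\in\mathbb N$ be fixed and let $\beta^0\in\mathbb R^K$. For each $N$ consider a three-way panel with $N$ countries: for all ordered pairs $(i,j)$, $i\neq j$, $i,j\in\{1,\dots,N\}$, and all $t\in\{1,\dots,T\}$ there are regressors $x_{ijt}\in\mathbb R^K$, outcomes $y_{ijt}\ge 0$, and true fixed effects $\alpha^0_{it},\gamma^0_{jt},\eta^0_{ij}\in\mathbb R$, all random and possibly depending on $N$, on a common standard Borel probability space. Write $x,\alpha^0,\gamma^0,\eta^0$ for the whole arrays of the $N$-country panel, and $\lambda_{ijt}(\beta,\alpha,\gamma,\eta)=\exp(x_{ijt}'\beta+\alpha_{it}+\gamma_{jt}+\eta_{ij})$, $\lambda_{ijt}=\lambda_{ijt}(\beta^0,\alpha^0,\gamma^0,\eta^0)$, $\vartheta_{ijt}=\lambda_{ijt}/\sum_\tau\lambda_{ij\tau}$. Assume: (a) (strict exogeneity) $y_{ijt}$ is integrable and $\mathbb E(y_{ijt}\mid x,\alpha^0,\gamma^0,\eta^0)=\lambda_{ijt}$, i.e. the disturbance $\omega_{ijt}=y_{ijt}/\lambda_{ijt}$ has mean one given all the regressors and fixed effects;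 (b) conditional on $x,\alpha^0,\gamma^0,\eta^0$, the $T$-vectors $y_{ij}=(y_{ijt})_t$ are independent across pairs $(i,j)$ (dependence over $t$ is unrestricted); (c) $x_{ijt},\alpha^0_{it},\gamma^0_{jt}$ are uniformly bounded, and for some $\nu>0$ the conditional moments $\mathbb E(y_{ijt}^{8+\nu}\mid x_{ijt},\alpha^0_{it},\gamma^0_{jt},\eta^0_{ij})$ are uniformly bounded over $i,j,t,N$; (d) (non-collinearity) almost surely $W_N=\frac1{N(N-1)}\sum_{i\ne j}\widetilde x_{ij}'\bar H_{ij}\widetilde x_{ij}$ converges, as $N\to\infty$, to a positive definite $K\times K$ matrix. Here $\bar H_{ij}=\mathbb E(H_{ij}\mid x,\alpha^0,\gamma^0,\eta^0)$ for the $T\times T$ matrix $H_{ij}$ with entries $H_{ij,tt}=\vartheta_{ijt}(1-\vartheta_{ijt})\sum_\tau y_{ij\tau}$ and $H_{ij,ts}=-\vartheta_{ijt}\vartheta_{ijs}\sum_\tau y_{ij\tau}$ for $t\ne s$; $x_{ij}$ is the $T\times K$ matrix with rows $x_{ijt}'$; and $\widetilde x_{ij}=x_{ij}-\alpha^x_i-\gamma^x_j$,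 where the $T\times K$ matrices $\alpha_i^x,\gamma_j^x$ minimize $\sum_{i\ne j}\mathrm{Tr}[(x_{ij}-\alpha^x_i-\gamma^x_j)'\bar H_{ij}(x_{ij}-\alpha^x_i-\gamma^x_j)]$ ($W_N$ does not depend on the choice of the minimizer). A three-way FE-PPML estimate $\widehat\beta$ is a maximizer over $\beta\in\mathbb R^K$ of $$\sup_{\alpha,\gamma,\eta}\ \sum_{i=1}^N\sum_{j\neq i}\sum_{t=1}^T\bigl(y_{ijt}\log\lambda_{ijt}(\beta,\alpha,\gamma,\eta)-\lambda_{ijt}(\beta,\alpha,\gamma,\eta)\bigr),$$ the supremum being over all real fixed effects. Then the three-way FE-PPML estimator of $\beta$ is consistent as $N\to\infty$ with $T$ fixed: with probability tending to one an estimate exists, and every sequence $\widehat\beta_N$ that is an FE-PPML estimate whenever one exists converges in probability to $\beta^0$. -/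

import Mathlib

open MeasureTheory ProbabilityTheory Filter Topology

namespace Gravity

/-- The observed ordered country pairs `(i, j)` with `i ≠ j` among `N` countries. -/
abbrev Pair (N : ℕ) : Type := {p : Fin N × Fin N // p.1 ≠ p.2}

/-- Values of the regressors `x_{ijt,k}`: for every pair a `T × K` array. -/
abbrev Regressors (N T K : ℕ) : Type := Pair N → Fin T → Fin K → ℝ

/-- Exporter-time or importer-time fixed effects for `N` countries. -/
abbrev CountryTime (N T : ℕ) : Type := Fin N → Fin T → ℝ

/-- The conditional mean function
`λ_{ijt} = exp (x_{ijt}' β + α_{it} + γ_{jt} + η_{ij})`. -/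
noncomputable def lam {N T K : ℕ} (x : Regressors N T K) (β : EuclideanSpace ℝ (Fin K))
    (α γ : CountryTime N T) (η : Pair N → ℝ) (p : Pair N) (t : Fin T) : ℝ :=
  Real.exp ((∑ k, x p t k * β k) + α p.1.1 t + γ p.1.2 t + η p)

/-- The three-way Poisson pseudo-log-likelihood
`∑_{i ≠ j} ∑_t (y_{ijt} log λ_{ijt} - λ_{ijt})`. -/
noncomputable def logLik {N T K : ℕ} (x : Regressors N T K) (y : Pair N → Fin T → ℝ)
    (β : EuclideanSpace ℝ (Fin K)) (α γ : CountryTime N T) (η : Pair N → ℝ) : ℝ :=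
  ∑ p : Pair N, ∑ t : Fin T,
    (y p t * Real.log (lam x β α γ η p t) - lam x β α γ η p t)

/-- The pseudo-log-likelihood of `β` after all three sets of fixed effects have been maximized out.
For nonnegative outcomes the supremum is over a set that is bounded above, since
`y log l - l ≤ y log y - y`. It need not be attained: a pair with only zero flows has `η̂ = -∞`. -/
noncomputable def concentratedLogLik {N T K : ℕ} (x : Regressors N T K)
    (y : Pair N → Fin T → ℝ) (β : EuclideanSpace ℝ (Fin K)) : ℝ :=
  ⨆ φ : CountryTime N T × CountryTime N T × (Pair N → ℝ), logLik x y β φ.1 φ.2.1 φ.2.2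

/-- `b` is a three-way FE-PPML estimate of `β` from the data `x, y`: it maximizes the
pseudo-log-likelihood in which the three sets of fixed effects have been maximized out. The
`β`-component of any joint maximizer of `logLik` is of this kind. -/
def IsFEPPML {N T K : ℕ} (x : Regressors N T K) (y : Pair N → Fin T → ℝ)
    (b : EuclideanSpace ℝ (Fin K)) : Prop :=
  ∀ b' : EuclideanSpace ℝ (Fin K), concentratedLogLik x y b' ≤ concentratedLogLik x y b

/-- Three-way panels for every number `N` of countries, on a common probability space: regressors,
outcomes, and the true exporter-time, importer-time and pair effects, all of them random. -/
structure Panel (Ω : Type*) [MeasurableSpace Ω] (T K : ℕ) where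
  x : (N : ℕ) → Ω → Regressors N T K
  y : (N : ℕ) → Ω → Pair N → Fin T → ℝ
  α : (N : ℕ) → Ω → CountryTime N T
  γ : (N : ℕ) → Ω → CountryTime N T
  η : (N : ℕ) → Ω → Pair N → ℝ
  measurable_x : ∀ N, Measurable (x N)
  measurable_y : ∀ N, Measurable (y N)
  measurable_α : ∀ N, Measurable (α N)
  measurable_γ : ∀ N, Measurable (γ N)
  measurable_η : ∀ N, Measurable (η N)

namespace Panel

variable {Ω : Type*} [mΩ : MeasurableSpace Ω] {T K : ℕ}

/-- The σ-algebra generated by all regressors and all true fixed effects of the `N`-country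
panel. -/
abbrev given (D : Panel Ω T K) (N : ℕ) : MeasurableSpace Ω :=
  MeasurableSpace.comap (fun ω => (D.x N ω, D.α N ω, D.γ N ω, D.η N ω)) inferInstance

theorem given_le (D : Panel Ω T K) (N : ℕ) : D.given N ≤ mΩ :=
  ((D.measurable_x N).prodMk ((D.measurable_α N).prodMk
    ((D.measurable_γ N).prodMk (D.measurable_η N)))).comap_le

/-- The σ-algebra generated by `x_{ijt}, α_{it}, γ_{jt}, η_{ij}` alone. -/
abbrev givenCell (D : Panel Ω T K) (N : ℕ) (p : Pair N) (t : Fin T) : MeasurableSpace Ω :=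
  MeasurableSpace.comap
    (fun ω => (D.x N ω p t, D.α N ω p.1.1 t, D.γ N ω p.1.2 t, D.η N ω p)) inferInstance

/-- `λ_{ijt}` at the true parameters. -/
noncomputable def trueLam (D : Panel Ω T K) (β₀ : EuclideanSpace ℝ (Fin K)) (N : ℕ) (ω : Ω)
    (p : Pair N) (t : Fin T) : ℝ :=
  lam (D.x N ω) β₀ (D.α N ω) (D.γ N ω) (D.η N ω) p t

/-- The shares `ϑ_{ijt} = λ_{ijt} / ∑_τ λ_{ijτ}` at the true parameters. -/
noncomputable def share (D : Panel Ω T K) (β₀ : EuclideanSpace ℝ (Fin K)) (N : ℕ) (ω : Ω)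
    (p : Pair N) (t : Fin T) : ℝ :=
  D.trueLam β₀ N ω p t / ∑ τ, D.trueLam β₀ N ω p τ

/-- The `T × T` Hessian matrix `H_{ij}`, minus the second derivative of the pair's profile
pseudo-log-likelihood `∑_t y_{ijt} log ϑ_{ijt}` in `α_i`, at the true parameters. -/
noncomputable def hess (D : Panel Ω T K) (β₀ : EuclideanSpace ℝ (Fin K)) (N : ℕ) (ω : Ω)
    (p : Pair N) : Matrix (Fin T) (Fin T) ℝ :=
  Matrix.of fun t s =>
    if t = s then D.share β₀ N ω p t * (1 - D.share β₀ N ω p t) * ∑ τ, D.y N ω p τ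
    else -(D.share β₀ N ω p s * D.share β₀ N ω p t) * ∑ τ, D.y N ω p τ

/-- The expected Hessian `H̄_{ij}`: the entrywise conditional expectation of `H_{ij}` given the
regressors and the fixed effects. -/
noncomputable def expHess (D : Panel Ω T K) (μ : Measure Ω) (β₀ : EuclideanSpace ℝ (Fin K))
    (N : ℕ) (ω : Ω) (p : Pair N) : Matrix (Fin T) (Fin T) ℝ :=
  Matrix.of fun t s => (μ[fun ω' => D.hess β₀ N ω' p t s | D.given N]) ω

/-- The `T × K` matrix `x_{ij} - a_i - g_j`. -/
def residual (D : Panel Ω T K) (N : ℕ) (ω : Ω) (a g : Fin N → Matrix (Fin T) (Fin K) ℝ)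
    (p : Pair N) : Matrix (Fin T) (Fin K) ℝ :=
  Matrix.of (D.x N ω p) - a p.1.1 - g p.1.2

/-- The criterion `∑_{i ≠ j} Tr [(x_{ij} - a_i - g_j)' H̄_{ij} (x_{ij} - a_i - g_j)]`. -/
noncomputable def projCriterion (D : Panel Ω T K) (μ : Measure Ω)
    (β₀ : EuclideanSpace ℝ (Fin K)) (N : ℕ) (ω : Ω)
    (a g : Fin N → Matrix (Fin T) (Fin K) ℝ) : ℝ :=
  ∑ p : Pair N, Matrix.trace
    ((D.residual N ω a g p).transpose * D.expHess μ β₀ N ω p * D.residual N ω a g p)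

/-- `a = (α_i^x)` and `g = (γ_j^x)` solve the weighted least squares problem that defines the
two-way within-transformation `x̃_{ij} = x_{ij} - α_i^x - γ_j^x`. -/
def IsProjection (D : Panel Ω T K) (μ : Measure Ω) (β₀ : EuclideanSpace ℝ (Fin K)) (N : ℕ)
    (ω : Ω) (a g : Fin N → Matrix (Fin T) (Fin K) ℝ) : Prop :=
  ∀ a' g' : Fin N → Matrix (Fin T) (Fin K) ℝ,
    D.projCriterion μ β₀ N ω a g ≤ D.projCriterion μ β₀ N ω a' g'

/-- The `K × K` matrix `W_N = (N (N - 1))⁻¹ ∑_{i ≠ j} x̃_{ij}' H̄_{ij} x̃_{ij}` for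
`x̃_{ij} = x_{ij} - a_i - g_j`. Its value is the same for all solutions `(a, g)` of the least
squares problem, so that no normalization of `a` and `g` is needed. -/
noncomputable def wMat (D : Panel Ω T K) (μ : Measure Ω) (β₀ : EuclideanSpace ℝ (Fin K))
    (N : ℕ) (ω : Ω) (a g : Fin N → Matrix (Fin T) (Fin K) ℝ) : Matrix (Fin K) (Fin K) ℝ :=
  ((N : ℝ) * ((N : ℝ) - 1))⁻¹ • ∑ p : Pair N,
    (D.residual N ω a g p).transpose * D.expHess μ β₀ N ω p * D.residual N ω a g p

/-- The three-way gravity model with strictly exogenous regressors and its regularity conditions,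
at the true value `β₀` of `β`. -/
structure Regular [StandardBorelSpace Ω] (D : Panel Ω T K) (μ : Measure Ω) [IsFiniteMeasure μ]
    (β₀ : EuclideanSpace ℝ (Fin K)) : Prop where
  /-- Outcomes are nonnegative. -/
  nonneg : ∀ N p t, ∀ᵐ ω ∂μ, 0 ≤ D.y N ω p t
  /-- Outcomes are integrable. -/
  integrable : ∀ N p t, Integrable (fun ω => D.y N ω p t) μ
  /-- Strict exogeneity: `E(y_{ijt} | x, α, γ, η) = λ_{ijt}`, that is, the disturbance
  `y_{ijt} / λ_{ijt}` has mean one given all regressors and all fixed effects. -/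
  exogenous : ∀ N p t,
    μ[fun ω => D.y N ω p t | D.given N] =ᵐ[μ] fun ω => D.trueLam β₀ N ω p t
  /-- Given the regressors and the fixed effects, the `T`-vectors `y_{ij}` are independent across
  pairs; the dependence over `t` is unrestricted. -/
  condIndep : ∀ N, iCondIndepFun (D.given N) (D.given_le N)
    (fun (p : Pair N) (ω : Ω) => D.y N ω p) μ
  /-- The regressors, the exporter-time and the importer-time effects are uniformly bounded. -/
  bounded : ∃ M : ℝ, ∀ N, ∀ᵐ ω ∂μ,
    (∀ p t k, |D.x N ω p t k| ≤ M) ∧ (∀ i t, |D.α N ω i t| ≤ M) ∧ (∀ j t, |D.γ N ω j t| ≤ M)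
  /-- Uniformly bounded conditional moments of some order above eight. -/
  moments : ∃ ν : ℝ, 0 < ν ∧ ∃ C : ℝ, ∀ N p t,
    Integrable (fun ω => D.y N ω p t ^ (8 + ν)) μ ∧
    ∀ᵐ ω ∂μ, (μ[fun ω' => D.y N ω' p t ^ (8 + ν) | D.givenCell N p t]) ω ≤ C
  /-- Non-collinearity: `W_N` converges to a positive definite matrix. -/
  noncollinear : ∀ᵐ ω ∂μ, ∃ a g : (N : ℕ) → Fin N → Matrix (Fin T) (Fin K) ℝ,
    (∀ N, D.IsProjection μ β₀ N ω (a N) (g N)) ∧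
    ∃ W : Matrix (Fin K) (Fin K) ℝ, W.PosDef ∧
      Tendsto (fun N => D.wMat μ β₀ N ω (a N) (g N)) atTop (𝓝 W)

end Panel

end Gravity

/-! For each pair the Poisson pseudo-likelihood splits into a term in the pair total, the only one
that involves `η`, and a multinomial logit likelihood in the indices `x'β + α + γ`. Maximizing over
`η` removes the first term, so only `K + 2NT` parameters remain for about `N²` conditionally
independent pairs. The concentrated objective is concave in `β`. Hence existence and consistency
both follow once, on the sphere `‖β - β₀‖ = ε`, the profile likelihood lies below its value at the
truth by a margin that is uniform over all `α` and `γ` (`isFEPPML_of_profileLik_lt`). The fixed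
effects range over a noncompact space of growing dimension; the two halves of the argument deal with
this.

The inequality `log r ≤ 2(√r - 1)` bounds the likelihood difference by twice a noise term minus a
divergence (`profileLik_le_of_hellinger`). The noise is linear in `y - λ` with weights `√(θ/ϑ) - 1`.
These are bounded over all parameters, because the true shares `ϑ` are bounded below. The divergence
sums squared Hellinger distances between `θ` and `ϑ`, weighted by the pair means.

Noise: outcomes are truncated at `N^(1/4)`, and Markov's inequality handles the excess. Up to a
small error, the square roots of the logit probabilities depend only on which of polynomially many
affine half-spaces contain the parameter. By Sauer–Shelah this yields a net of log-size `O(N log N)`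
over the whole parameter space (`exists_net`). Conditionally on regressors and fixed effects,
Hoeffding's inequality has an exponent of order `N^(5/4)`, which beats the net. The noise is thus at
most of order `N^(15/8)` with probability tending to one.

Divergence: non-collinearity says that `x'(β - β₀)` cannot be fitted by two-way and pair effects
with weighted squared error below a multiple of `N²` (`Panel.Regular.exists_eventually_quadratic`).
A small Hellinger distance controls index differences within a pair, but a pair with a large
distance says nothing about how large its effects are. `exists_bounded_contraction` replaces
arbitrary effects by bounded ones while changing few of the relevant sums, so the pairs with large
distance can be paid for. The divergence is then at least `δ N²`, which dominates the noise. -/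

namespace Gravity

/-! ### Profiling out the pair effects, and concavity in `β` -/

section Optimization

variable {N T K : ℕ}

/-- The linear index `x_{ijt}' β + α_{it} + γ_{jt}`. -/
noncomputable def index (x : Regressors N T K) (β : EuclideanSpace ℝ (Fin K))
    (α γ : CountryTime N T) (p : Pair N) (t : Fin T) : ℝ :=
  (∑ k, x p t k * β k) + α p.1.1 t + γ p.1.2 t

/-- The multinomial logit probabilities of the indices. -/
noncomputable def softmax {ι : Type*} [Fintype ι] (u : ι → ℝ) (t : ι) : ℝ :=
  Real.exp (u t) / ∑ s, Real.exp (u s)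

/-- The pseudo-log-likelihood with the pair effects profiled out, up to a constant. -/
noncomputable def profileLik (x : Regressors N T K) (y : Pair N → Fin T → ℝ)
    (β : EuclideanSpace ℝ (Fin K)) (α γ : CountryTime N T) : ℝ :=
  ∑ p : Pair N, ∑ t, y p t * Real.log (softmax (index x β α γ p) t)

/-- The part of the profile pseudo-log-likelihood that is free of parameters. -/
noncomputable def pairConst (y : Pair N → Fin T → ℝ) : ℝ :=
  ∑ p : Pair N, ((∑ t, y p t) * Real.log (∑ t, y p t) - ∑ t, y p t)

theorem sum_exp_pos {ι : Type*} [Fintype ι] [Nonempty ι] (u : ι → ℝ) :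
    0 < ∑ s, Real.exp (u s) :=
  Finset.sum_pos (fun _ _ => Real.exp_pos _) Finset.univ_nonempty

theorem softmax_pos {ι : Type*} [Fintype ι] (u : ι → ℝ) (t : ι) : 0 < softmax u t := by
  have : Nonempty ι := ⟨t⟩
  exact div_pos (Real.exp_pos _) (sum_exp_pos u)

theorem sum_softmax {ι : Type*} [Fintype ι] [Nonempty ι] (u : ι → ℝ) :
    ∑ t, softmax u t = 1 := by
  unfold softmax
  rw [← Finset.sum_div, div_self (sum_exp_pos u).ne']

theorem softmax_le_one {ι : Type*} [Fintype ι] (u : ι → ℝ) (t : ι) : softmax u t ≤ 1 := by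
  have : Nonempty ι := ⟨t⟩
  rw [← sum_softmax u]
  exact Finset.single_le_sum (fun s _ => (softmax_pos u s).le) (Finset.mem_univ t)

theorem log_softmax {ι : Type*} [Fintype ι] (u : ι → ℝ) (t : ι) :
    Real.log (softmax u t) = u t - Real.log (∑ s, Real.exp (u s)) := by
  have : Nonempty ι := ⟨t⟩
  rw [softmax, Real.log_div (Real.exp_pos _).ne' (sum_exp_pos u).ne', Real.log_exp]

/-- The normalizer of the logit probabilities combines with `η` into the log of the total mean, so
`η` affects only the Poisson likelihood of the total. -/
theorem sum_poisson_eq {ι : Type*} [Fintype ι] (y u : ι → ℝ) (η : ℝ) :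
    ∑ t, (y t * (u t + η) - Real.exp (u t + η)) =
      ∑ t, y t * Real.log (softmax u t) +
        ((∑ t, y t) * (Real.log (∑ s, Real.exp (u s)) + η)
          - Real.exp η * ∑ s, Real.exp (u s)) := by
  simp only [log_softmax, Real.exp_add, Finset.sum_sub_distrib, mul_add, mul_sub,
    Finset.sum_add_distrib, Finset.sum_mul, Finset.mul_sum]
  have : ∑ t, Real.exp (u t) * Real.exp η = ∑ t, Real.exp η * Real.exp (u t) :=
    Finset.sum_congr rfl fun t _ => mul_comm _ _
  rw [this]; ring

theorem mul_log_sub_le {Y w : ℝ} (hY : 0 ≤ Y) (hw : 0 < w) :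
    Y * Real.log w - w ≤ Y * Real.log Y - Y := by
  rcases hY.eq_or_lt with rfl | hY
  · simp [hw.le]
  · have h := Real.log_le_sub_one_of_pos (div_pos hw hY)
    rw [Real.log_div hw.ne' hY.ne'] at h
    have h2 := mul_le_mul_of_nonneg_left h hY.le
    have h3 : Y * (w / Y - 1) = w - Y := by field_simp
    nlinarith

theorem sum_poisson_le {ι : Type*} [Fintype ι] (y u : ι → ℝ) (hy : ∀ t, 0 ≤ y t) (η : ℝ) :
    ∑ t, (y t * (u t + η) - Real.exp (u t + η)) ≤
      ∑ t, y t * Real.log (softmax u t) +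
        ((∑ t, y t) * Real.log (∑ t, y t) - ∑ t, y t) := by
  rcases isEmpty_or_nonempty ι with h | h
  · simp
  rw [sum_poisson_eq]
  have hS := sum_exp_pos u
  have := mul_log_sub_le (Finset.sum_nonneg fun t (_ : t ∈ Finset.univ) => hy t)
    (mul_pos (Real.exp_pos η) hS)
  rw [Real.log_mul (Real.exp_pos _).ne' hS.ne', Real.log_exp] at this
  linarith [add_comm η (Real.log (∑ s, Real.exp (u s)))]

theorem exists_sum_poisson_ge {ι : Type*} [Fintype ι] (y u : ι → ℝ) (hy : ∀ t, 0 ≤ y t)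
    {δ : ℝ} (hδ : 0 < δ) :
    ∃ η : ℝ, ∑ t, y t * Real.log (softmax u t) +
        ((∑ t, y t) * Real.log (∑ t, y t) - ∑ t, y t) - δ ≤
      ∑ t, (y t * (u t + η) - Real.exp (u t + η)) := by
  rcases isEmpty_or_nonempty ι with h | h
  · exact ⟨0, by simpa using hδ.le⟩
  have hS := sum_exp_pos u
  simp only [sum_poisson_eq]
  rcases (Finset.sum_nonneg fun t (_ : t ∈ Finset.univ) => hy t).eq_or_lt with h0 | h0
  -- With zero total the supremum is approached only as `η → -∞`; this `η` makes the total mean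
  -- equal to the allowed loss `δ`.
  · refine ⟨Real.log (δ / ∑ s, Real.exp (u s)), ?_⟩
    rw [← h0, Real.exp_log (div_pos hδ hS), div_mul_cancel₀ _ hS.ne']
    simp
  · refine ⟨Real.log ((∑ t, y t) / ∑ s, Real.exp (u s)), ?_⟩
    rw [Real.exp_log (div_pos h0 hS), div_mul_cancel₀ _ hS.ne',
      Real.log_div h0.ne' hS.ne']
    have : Real.log (∑ s, Real.exp (u s)) +
      (Real.log (∑ t, y t) - Real.log (∑ s, Real.exp (u s))) = Real.log (∑ t, y t) := by ring
    rw [this]; linarith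

theorem lam_eq (x : Regressors N T K) (β : EuclideanSpace ℝ (Fin K)) (α γ : CountryTime N T)
    (η : Pair N → ℝ) (p : Pair N) (t : Fin T) :
    lam x β α γ η p t = Real.exp (index x β α γ p t + η p) := rfl

theorem logLik_le (x : Regressors N T K) (y : Pair N → Fin T → ℝ) (hy : ∀ p t, 0 ≤ y p t)
    (β : EuclideanSpace ℝ (Fin K)) (α γ : CountryTime N T) (η : Pair N → ℝ) :
    logLik x y β α γ η ≤ profileLik x y β α γ + pairConst y := by
  rw [logLik, profileLik, pairConst, ← Finset.sum_add_distrib]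
  refine Finset.sum_le_sum fun p _ => ?_
  simp only [lam_eq, Real.log_exp]
  exact sum_poisson_le _ _ (hy p) _

theorem profileLik_nonpos (x : Regressors N T K) (y : Pair N → Fin T → ℝ)
    (hy : ∀ p t, 0 ≤ y p t) (β : EuclideanSpace ℝ (Fin K)) (α γ : CountryTime N T) :
    profileLik x y β α γ ≤ 0 :=
  Finset.sum_nonpos fun p _ => Finset.sum_nonpos fun t _ =>
    mul_nonpos_of_nonneg_of_nonpos (hy p t)
      (Real.log_nonpos (softmax_pos _ _).le (softmax_le_one _ _))

theorem bddAbove_logLik (x : Regressors N T K) (y : Pair N → Fin T → ℝ)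
    (hy : ∀ p t, 0 ≤ y p t) (β : EuclideanSpace ℝ (Fin K)) :
    BddAbove (Set.range fun φ : CountryTime N T × CountryTime N T × (Pair N → ℝ) =>
      logLik x y β φ.1 φ.2.1 φ.2.2) := by
  refine ⟨pairConst y, ?_⟩
  rintro _ ⟨φ, rfl⟩
  have h1 := logLik_le x y hy β φ.1 φ.2.1 φ.2.2
  have h2 := profileLik_nonpos x y hy β φ.1 φ.2.1
  simp only
  linarith

theorem profileLik_le_concentratedLogLik (x : Regressors N T K) (y : Pair N → Fin T → ℝ)
    (hy : ∀ p t, 0 ≤ y p t) (β : EuclideanSpace ℝ (Fin K)) (α γ : CountryTime N T) :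
    profileLik x y β α γ + pairConst y ≤ concentratedLogLik x y β := by
  refine le_of_forall_pos_le_add fun ε hε => ?_
  -- The loss `ε` is shared among the pairs; the `+ 1` keeps the share well defined when there are
  -- none.
  have hc : (0 : ℝ) < Fintype.card (Pair N) + 1 := by positivity
  choose η hη using fun p => exists_sum_poisson_ge (y p) (index x β α γ p) (hy p) (div_pos hε hc)
  have h1 : logLik x y β α γ η ≤ concentratedLogLik x y β :=
    le_ciSup (bddAbove_logLik x y hy β) (α, γ, η)
  have h2 : profileLik x y β α γ + pairConst y
      - Fintype.card (Pair N) * (ε / (Fintype.card (Pair N) + 1)) ≤ logLik x y β α γ η := by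
    have := Finset.sum_le_sum fun p (_ : p ∈ Finset.univ) => hη p
    rw [Finset.sum_sub_distrib, Finset.sum_add_distrib, Finset.sum_const, Finset.card_univ,
      nsmul_eq_mul] at this
    simp only [logLik, lam_eq, Real.log_exp]
    exact this
  have h3 : (Fintype.card (Pair N) : ℝ) * (ε / (Fintype.card (Pair N) + 1)) ≤ ε := by
    rw [mul_div_assoc', div_le_iff₀ hc]
    nlinarith
  linarith

theorem concentratedLogLik_le (x : Regressors N T K) (y : Pair N → Fin T → ℝ)
    (hy : ∀ p t, 0 ≤ y p t) (β : EuclideanSpace ℝ (Fin K)) {c : ℝ}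
    (hc : ∀ α γ, profileLik x y β α γ ≤ c) : concentratedLogLik x y β ≤ c + pairConst y :=
  ciSup_le fun φ => (logLik_le x y hy β φ.1 φ.2.1 φ.2.2).trans (by linarith [hc φ.1 φ.2.1])

theorem index_combo (x : Regressors N T K) (β β' : EuclideanSpace ℝ (Fin K))
    (α γ α' γ' : CountryTime N T) (a b : ℝ) (p : Pair N) (t : Fin T) :
    index x (a • β + b • β') (a • α + b • α') (a • γ + b • γ') p t =
      a * index x β α γ p t + b * index x β' α' γ' p t := by
  simp only [index, PiLp.add_apply, PiLp.smul_apply, Pi.add_apply, Pi.smul_apply, smul_eq_mul,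
    mul_add, Finset.sum_add_distrib, Finset.mul_sum]
  have h1 : ∑ k, x p t k * (a * β k) = ∑ k, a * (x p t k * β k) :=
    Finset.sum_congr rfl fun k _ => by ring
  have h2 : ∑ k, x p t k * (b * β' k) = ∑ k, b * (x p t k * β' k) :=
    Finset.sum_congr rfl fun k _ => by ring
  rw [h1, h2]; ring

/-- `log λ` is linear in the parameters, so the only curvature is that of `-exp`. -/
theorem logLik_combo (x : Regressors N T K) (y : Pair N → Fin T → ℝ)
    (β β' : EuclideanSpace ℝ (Fin K)) (α γ α' γ' : CountryTime N T) (η η' : Pair N → ℝ)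
    {a b : ℝ} (ha : 0 ≤ a) (hb : 0 ≤ b) (hab : a + b = 1) :
    a * logLik x y β α γ η + b * logLik x y β' α' γ' η' ≤
      logLik x y (a • β + b • β') (a • α + b • α') (a • γ + b • γ') (a • η + b • η') := by
  simp only [logLik, lam_eq, Real.log_exp, index_combo, Finset.mul_sum, ← Finset.sum_add_distrib]
  refine Finset.sum_le_sum fun p _ => Finset.sum_le_sum fun t _ => ?_
  have h := convexOn_exp.2 (Set.mem_univ (index x β α γ p t + η p))
    (Set.mem_univ (index x β' α' γ' p t + η' p)) ha hb hab
  simp only [smul_eq_mul, Pi.add_apply, Pi.smul_apply] at h ⊢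
  have e : a * (index x β α γ p t + η p) + b * (index x β' α' γ' p t + η' p) =
    a * index x β α γ p t + b * index x β' α' γ' p t + (a * η p + b * η' p) := by ring
  rw [e] at h
  linarith

/-- Partial maximization of a jointly concave function preserves concavity. -/
theorem concaveOn_concentratedLogLik (x : Regressors N T K) (y : Pair N → Fin T → ℝ)
    (hy : ∀ p t, 0 ≤ y p t) : ConcaveOn ℝ Set.univ (concentratedLogLik x y) := by
  refine ⟨convex_univ, fun β _ β' _ a b ha hb hab => ?_⟩
  simp only [smul_eq_mul]
  have key : ∀ φ φ' : CountryTime N T × CountryTime N T × (Pair N → ℝ),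
      a * logLik x y β φ.1 φ.2.1 φ.2.2 + b * logLik x y β' φ'.1 φ'.2.1 φ'.2.2 ≤
        concentratedLogLik x y (a • β + b • β') := fun φ φ' =>
    (logLik_combo x y β β' _ _ _ _ _ _ ha hb hab).trans
      (le_ciSup (bddAbove_logLik x y hy (a • β + b • β')) (a • φ + b • φ'))
  have h1 : ∀ φ' : CountryTime N T × CountryTime N T × (Pair N → ℝ),
      a * concentratedLogLik x y β ≤ concentratedLogLik x y (a • β + b • β')
        - b * logLik x y β' φ'.1 φ'.2.1 φ'.2.2 := fun φ' => by
    rw [concentratedLogLik, Real.mul_iSup_of_nonneg ha]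
    exact ciSup_le fun φ => by linarith [key φ φ']
  have h2 : b * concentratedLogLik x y β' ≤ concentratedLogLik x y (a • β + b • β')
      - a * concentratedLogLik x y β := by
    rw [concentratedLogLik, Real.mul_iSup_of_nonneg hb]
    exact ciSup_le fun φ => by linarith [h1 φ]
  linarith

/-- A concave function that is smaller on a sphere than at its centre attains its maximum, and only
inside the sphere. -/
theorem exists_maximizer_of_concaveOn {E : Type*} [NormedAddCommGroup E] [NormedSpace ℝ E]
    [FiniteDimensional ℝ E] {f : E → ℝ} (hf : ConcaveOn ℝ Set.univ f) (c : E) {ε : ℝ} (hε : 0 < ε)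
    (h : ∀ b, ‖b - c‖ = ε → f b < f c) :
    (∃ b, ∀ b', f b' ≤ f b) ∧ ∀ b, (∀ b', f b' ≤ f b) → ‖b - c‖ ≤ ε := by
  have out : ∀ b, ε < ‖b - c‖ → f b < f c := by
    intro b hb
    by_contra! hcb
    have hn : 0 < ‖b - c‖ := hε.trans hb
    -- The segment from `c` to `b` meets the sphere at parameter `s`; if `f b ≥ f c`, concavity
    -- would give a value of at least `f c` there.
    set s := ε / ‖b - c‖ with hs
    have hs0 : 0 ≤ s := by positivity
    have hs1 : s ≤ 1 := by rw [hs, div_le_one hn]; exact hb.le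
    have hmem := hf.2 (Set.mem_univ c) (Set.mem_univ b) (sub_nonneg.2 hs1) hs0 (by ring)
    have hpt : (1 - s) • c + s • b - c = s • (b - c) := by module
    have hnorm : ‖(1 - s) • c + s • b - c‖ = ε := by
      rw [hpt, norm_smul, Real.norm_of_nonneg hs0, hs, div_mul_cancel₀ _ hn.ne']
    have := h _ hnorm
    simp only [smul_eq_mul] at hmem
    nlinarith
  have hcont : Continuous f := by
    rw [← continuousOn_univ]
    exact hf.continuousOn isOpen_univ
  constructor
  · have hne : (Metric.closedBall c ε).Nonempty := ⟨c, Metric.mem_closedBall_self hε.le⟩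
    obtain ⟨b, hb, hmax⟩ := (isCompact_closedBall c ε).exists_isMaxOn hne hcont.continuousOn
    refine ⟨b, fun b' => ?_⟩
    rcases le_or_gt ‖b' - c‖ ε with h1 | h1
    · exact hmax (by simpa [dist_eq_norm] using h1)
    · exact (out b' h1).le.trans (hmax (Metric.mem_closedBall_self hε.le))
  · intro b hb
    by_contra! h1
    exact (out b h1).not_ge (hb c)

/-- The margin `c` has to be uniform in the fixed effects to survive their supremum. At the centre a
single choice of effects suffices, since it bounds the supremum from below. -/
theorem isFEPPML_of_profileLik_lt (x : Regressors N T K) (y : Pair N → Fin T → ℝ)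
    (hy : ∀ p t, 0 ≤ y p t) (β₀ : EuclideanSpace ℝ (Fin K)) (α₀ γ₀ : CountryTime N T)
    {ε c : ℝ} (hε : 0 < ε) (hc : 0 < c)
    (h : ∀ β, ‖β - β₀‖ = ε → ∀ α γ, profileLik x y β α γ ≤ profileLik x y β₀ α₀ γ₀ - c) :
    (∃ b, IsFEPPML x y b) ∧ ∀ b, IsFEPPML x y b → ‖b - β₀‖ ≤ ε := by
  refine exists_maximizer_of_concaveOn (concaveOn_concentratedLogLik x y hy) β₀ hε
    fun b hb => ?_
  have h1 := concentratedLogLik_le x y hy b (h b hb)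
  have h2 := profileLik_le_concentratedLogLik x y hy β₀ α₀ γ₀
  linarith

end Optimization

end Gravity

namespace Gravity

/-! ### Likelihood ratios and Hellinger distance -/

section Hellinger

variable {ι : Type*} [Fintype ι]

/-- The squared Hellinger distance between the logit probabilities of two index vectors. -/
noncomputable def hellinger (u v : ι → ℝ) : ℝ :=
  ∑ t, (Real.sqrt (softmax u t) - Real.sqrt (softmax v t)) ^ 2

theorem hellinger_nonneg (u v : ι → ℝ) : 0 ≤ hellinger u v :=
  Finset.sum_nonneg fun _ _ => sq_nonneg _

/-- The log-likelihood ratio is unbounded below when fixed effects diverge. Its majorant in terms of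
the square root is bounded on both sides once the true probability in the denominator is bounded
below. -/
theorem log_le_two_mul_sqrt_sub_one {r : ℝ} (hr : 0 < r) :
    Real.log r ≤ 2 * (Real.sqrt r - 1) := by
  have h := Real.log_le_sub_one_of_pos (Real.sqrt_pos.2 hr)
  rw [Real.log_sqrt hr.le] at h
  linarith

theorem sum_mul_log_softmax_le (y u v : ι → ℝ) (hy : ∀ t, 0 ≤ y t) :
    ∑ t, y t * Real.log (softmax u t) ≤ ∑ t, y t * Real.log (softmax v t) +
      2 * ∑ t, y t * (Real.sqrt (softmax u t / softmax v t) - 1) := by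
  rw [Finset.mul_sum, ← Finset.sum_add_distrib]
  refine Finset.sum_le_sum fun t _ => ?_
  have h := log_le_two_mul_sqrt_sub_one (div_pos (softmax_pos u t) (softmax_pos v t))
  rw [Real.log_div (softmax_pos u t).ne' (softmax_pos v t).ne'] at h
  nlinarith [mul_le_mul_of_nonneg_left h (hy t)]

theorem two_mul_sum_softmax_mul_sqrt_div (u v : ι → ℝ) :
    2 * ∑ t, softmax v t * (Real.sqrt (softmax u t / softmax v t) - 1) = -hellinger u v := by
  rcases isEmpty_or_nonempty ι with h | h
  · simp [hellinger]
  have key : ∀ t, 2 * (softmax v t * (Real.sqrt (softmax u t / softmax v t) - 1)) =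
      softmax u t - softmax v t - (Real.sqrt (softmax u t) - Real.sqrt (softmax v t)) ^ 2 := by
    intro t
    have hu := Real.sq_sqrt (softmax_pos u t).le
    have hv := Real.sq_sqrt (softmax_pos v t).le
    have hv0 := Real.sqrt_pos.2 (softmax_pos v t)
    rw [Real.sqrt_div (softmax_pos u t).le]
    generalize Real.sqrt (softmax u t) = a at *
    generalize Real.sqrt (softmax v t) = b at *
    rw [← hu, ← hv]
    field_simp
    ring
  rw [Finset.mul_sum, Finset.sum_congr rfl fun t _ => key t, Finset.sum_sub_distrib,
    Finset.sum_sub_distrib, sum_softmax, sum_softmax, hellinger]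
  ring

theorem abs_log_le_two_mul {q : ℝ} (hq : |q - 1| ≤ 1 / 2) : |Real.log q| ≤ 2 * |q - 1| := by
  obtain ⟨h1, h2⟩ := abs_le.1 hq
  have hq0 : 0 < q := by linarith
  rw [abs_le]
  constructor
  · have h := Real.log_le_sub_one_of_pos (inv_pos.2 hq0)
    rw [Real.log_inv] at h
    have h3 : q⁻¹ - 1 ≤ 2 * |q - 1| := by
      rw [inv_eq_one_div, sub_le_iff_le_add, div_le_iff₀ hq0]
      rcases le_total q 1 with hq1 | hq1
      · rw [abs_of_nonpos (by linarith)]; nlinarith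
      · rw [abs_of_nonneg (by linarith)]; nlinarith
    linarith
  · have h := Real.log_le_sub_one_of_pos hq0
    linarith [le_abs_self (q - 1), abs_nonneg (q - 1)]

/-- Each ratio of square roots is within `δ = √(h/κ) ≤ 1/2` of one, where `h` is the squared
Hellinger distance, so its logarithm is at most `2δ` in size. Twice this logarithm is `u t - v t` up
to a normalizer that cancels between `s` and `t`; the total is `8δ`, and `8² = 64`. -/
theorem sq_sub_le_of_hellinger_le {u v : ι → ℝ} {κ : ℝ} (hκ : 0 < κ)
    (hv : ∀ t, κ ≤ softmax v t) (h : hellinger u v ≤ κ / 4) (s t : ι) :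
    ((u t - v t) - (u s - v s)) ^ 2 ≤ 64 / κ * hellinger u v := by
  set δ := Real.sqrt (hellinger u v / κ) with hδ
  have hδ0 : 0 ≤ δ := Real.sqrt_nonneg _
  have hδsq : δ ^ 2 = hellinger u v / κ := Real.sq_sqrt (div_nonneg (hellinger_nonneg u v) hκ.le)
  have hδ2 : δ ≤ 1 / 2 := by
    apply Real.sqrt_le_iff.2 ⟨by norm_num, ?_⟩
    rw [div_le_iff₀ hκ]; linarith
  have hq : ∀ t, |Real.sqrt (softmax u t) / Real.sqrt (softmax v t) - 1| ≤ δ := by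
    intro t
    have hv0 := Real.sqrt_pos.2 (softmax_pos v t)
    apply abs_le_of_sq_le_sq _ hδ0
    rw [hδsq, div_sub_one hv0.ne', div_pow, Real.sq_sqrt (softmax_pos v t).le]
    refine div_le_div₀ (hellinger_nonneg u v) ?_ hκ (hv t)
    exact Finset.single_le_sum
      (f := fun t => (Real.sqrt (softmax u t) - Real.sqrt (softmax v t)) ^ 2)
      (fun _ _ => sq_nonneg _) (Finset.mem_univ t)
  have hlog : ∀ t, |Real.log (Real.sqrt (softmax u t) / Real.sqrt (softmax v t))| ≤ 2 * δ :=
    fun t => (abs_log_le_two_mul ((hq t).trans hδ2)).trans (by linarith [hq t])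
  have hform : ∀ t, 2 * Real.log (Real.sqrt (softmax u t) / Real.sqrt (softmax v t)) =
      u t - v t - (Real.log (∑ s, Real.exp (u s)) - Real.log (∑ s, Real.exp (v s))) := by
    intro t
    rw [Real.log_div (Real.sqrt_pos.2 (softmax_pos u t)).ne'
      (Real.sqrt_pos.2 (softmax_pos v t)).ne', Real.log_sqrt (softmax_pos u t).le,
      Real.log_sqrt (softmax_pos v t).le, log_softmax, log_softmax]
    ring
  have habs : |(u t - v t) - (u s - v s)| ≤ 8 * δ := by
    have e : (u t - v t) - (u s - v s) =
      2 * Real.log (Real.sqrt (softmax u t) / Real.sqrt (softmax v t)) -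
      2 * Real.log (Real.sqrt (softmax u s) / Real.sqrt (softmax v s)) := by
        rw [hform, hform]; ring
    rw [e, abs_le]
    obtain ⟨h1, h2⟩ := abs_le.1 (hlog t)
    obtain ⟨h3, h4⟩ := abs_le.1 (hlog s)
    constructor <;> linarith
  calc ((u t - v t) - (u s - v s)) ^ 2 = |(u t - v t) - (u s - v s)| ^ 2 := (sq_abs _).symm
    _ ≤ (8 * δ) ^ 2 := by gcongr
    _ = 64 / κ * hellinger u v := by rw [mul_pow, hδsq]; ring

end Hellinger

/-- With `m` the conditional means, `hm` says that their shares are the true probabilities.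
Replacing `y` by `m` in the square-root bound then gives exactly minus the weighted Hellinger term,
and `y - m` remains as noise. -/
theorem profileLik_le_of_hellinger {N T K : ℕ} (x : Regressors N T K) (y : Pair N → Fin T → ℝ)
    (hy : ∀ p t, 0 ≤ y p t) (β β₀ : EuclideanSpace ℝ (Fin K)) (α γ α₀ γ₀ : CountryTime N T)
    (m : Pair N → Fin T → ℝ)
    (hm : ∀ p t, m p t = (∑ s, m p s) * softmax (index x β₀ α₀ γ₀ p) t) :
    profileLik x y β α γ ≤ profileLik x y β₀ α₀ γ₀ +
      2 * ∑ p, ∑ t, (y p t - m p t) *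
        (Real.sqrt (softmax (index x β α γ p) t / softmax (index x β₀ α₀ γ₀ p) t) - 1) -
      ∑ p, (∑ t, m p t) * hellinger (index x β α γ p) (index x β₀ α₀ γ₀ p) := by
  simp only [profileLik]
  rw [Finset.mul_sum, ← Finset.sum_add_distrib, ← Finset.sum_sub_distrib]
  refine Finset.sum_le_sum fun p _ => ?_
  have h1 := sum_mul_log_softmax_le (y p) (index x β α γ p) (index x β₀ α₀ γ₀ p) (hy p)
  have h2 := two_mul_sum_softmax_mul_sqrt_div (index x β α γ p) (index x β₀ α₀ γ₀ p)
  have h3 : ∑ t, m p t *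
      (Real.sqrt (softmax (index x β α γ p) t / softmax (index x β₀ α₀ γ₀ p) t) - 1) =
      (∑ t, m p t) * ∑ t, softmax (index x β₀ α₀ γ₀ p) t *
      (Real.sqrt (softmax (index x β α γ p) t / softmax (index x β₀ α₀ γ₀ p) t) - 1) := by
    rw [Finset.mul_sum]
    refine Finset.sum_congr rfl fun t _ => ?_
    rw [← mul_assoc, ← hm]
  simp only [sub_mul, Finset.sum_sub_distrib, h3]
  linear_combination h1 + (∑ t, m p t) * h2

end Gravity

namespace Gravity

/-! ### Replacing unbounded fixed effects by bounded ones -/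

section Truncation

-- `Φ` has slope one on the set `U` of points with at least `m` of the `a i` within distance `2R`,
-- and slope zero elsewhere, so sparse stretches of the line are collapsed. Markov's inequality for
-- Lebesgue measure bounds the length of `U`, hence the oscillation of `Φ`.
open Classical in
theorem exists_bounded_contraction {N : ℕ} (a : Fin N → ℝ) {R m : ℝ} (hR : 0 < R) (hm : 0 < m) :
    ∃ Φ : ℝ → ℝ, (∀ v w, |Φ v - Φ w| ≤ |v - w|) ∧ (∀ v w, |Φ v - Φ w| ≤ 4 * R * N / m) ∧
      ∀ w, ((Finset.univ.filter fun i => |a i - w| ≤ R ∧ Φ (a i) - Φ w ≠ a i - w).card : ℝ)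
        ≤ m := by
  set ρ : ℝ → ℝ := fun v => ∑ i, (Metric.closedBall (a i) (2 * R)).indicator (fun _ => (1 : ℝ)) v
    with hρ
  have hint : ∀ i, Integrable
      ((Metric.closedBall (a i) (2 * R)).indicator (fun _ => (1 : ℝ))) volume := fun i =>
    (integrable_indicator_iff Metric.isClosed_closedBall.measurableSet).2
      (integrableOn_const measure_closedBall_lt_top.ne)
  have hρint : Integrable ρ volume := integrable_finsetSum _ fun i _ => hint i
  have hρ0 : ∀ v, 0 ≤ ρ v := fun v => Finset.sum_nonneg fun i _ =>
    Set.indicator_nonneg (fun _ _ => zero_le_one) _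
  have hρI : ∫ v, ρ v = 4 * R * N := by
    rw [hρ, integral_finsetSum _ fun i _ => hint i]
    have : ∀ i, ∫ v, (Metric.closedBall (a i) (2 * R)).indicator (fun _ => (1 : ℝ)) v = 4 * R := by
      intro i
      rw [integral_indicator Metric.isClosed_closedBall.measurableSet, setIntegral_const,
        measureReal_def, Real.volume_closedBall, ENNReal.toReal_ofReal (by positivity)]
      simp; ring
    simp only [this, Finset.sum_const, Finset.card_univ, Fintype.card_fin, nsmul_eq_mul]
    ring
  set U : Set ℝ := {v | m ≤ ρ v} with hU
  have hρm : Measurable ρ := Finset.measurable_sum _ fun i _ =>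
    measurable_const.indicator Metric.isClosed_closedBall.measurableSet
  have hUm : MeasurableSet U := measurableSet_le measurable_const hρm
  have hmarkov : m * volume.real U ≤ 4 * R * N := by
    rw [← hρI]
    exact mul_meas_ge_le_integral_of_nonneg (Eventually.of_forall hρ0) hρint m
  have hUfin : volume U ≠ ⊤ := (hρint.measure_ge_lt_top hm).ne
  have hUr : volume.real U ≤ 4 * R * N / m := by
    rw [le_div_iff₀ hm]; linarith
  set Φ : ℝ → ℝ := fun v => volume.real (U ∩ Set.Iic v) with hΦ
  have hfin : ∀ s, volume (U ∩ s) ≠ ⊤ := fun s =>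
    ((measure_mono Set.inter_subset_left).trans_lt hUfin.lt_top).ne
  have hdiff : ∀ {v w}, w ≤ v → Φ v - Φ w = volume.real (U ∩ Set.Ioc w v) := by
    intro v w hwv
    have hsplit : U ∩ Set.Iic v = (U ∩ Set.Iic w) ∪ (U ∩ Set.Ioc w v) := by
      rw [← Set.inter_union_distrib_left, Set.Iic_union_Ioc_eq_Iic hwv]
    have hdisj : Disjoint (U ∩ Set.Iic w) (U ∩ Set.Ioc w v) :=
      Set.disjoint_left.2 fun z hz hz' => not_lt.2 hz.2 hz'.2.1
    simp only [hΦ]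
    rw [hsplit, measureReal_union hdisj (hUm.inter measurableSet_Ioc) (hfin _) (hfin _)]
    ring
  have hle : ∀ {v w}, w ≤ v → |Φ v - Φ w| ≤ |v - w| ∧ |Φ v - Φ w| ≤ 4 * R * N / m := by
    intro v w hwv
    rw [hdiff hwv, abs_of_nonneg measureReal_nonneg]
    constructor
    · rw [abs_of_nonneg (sub_nonneg.2 hwv)]
      calc volume.real (U ∩ Set.Ioc w v) ≤ volume.real (Set.Ioc w v) :=
            measureReal_mono Set.inter_subset_right (by simp)
        _ = v - w := by rw [Real.volume_real_Ioc_of_le hwv]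
    · exact (measureReal_mono Set.inter_subset_left hUfin).trans hUr
  have hcover : ∀ {v w}, w ≤ v → Set.Ioc w v ⊆ U → Φ v - Φ w = v - w := by
    intro v w hwv hsub
    rw [hdiff hwv, Set.inter_eq_self_of_subset_right hsub, Real.volume_real_Ioc_of_le hwv]
  refine ⟨Φ, ?_, ?_, ?_⟩
  · intro v w
    rcases le_total w v with h | h
    · exact (hle h).1
    · rw [abs_sub_comm, abs_sub_comm v]; exact (hle h).1
  · intro v w
    rcases le_total w v with h | h
    · exact (hle h).2
    · rw [abs_sub_comm]; exact (hle h).2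
  · intro w
    by_contra! hcon
    have hne : (Finset.univ.filter fun i => |a i - w| ≤ R ∧ Φ (a i) - Φ w ≠ a i - w).Nonempty := by
      rw [Finset.nonempty_iff_ne_empty]
      intro h0
      rw [h0] at hcon
      simp at hcon
      linarith
    obtain ⟨i₀, hi₀⟩ := hne
    rw [Finset.mem_filter] at hi₀
    obtain ⟨-, hR0, hne0⟩ := hi₀
    obtain ⟨h1, h2⟩ := abs_le.1 hR0
    -- A single altered difference gives a point `z` outside `U` within `R` of `w`. Every altered `a
    -- i` is then within `2R` of this same `z`, and fewer than `m` of the `a i` are.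
    obtain ⟨z, hzU, hz⟩ : ∃ z, z ∉ U ∧ |z - w| ≤ R := by
      rcases le_total w (a i₀) with h | h
      · have : ¬ Set.Ioc w (a i₀) ⊆ U := fun hs => hne0 (hcover h hs)
        obtain ⟨z, hz, hzU⟩ := Set.not_subset.1 this
        exact ⟨z, hzU, abs_le.2 ⟨by linarith [hz.1], by linarith [hz.2]⟩⟩
      · have : ¬ Set.Ioc (a i₀) w ⊆ U := fun hs => hne0 (by linarith [hcover h hs])
        obtain ⟨z, hz, hzU⟩ := Set.not_subset.1 this
        exact ⟨z, hzU, abs_le.2 ⟨by linarith [hz.1], by linarith [hz.2]⟩⟩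
    have hzm : ρ z < m := not_le.1 hzU
    have hcount : ((Finset.univ.filter fun i =>
        |a i - w| ≤ R ∧ Φ (a i) - Φ w ≠ a i - w).card : ℝ) ≤ ρ z := by
      rw [Finset.card_filter, Nat.cast_sum, hρ]
      refine Finset.sum_le_sum fun i _ => ?_
      split_ifs with hi
      · have : z ∈ Metric.closedBall (a i) (2 * R) := by
          rw [Metric.mem_closedBall, Real.dist_eq]
          obtain ⟨h3, h4⟩ := abs_le.1 hi.1
          obtain ⟨h5, h6⟩ := abs_le.1 hz
          exact abs_le.2 ⟨by linarith, by linarith⟩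
        rw [Set.indicator_of_mem this]; simp
      · simp only [Nat.cast_zero]
        exact Set.indicator_nonneg (fun _ _ => zero_le_one) _
    linarith

end Truncation

open Classical in
/-- If no two-way fixed effects fit `z` well in weighted mean square, up to pair effects, then none,
however large, bring the logit probabilities close to the true ones in Hellinger distance. -/
theorem exists_hellinger_lower_bound {T : ℕ} (t₀ : Fin T) {κ X Lb q : ℝ} (hκ : 0 < κ)
    (hX : 0 ≤ X) (hLb : 0 ≤ Lb) (hq : 0 < q) :
    ∃ δ : ℝ, 0 < δ ∧ ∀ (N : ℕ) (L : Pair N → ℝ) (v z : Pair N → Fin T → ℝ),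
      (∀ p, 0 ≤ L p) → (∀ p, L p ≤ Lb) → (∀ p t, κ ≤ softmax (v p) t) →
      (∀ p t, |z p t| ≤ X) →
      (∀ (a g : CountryTime N T) (e : Pair N → ℝ),
        q * (N : ℝ) ^ 2 ≤ ∑ p, L p * ∑ t, (z p t + a p.1.1 t + g p.1.2 t + e p) ^ 2) →
      ∀ a g : CountryTime N T, δ * (N : ℝ) ^ 2 ≤
        ∑ p, L p * hellinger (fun t => v p t + z p t + a p.1.1 t + g p.1.2 t) (v p) := by
  -- For a pair with squared Hellinger distance at most `κ/4`, the index differences are at most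
  -- `√(64/κ · κ/4) = 4`; removing `z` costs another `2X`.
  set R : ℝ := 4 + 2 * X with hR
  have hR0 : 0 < R := by positivity
  set c₁ : ℝ := Lb * (2 * X + R) ^ 2 * T with hc₁
  have hc₁0 : 0 ≤ c₁ := by positivity
  -- The tolerated fraction of altered pairs: their squared error `c₁ δ'` uses up at most half of
  -- `q`.
  set δ' : ℝ := q / (2 * (c₁ + 1)) with hδ'
  have hδ'0 : 0 < δ' := by positivity
  set B : ℝ := 2 * X + 4 * R / δ' with hB
  set c₂ : ℝ := (64 + 4 * B ^ 2) / κ * T with hc₂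
  have hT : (0 : ℝ) < T := by exact_mod_cast (Fin.pos t₀)
  have hc₂0 : 0 < c₂ := by positivity
  refine ⟨q / 2 / c₂, by positivity, ?_⟩
  intro N L v z hL hLb' hv hz hfit a g
  rcases N.eq_zero_or_pos with rfl | hN
  · simp only [Nat.cast_zero, ne_eq, OfNat.ofNat_ne_zero, not_false_eq_true, zero_pow, mul_zero]
    exact Finset.sum_nonneg fun p _ => mul_nonneg (hL p) (hellinger_nonneg _ _)
  have hN0 : (0 : ℝ) < N := by exact_mod_cast hN
  set H : Pair N → ℝ := fun p =>
    hellinger (fun t => v p t + z p t + a p.1.1 t + g p.1.2 t) (v p) with hH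
  have hH0 : ∀ p, 0 ≤ H p := fun p => hellinger_nonneg _ _
  have hm : 0 < δ' * N := by positivity
  -- Effects are taken relative to period `t₀`, a pair effect absorbing the `t₀` term of `z`. The
  -- same `Φ t` acts on the exporter effects and on minus the importer effects, so that preserving
  -- their difference preserves the sum `a + g`.
  choose Φ hΦ1 hΦ2 hΦ3 using fun t =>
    exists_bounded_contraction (fun i => a i t - a i t₀) hR0 hm
  have hΦ2' : ∀ t v w, |Φ t v - Φ t w| ≤ 4 * R / δ' := fun t v w =>
    (hΦ2 t v w).trans (by rw [mul_div_mul_right _ _ hN0.ne'])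
  set aff : Pair N → Fin T → Prop := fun p t =>
    |(a p.1.1 t - a p.1.1 t₀) - -(g p.1.2 t - g p.1.2 t₀)| ≤ R ∧
      Φ t (a p.1.1 t - a p.1.1 t₀) - Φ t (-(g p.1.2 t - g p.1.2 t₀)) ≠
        (a p.1.1 t - a p.1.1 t₀) - -(g p.1.2 t - g p.1.2 t₀) with haff
  set w : Pair N → Fin T → ℝ := fun p t => z p t + Φ t (a p.1.1 t - a p.1.1 t₀) +
    -Φ t (-(g p.1.2 t - g p.1.2 t₀)) + -z p t₀ with hw
  have hz2 : ∀ p t, |z p t - z p t₀| ≤ 2 * X := fun p t =>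
    (abs_sub _ _).trans (by linarith [hz p t, hz p t₀])
  have hpt : ∀ p t, w p t ^ 2 ≤ (64 + 4 * B ^ 2) / κ * H p +
      (2 * X + R) ^ 2 * (if aff p t then 1 else 0) := by
    intro p t
    have hw' : w p t = (z p t - z p t₀) +
      (Φ t (a p.1.1 t - a p.1.1 t₀) - Φ t (-(g p.1.2 t - g p.1.2 t₀))) := by
        rw [hw]; ring
    have hind : 0 ≤ (2 * X + R) ^ 2 * (if aff p t then (1 : ℝ) else 0) := by
      split_ifs <;> positivity
    have hexp : (64 + 4 * B ^ 2) / κ * H p = 64 / κ * H p + B ^ 2 * (4 / κ * H p) := by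
      field_simp
    rw [hexp]
    have hn1 : 0 ≤ 64 / κ * H p := by have := hH0 p; positivity
    have hn2 : 0 ≤ B ^ 2 * (4 / κ * H p) := by have := hH0 p; positivity
    -- For small `H p` the surrogate residual `w` equals the true index difference, unless the
    -- contraction alters it. For large `H p` the factor `4/κ · H p ≥ 1` pays for the crude bound
    -- `B²`, which is finite because the surrogate effects are bounded.
    rcases le_or_gt (H p) (κ / 4) with hgood | hbad
    · have h64 := sq_sub_le_of_hellinger_le hκ (hv p) hgood t₀ t
      set D := (v p t + z p t + a p.1.1 t + g p.1.2 t - v p t) -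
        (v p t₀ + z p t₀ + a p.1.1 t₀ + g p.1.2 t₀ - v p t₀) with hD
      have h64' : D ^ 2 ≤ 64 / κ * H p := h64
      have hD16 : D ^ 2 ≤ 4 ^ 2 := h64'.trans (by
        rw [div_mul_eq_mul_div, div_le_iff₀ hκ]; linarith)
      have hD4 : |D| ≤ 4 := abs_le_of_sq_le_sq hD16 (by norm_num)
      have hDe : D = (z p t - z p t₀) +
          ((a p.1.1 t - a p.1.1 t₀) - -(g p.1.2 t - g p.1.2 t₀)) := by rw [hD]; ring
      have hag : |(a p.1.1 t - a p.1.1 t₀) - -(g p.1.2 t - g p.1.2 t₀)| ≤ R := by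
        have : (a p.1.1 t - a p.1.1 t₀) - -(g p.1.2 t - g p.1.2 t₀) =
          D - (z p t - z p t₀) := by rw [hDe]; ring
        rw [this]
        exact (abs_sub _ _).trans (by linarith [hz2 p t])
      by_cases ha : aff p t
      · rw [if_pos ha, mul_one]
        have : |w p t| ≤ 2 * X + R := by
          rw [hw']
          exact (abs_add_le _ _).trans (add_le_add (hz2 p t) ((hΦ1 t _ _).trans hag))
        have h2 : w p t ^ 2 ≤ (2 * X + R) ^ 2 := by
          rw [← sq_abs]; gcongr
        linarith
      · have heq : Φ t (a p.1.1 t - a p.1.1 t₀) - Φ t (-(g p.1.2 t - g p.1.2 t₀)) =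
            (a p.1.1 t - a p.1.1 t₀) - -(g p.1.2 t - g p.1.2 t₀) := by
          by_contra hne
          exact ha ⟨hag, hne⟩
        have : w p t = D := by rw [hw', heq, hDe]
        rw [this]
        linarith
    · have hone : 1 ≤ 4 / κ * H p := by
        rw [div_mul_eq_mul_div, le_div_iff₀ hκ]; linarith
      have : |w p t| ≤ B := by
        rw [hw']
        exact (abs_add_le _ _).trans (add_le_add (hz2 p t) (hΦ2' t _ _))
      have h2 : w p t ^ 2 ≤ B ^ 2 := by
        rw [← sq_abs]; gcongr
      have h3 : B ^ 2 ≤ B ^ 2 * (4 / κ * H p) := le_mul_of_one_le_right (sq_nonneg _) hone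
      linarith
  have hcount : ∀ t, ∑ p : Pair N, (if aff p t then (1 : ℝ) else 0) ≤ δ' * (N : ℝ) ^ 2 := by
    intro t
    set F : Fin N × Fin N → ℝ := fun r =>
      if |(a r.1 t - a r.1 t₀) - -(g r.2 t - g r.2 t₀)| ≤ R ∧
        Φ t (a r.1 t - a r.1 t₀) - Φ t (-(g r.2 t - g r.2 t₀)) ≠
        (a r.1 t - a r.1 t₀) - -(g r.2 t - g r.2 t₀) then (1 : ℝ) else 0 with hF
    have h1 : ∑ p : Pair N, (if aff p t then (1 : ℝ) else 0) ≤ ∑ r, F r := by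
      have hinj : ∑ p : Pair N, F p.1 = ∑ r ∈ Finset.univ.filter
          (fun r : Fin N × Fin N => r.1 ≠ r.2), F r := by
        rw [← Finset.sum_subtype (Finset.univ.filter
          (fun r : Fin N × Fin N => r.1 ≠ r.2)) (by simp) F]
      calc ∑ p : Pair N, (if aff p t then (1 : ℝ) else 0) = ∑ p : Pair N, F p.1 := rfl
        _ ≤ ∑ r, F r := by
          rw [hinj]
          refine Finset.sum_le_sum_of_subset_of_nonneg (Finset.filter_subset _ _) ?_
          intro r _ _
          simp only [hF]; split_ifs <;> norm_num
    refine h1.trans ?_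
    rw [Fintype.sum_prod_type_right]
    -- Fixing the importer fixes the base point of the contraction, which alters the difference for
    -- at most `δ' N` exporters.
    have h2 : ∀ j, ∑ i, F (i, j) ≤ δ' * N := by
      intro j
      have := hΦ3 t (-(g j t - g j t₀))
      rw [Finset.card_filter, Nat.cast_sum] at this
      simpa only [Nat.cast_ite, Nat.cast_one, Nat.cast_zero] using this
    calc ∑ j, ∑ i, F (i, j) ≤ ∑ _j : Fin N, δ' * N := Finset.sum_le_sum fun j _ => h2 j
      _ = δ' * (N : ℝ) ^ 2 := by simp; ring
  have hmain : q * (N : ℝ) ^ 2 ≤ c₂ * (∑ p, L p * H p) + c₁ * δ' * (N : ℝ) ^ 2 := by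
    refine (hfit (fun i t => Φ t (a i t - a i t₀)) (fun j t => -Φ t (-(g j t - g j t₀)))
      (fun p => -z p t₀)).trans ?_
    calc ∑ p, L p * ∑ t, w p t ^ 2
        ≤ ∑ p, L p * ∑ t, ((64 + 4 * B ^ 2) / κ * H p +
          (2 * X + R) ^ 2 * (if aff p t then 1 else 0)) :=
          Finset.sum_le_sum fun p _ => mul_le_mul_of_nonneg_left
            (Finset.sum_le_sum fun t _ => hpt p t) (hL p)
      _ = ∑ p, (c₂ * (L p * H p) +
          L p * ((2 * X + R) ^ 2 * ∑ t, (if aff p t then (1 : ℝ) else 0))) := by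
          refine Finset.sum_congr rfl fun p _ => ?_
          rw [Finset.sum_add_distrib, Finset.sum_const, ← Finset.mul_sum, Finset.card_univ,
            Fintype.card_fin, nsmul_eq_mul, hc₂]
          ring
      _ ≤ ∑ p, (c₂ * (L p * H p) +
          Lb * ((2 * X + R) ^ 2 * ∑ t, (if aff p t then (1 : ℝ) else 0))) := by
          refine Finset.sum_le_sum fun p _ => add_le_add le_rfl ?_
          refine mul_le_mul_of_nonneg_right (hLb' p) (mul_nonneg (sq_nonneg _) ?_)
          exact Finset.sum_nonneg fun t _ => by split_ifs <;> norm_num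
      _ = c₂ * (∑ p, L p * H p) + Lb * (2 * X + R) ^ 2 *
          ∑ t, ∑ p : Pair N, (if aff p t then (1 : ℝ) else 0) := by
          rw [Finset.sum_add_distrib, ← Finset.mul_sum, ← Finset.mul_sum, ← Finset.mul_sum,
            Finset.sum_comm]
          ring
      _ ≤ c₂ * (∑ p, L p * H p) + Lb * (2 * X + R) ^ 2 *
          ∑ _t : Fin T, δ' * (N : ℝ) ^ 2 := by
          gcongr with t _
          exact hcount t
      _ = c₂ * (∑ p, L p * H p) + c₁ * δ' * (N : ℝ) ^ 2 := by
          rw [Finset.sum_const, Finset.card_univ, Fintype.card_fin, nsmul_eq_mul, hc₁]; ring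
  have hc : c₁ * δ' ≤ q / 2 := by
    rw [hδ', mul_div_assoc', div_le_div_iff₀ (by positivity) (by norm_num)]
    nlinarith
  have hc' : c₁ * δ' * (N : ℝ) ^ 2 ≤ q / 2 * (N : ℝ) ^ 2 := by gcongr
  rw [div_mul_eq_mul_div, div_le_iff₀ hc₂0]
  linarith

end Gravity

namespace Gravity

/-! ### Sign patterns of affine half-spaces -/

section SignPatterns

theorem sum_choose_le_pow (n d : ℕ) : ∑ k ∈ Finset.Iic d, n.choose k ≤ (n + 1) ^ d := by
  have : Finset.Iic d = Finset.range (d + 1) := by ext; simp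
  rw [add_pow, this]
  refine Finset.sum_le_sum fun k hk => ?_
  rw [one_pow, mul_one]
  have hk' : k ≤ d := Nat.lt_succ_iff.1 (Finset.mem_range.1 hk)
  exact (Nat.choose_le_pow n k).trans (Nat.le_mul_of_pos_right _ (Nat.choose_pos hk'))

variable {I E : Type*} [Fintype I] [AddCommGroup E] [Module ℝ E]

open Classical in
/-- The half-spaces `c i < ℓ i v` that contain the point `v`. -/
noncomputable def signSet (ℓ : I → Module.Dual ℝ E) (c : I → ℝ) (v : E) : Finset I :=
  Finset.univ.filter fun i => c i < ℓ i v

theorem mem_signSet {ℓ : I → Module.Dual ℝ E} {c : I → ℝ} {v : E} {i : I} :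
    i ∈ signSet ℓ c v ↔ c i < ℓ i v := by
  simp [signSet]

variable [FiniteDimensional ℝ E]

-- More than `finrank` functionals are dependent, so some nontrivial combination `∑ w i (ℓ i v - c
-- i)` does not depend on `v`. Shattering supplies a point where no term is negative and one where
-- no term is positive, with a strict gap at an index with `w i ≠ 0`.
open Classical in
theorem card_le_finrank_of_shatters (ℓ : I → Module.Dual ℝ E) (c : I → ℝ) {𝒜 : Finset (Finset I)}
    (h𝒜 : ∀ A ∈ 𝒜, ∃ v, signSet ℓ c v = A) {s : Finset I} (hs : 𝒜.Shatters s) :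
    s.card ≤ Module.finrank ℝ E := by
  by_contra! hcard
  have hdep : ¬ LinearIndependent ℝ (fun i : s => ℓ i) := by
    intro hli
    have := hli.fintype_card_le_finrank
    rw [Subspace.dual_finrank_eq, Fintype.card_coe] at this
    omega
  rw [Fintype.not_linearIndependent_iff] at hdep
  obtain ⟨w, hw, i₀, hi₀⟩ := hdep
  have hconst : ∀ v, ∑ i : s, w i * (ℓ i v - c i) = -∑ i : s, w i * c i := by
    intro v
    have := congrArg (fun f : Module.Dual ℝ E => f v) hw
    simp only [LinearMap.sum_apply, LinearMap.smul_apply, smul_eq_mul,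
      LinearMap.zero_apply] at this
    simp only [mul_sub, Finset.sum_sub_distrib, this, zero_sub]
  have hpat : ∀ P : s → Prop, ∃ v, ∀ i : s, c i < ℓ i v ↔ P i := by
    intro P
    obtain ⟨A, hA, hAs⟩ := hs (t := (Finset.univ.filter P).map ⟨Subtype.val, Subtype.val_injective⟩)
      (by intro i hi
          simp only [Finset.mem_map, Finset.mem_filter, Finset.mem_univ, true_and,
            Function.Embedding.coeFn_mk] at hi
          obtain ⟨j, -, rfl⟩ := hi
          exact j.2)
    obtain ⟨v, rfl⟩ := h𝒜 A hA
    refine ⟨v, fun i => ?_⟩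
    have := Finset.ext_iff.1 hAs i
    simpa [signSet] using this
  obtain ⟨v, hv⟩ := hpat fun i => 0 < w i
  obtain ⟨v', hv'⟩ := hpat fun i => w i < 0
  have h1 : ∀ i : s, 0 ≤ w i * (ℓ i v - c i) := by
    intro i
    by_cases h : 0 < w i
    · exact mul_nonneg h.le (sub_nonneg.2 ((hv i).2 h).le)
    · exact mul_nonneg_of_nonpos_of_nonpos (not_lt.1 h)
        (sub_nonpos.2 (not_lt.1 fun hc => h ((hv i).1 hc)))
  have h2 : ∀ i : s, w i * (ℓ i v' - c i) ≤ 0 := by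
    intro i
    by_cases h : w i < 0
    · exact mul_nonpos_of_nonpos_of_nonneg h.le (sub_nonneg.2 ((hv' i).2 h).le)
    · exact mul_nonpos_of_nonneg_of_nonpos (not_lt.1 h)
        (sub_nonpos.2 (not_lt.1 fun hc => h ((hv' i).1 hc)))
  have h3 : ∑ i : s, w i * (ℓ i v' - c i) < ∑ i : s, w i * (ℓ i v - c i) := by
    refine Finset.sum_lt_sum (fun i _ => (h2 i).trans (h1 i)) ⟨i₀, Finset.mem_univ _, ?_⟩
    rcases lt_or_gt_of_ne hi₀ with h | h
    · exact (mul_neg_of_neg_of_pos h (sub_pos.2 ((hv' i₀).2 h))).trans_le (h1 i₀)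
    · exact (h2 i₀).trans_lt (mul_pos h (sub_pos.2 ((hv i₀).2 h)))
  rw [hconst, hconst] at h3
  exact lt_irrefl _ h3

open Classical in
/-- Affine half-spaces in a space of dimension `d` have few sign patterns. -/
theorem exists_finset_signSet (ℓ : I → Module.Dual ℝ E) (c : I → ℝ) :
    ∃ G : Finset E, G.card ≤ (Fintype.card I + 1) ^ Module.finrank ℝ E ∧
      ∀ v, ∃ r ∈ G, signSet ℓ c v = signSet ℓ c r := by
  set 𝒜 : Finset (Finset I) := Finset.univ.filter fun A => ∃ v, signSet ℓ c v = A with h𝒜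
  have hmem : ∀ A ∈ 𝒜, ∃ v, signSet ℓ c v = A := fun A hA => (Finset.mem_filter.1 hA).2
  have hvc : 𝒜.vcDim ≤ Module.finrank ℝ E := Finset.sup_le fun s hs =>
    card_le_finrank_of_shatters ℓ c hmem (Finset.mem_shatterer.1 hs)
  -- Sauer–Shelah: there are at most as many patterns as shattered sets, and these have at most
  -- `finrank` elements.
  have hcard : 𝒜.card ≤ (Fintype.card I + 1) ^ Module.finrank ℝ E := by
    refine (Finset.card_le_card_shatterer 𝒜).trans
      (Finset.card_shatterer_le_sum_vcDim.trans ?_)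
    exact (sum_choose_le_pow _ _).trans (Nat.pow_le_pow_right (Nat.succ_pos _) hvc)
  choose! r hr using hmem
  refine ⟨𝒜.image r, Finset.card_image_le.trans hcard, fun v => ⟨r (signSet ℓ c v), ?_, ?_⟩⟩
  · exact Finset.mem_image_of_mem _ (Finset.mem_filter.2 ⟨Finset.mem_univ _, v, rfl⟩)
  · exact (hr _ (Finset.mem_filter.2 ⟨Finset.mem_univ _, v, rfl⟩)).symm

end SignPatterns

/-! ### Logit probabilities from quantized index differences -/

section Quantization

theorem close_or_large_of_thresholds {n : ℕ} (hn : 0 < n) {v v' : ℝ}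
    (h : ∀ k : ℤ, |k| ≤ (n : ℤ) ^ 2 → ((k : ℝ) / n < v ↔ (k : ℝ) / n < v')) :
    |v - v'| ≤ 1 / n ∨ ((n : ℝ) < v ∧ (n : ℝ) < v') ∨ (v ≤ -n ∧ v' ≤ -n) := by
  have hn0 : (0 : ℝ) < n := by exact_mod_cast hn
  have htop := h ((n : ℤ) ^ 2) (by simp)
  have hbot := h (-(n : ℤ) ^ 2) (by simp)
  have e1 : (((n : ℤ) ^ 2 : ℤ) : ℝ) / n = n := by push_cast; field_simp
  have e2 : ((-(n : ℤ) ^ 2 : ℤ) : ℝ) / n = -n := by push_cast; field_simp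
  rw [e1] at htop
  rw [e2] at hbot
  -- The thresholds form a grid of mesh `1/n` on `[-n, n]`. The first grid point at or above `a`
  -- would separate `a` from any `b > a + 1/n`.
  have step : ∀ {a b : ℝ}, (∀ k : ℤ, |k| ≤ (n : ℤ) ^ 2 → ((k : ℝ) / n < b → (k : ℝ) / n < a)) →
      -(n : ℝ) < a → a ≤ n → b ≤ a + 1 / n := by
    intro a b hab ha1 ha2
    by_contra! hlt
    have h1 : (⌈a * n⌉ : ℝ) / n < a + 1 / n := by
      rw [div_lt_iff₀ hn0, add_mul, one_div, inv_mul_cancel₀ hn0.ne']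
      exact Int.ceil_lt_add_one _
    have h2 : a ≤ (⌈a * n⌉ : ℝ) / n := by
      rw [le_div_iff₀ hn0]; exact Int.le_ceil _
    have hk : |⌈a * n⌉| ≤ (n : ℤ) ^ 2 := by
      rw [abs_le]
      constructor
      · have : (-(n : ℤ) ^ 2 : ℝ) ≤ ⌈a * n⌉ := le_trans (by push_cast; nlinarith) (Int.le_ceil _)
        exact_mod_cast this
      · refine Int.ceil_le.2 ?_
        push_cast; nlinarith
    exact absurd (hab _ hk (h1.trans hlt)) (not_lt.2 h2)
  rcases le_or_gt v (-n) with hv | hv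
  · exact Or.inr (Or.inr ⟨hv, not_lt.1 fun hc => absurd (hbot.2 hc) (not_lt.2 hv)⟩)
  rcases lt_or_ge (n : ℝ) v with hv2 | hv2
  · exact Or.inr (Or.inl ⟨hv2, htop.1 hv2⟩)
  · left
    have hv' : -(n : ℝ) < v' := hbot.1 hv
    have hv2' : v' ≤ n := not_lt.1 fun hc => absurd (htop.2 hc) (not_lt.2 hv2)
    have s1 := step (a := v) (b := v') (fun k hk => (h k hk).2) hv hv2
    have s2 := step (a := v') (b := v) (fun k hk => (h k hk).1) hv' hv2'
    rw [abs_le]; constructor <;> linarith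

variable {ι : Type*} [Fintype ι]

theorem softmax_eq_inv (u : ι → ℝ) (t : ι) :
    softmax u t = (∑ s, Real.exp (-(u t - u s)))⁻¹ := by
  have : ∑ s, Real.exp (-(u t - u s)) = (∑ s, Real.exp (u s)) / Real.exp (u t) := by
    rw [Finset.sum_div]
    refine Finset.sum_congr rfl fun s _ => ?_
    rw [neg_sub, Real.exp_sub]
  rw [this, inv_div, softmax]

theorem softmax_le_exp_sub (u : ι → ℝ) (t s : ι) : softmax u t ≤ Real.exp (u t - u s) := by
  rw [softmax_eq_inv, ← inv_inv (Real.exp (u t - u s)), ← Real.exp_neg]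
  refine inv_anti₀ (Real.exp_pos _) ?_
  exact Finset.single_le_sum (f := fun s => Real.exp (-(u t - u s)))
    (fun _ _ => (Real.exp_pos _).le) (Finset.mem_univ s)

theorem exp_neg_le_inv {n : ℕ} (hn : 0 < n) : Real.exp (-(n : ℝ)) ≤ 1 / n := by
  have hn0 : (0 : ℝ) < n := by exact_mod_cast hn
  rw [Real.exp_neg, one_div]
  exact inv_anti₀ hn0 (by linarith [Real.add_one_le_exp (n : ℝ)])

/-- The probability is the inverse of `∑ exp (-(u t - u s))`. If some difference is at most `-n`, it
is already below `1/n`. Otherwise each term of the sum for `u'` exceeds that for `u` by at most a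
factor `exp (1/n)` and a summand `1/n`, including differences beyond `n`. Exchanging `u` and `u'`
gives the other side. -/
theorem softmax_sub_le_of_thresholds {n : ℕ} (hn : 0 < n) {u u' : ι → ℝ} (t : ι)
    (h : ∀ s, ∀ k : ℤ, |k| ≤ (n : ℤ) ^ 2 →
      ((k : ℝ) / n < u t - u s ↔ (k : ℝ) / n < u' t - u' s)) :
    softmax u t - softmax u' t ≤ (Fintype.card ι + 2) / n := by
  have hn0 : (0 : ℝ) < n := by exact_mod_cast hn
  have hn1 : (1 : ℝ) ≤ n := by exact_mod_cast hn
  have hexpn := exp_neg_le_inv hn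
  have hexp1 : Real.exp (1 / n) - 1 ≤ 2 / n := by
    have h1 : |(1 : ℝ) / n| ≤ 1 := by
      rw [abs_of_pos (by positivity), div_le_one hn0]; exact hn1
    have := (le_abs_self _).trans (Real.abs_exp_sub_one_le h1)
    rw [abs_of_pos (by positivity : (0 : ℝ) < 1 / n)] at this
    linarith [show 2 * (1 / (n : ℝ)) = 2 / n by ring]
  by_cases hlarge : ∃ s, u t - u s ≤ -n
  · obtain ⟨s, hs⟩ := hlarge
    have h1 : softmax u t ≤ 1 / n :=
      (softmax_le_exp_sub u t s).trans ((Real.exp_le_exp.2 hs).trans hexpn)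
    have h2 := softmax_pos u' t
    have h3 : (1 : ℝ) / n ≤ (Fintype.card ι + 2) / n := by
      gcongr; linarith [(Nat.cast_nonneg (Fintype.card ι) : (0 : ℝ) ≤ _)]
    linarith
  · push Not at hlarge
    have hterm : ∀ s, Real.exp (-(u' t - u' s)) ≤
        Real.exp (1 / n) * Real.exp (-(u t - u s)) + 1 / n := by
      intro s
      have hpos : 0 ≤ Real.exp (1 / n) * Real.exp (-(u t - u s)) := by positivity
      have hn' : (0 : ℝ) ≤ 1 / n := by positivity
      rcases close_or_large_of_thresholds hn (h s) with hc | hc | hc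
      · have : Real.exp (-(u' t - u' s)) ≤ Real.exp (1 / n) * Real.exp (-(u t - u s)) := by
          rw [← Real.exp_add, Real.exp_le_exp]
          linarith [(abs_le.1 hc).2]
        linarith
      · have : Real.exp (-(u' t - u' s)) ≤ 1 / n :=
          (Real.exp_le_exp.2 (by linarith [hc.2])).trans hexpn
        linarith
      · exact absurd hc.1 (not_le.2 (hlarge s))
    have hsum := Finset.sum_le_sum fun s (_ : s ∈ Finset.univ) => hterm s
    rw [Finset.sum_add_distrib, ← Finset.mul_sum, Finset.sum_const, Finset.card_univ,
      nsmul_eq_mul] at hsum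
    set S := ∑ s, Real.exp (-(u t - u s)) with hS
    set S' := ∑ s, Real.exp (-(u' t - u' s)) with hS'
    have hS1 : 1 ≤ S := by
      have := Finset.single_le_sum (f := fun s => Real.exp (-(u t - u s)))
        (fun _ _ => (Real.exp_pos _).le) (Finset.mem_univ t)
      simpa only [sub_self, neg_zero, Real.exp_zero] using this
    have hS1' : 1 ≤ S' := by
      have := Finset.single_le_sum (f := fun s => Real.exp (-(u' t - u' s)))
        (fun _ _ => (Real.exp_pos _).le) (Finset.mem_univ t)
      simpa only [sub_self, neg_zero, Real.exp_zero] using this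
    rw [softmax_eq_inv u, softmax_eq_inv u']
    have hc : (Fintype.card ι : ℝ) * (1 / n) ≤ Fintype.card ι * (1 / n) * S :=
      le_mul_of_one_le_right (by positivity) hS1
    have hdiff : S' - S ≤ (Fintype.card ι + 2) / n * S := by
      have h2 : (Real.exp (1 / n) - 1) * S ≤ 2 / n * S := by gcongr
      have h3 : (Fintype.card ι + 2) / n * S =
        Fintype.card ι * (1 / n) * S + 2 / (n : ℝ) * S := by ring
      linarith
    have hS0 : 0 < S := by linarith
    have hS0' : 0 < S' := by linarith
    have e : S⁻¹ - S'⁻¹ = (S' - S) / (S * S') := by field_simp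
    rw [e, div_le_iff₀ (by positivity)]
    have h4 : (0 : ℝ) ≤ (Fintype.card ι + 2) / n * S := by positivity
    calc S' - S ≤ (Fintype.card ι + 2) / n * S := hdiff
      _ ≤ (Fintype.card ι + 2) / n * S * S' := le_mul_of_one_le_right h4 hS1'
      _ = (Fintype.card ι + 2) / n * (S * S') := by ring

theorem abs_sqrt_sub_sqrt_le {a b : ℝ} (ha : 0 ≤ a) (hb : 0 ≤ b) :
    |Real.sqrt a - Real.sqrt b| ≤ Real.sqrt |a - b| := by
  apply Real.le_sqrt_of_sq_le
  have h1 := Real.sq_sqrt ha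
  have h2 := Real.sq_sqrt hb
  have h3 := Real.sqrt_nonneg a
  have h4 := Real.sqrt_nonneg b
  generalize Real.sqrt a = s at *
  generalize Real.sqrt b = t at *
  rw [sq_abs]
  rcases le_total t s with h | h
  · refine le_trans ?_ (le_abs_self _); nlinarith
  · refine le_trans ?_ (neg_abs_le _ |> neg_le.1); nlinarith

theorem abs_sqrt_softmax_sub_le_of_thresholds {n : ℕ} (hn : 0 < n) {u u' : ι → ℝ} (t : ι)
    (h : ∀ s, ∀ k : ℤ, |k| ≤ (n : ℤ) ^ 2 →
      ((k : ℝ) / n < u t - u s ↔ (k : ℝ) / n < u' t - u' s)) :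
    |Real.sqrt (softmax u t) - Real.sqrt (softmax u' t)| ≤
      Real.sqrt ((Fintype.card ι + 2) / n) := by
  refine (abs_sqrt_sub_sqrt_le (softmax_pos u t).le (softmax_pos u' t).le).trans
    (Real.sqrt_le_sqrt (abs_le.2 ⟨?_, softmax_sub_le_of_thresholds hn t h⟩))
  linarith [softmax_sub_le_of_thresholds hn (u := u') (u' := u) t fun s k hk => (h s k hk).symm]

end Quantization

/-! ### A finite net over all parameters -/

section Net

variable {N T K : ℕ}

/-- All parameters of the profile pseudo-log-likelihood. -/
abbrev Params (N T K : ℕ) : Type :=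
  EuclideanSpace ℝ (Fin K) × CountryTime N T × CountryTime N T

/-- The logit probabilities of a parameter. -/
noncomputable def prob (x : Regressors N T K) (v : Params N T K) (p : Pair N) (t : Fin T) : ℝ :=
  softmax (index x v.1 v.2.1 v.2.2 p) t

/-- The index as a linear function of the parameters. -/
noncomputable def indexLin (x : Regressors N T K) (p : Pair N) (t : Fin T) :
    Module.Dual ℝ (Params N T K) where
  toFun v := index x v.1 v.2.1 v.2.2 p t
  map_add' v w := by
    have := index_combo x v.1 w.1 v.2.1 v.2.2 w.2.1 w.2.2 1 1 p t
    simpa using this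
  map_smul' a v := by
    have := index_combo x v.1 0 v.2.1 v.2.2 0 0 a 0 p t
    simpa using this

theorem indexLin_apply (x : Regressors N T K) (p : Pair N) (t : Fin T) (v : Params N T K) :
    indexLin x p t v = index x v.1 v.2.1 v.2.2 p t := rfl

/-- Linear in `N`: the pair effects, which would contribute order `N²` dimensions, have been
profiled out. -/
theorem finrank_params : Module.finrank ℝ (Params N T K) = K + 2 * (N * T) := by
  simp [Module.finrank_prod, Module.finrank_pi_fintype]
  ring

theorem card_pair_le : Fintype.card (Pair N) ≤ N ^ 2 := by
  refine (Fintype.card_subtype_le _).trans ?_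
  simp [sq]

/-- A finite net for the square roots of the logit probabilities, over all parameters. -/
theorem exists_net (x : Regressors N T K) {n : ℕ} (hn : 0 < n) :
    ∃ G : Finset (Params N T K),
      G.card ≤ (N ^ 2 * T ^ 2 * (2 * n ^ 2 + 1) + 1) ^ (K + 2 * (N * T)) ∧
      ∀ v, ∃ r ∈ G, ∀ p t,
        |Real.sqrt (prob x v p t) - Real.sqrt (prob x r p t)| ≤ Real.sqrt ((T + 2) / n) := by
  -- One half-space for each pair, each two periods and each threshold.
  obtain ⟨G, hG, hnet⟩ := exists_finset_signSet
    (I := (Pair N × (Fin T × Fin T)) × Finset.Icc (-(n : ℤ) ^ 2) ((n : ℤ) ^ 2))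
    (fun i => indexLin x i.1.1 i.1.2.1 - indexLin x i.1.1 i.1.2.2) (fun i => (i.2.1 : ℝ) / n)
  refine ⟨G, ?_, fun v => ?_⟩
  · rw [finrank_params] at hG
    refine hG.trans (Nat.pow_le_pow_left (Nat.succ_le_succ ?_) _)
    have hcard : (Finset.Icc (-(n : ℤ) ^ 2) ((n : ℤ) ^ 2)).card = 2 * n ^ 2 + 1 := by
      have : (n : ℤ) ^ 2 + 1 - -(n : ℤ) ^ 2 = ((2 * n ^ 2 + 1 : ℕ) : ℤ) := by push_cast; ring
      rw [Int.card_Icc, this, Int.toNat_natCast]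
    rw [Fintype.card_prod, Fintype.card_prod, Fintype.card_prod, Fintype.card_coe, hcard,
      Fintype.card_fin]
    refine Nat.mul_le_mul_right _ ?_
    rw [sq T]
    exact Nat.mul_le_mul_right _ card_pair_le
  · obtain ⟨r, hr, hvr⟩ := hnet v
    refine ⟨r, hr, fun p t => ?_⟩
    have := abs_sqrt_softmax_sub_le_of_thresholds hn (u := index x v.1 v.2.1 v.2.2 p)
      (u' := index x r.1 r.2.1 r.2.2 p) t fun s k hk => by
        have := Finset.ext_iff.1 hvr ((p, (t, s)), ⟨k, Finset.mem_Icc.2 (abs_le.1 hk)⟩)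
        simpa only [mem_signSet, LinearMap.sub_apply, indexLin_apply] using this
    simpa [prob] using this

end Net

end Gravity

namespace Gravity

/-! ### Uniform concentration for independent bounded outcomes -/

section Concentration

variable {N T K : ℕ}

theorem abs_mul_sqrt_sub_one_le {w F θ : ℝ} (hw : 0 ≤ w) (hwF : w ≤ F) (hF : 1 ≤ F)
    (hθ : θ ≤ 1) : |w * Real.sqrt θ - 1| ≤ F := by
  have h1 : Real.sqrt θ ≤ 1 := Real.sqrt_le_one.2 hθ
  have h2 := Real.sqrt_nonneg θ
  have h3 : 0 ≤ w * Real.sqrt θ := by positivity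
  have h4 : w * Real.sqrt θ ≤ F := by nlinarith
  rw [abs_le]; constructor <;> linarith

/-- Two-sided Hoeffding bound for a sum of independent centred variables with a common bound. -/
theorem measureReal_abs_sum_ge_le {Ω ι : Type*} [MeasurableSpace Ω] [Fintype ι] [Nonempty ι]
    {P : Measure Ω} [IsProbabilityMeasure P] {Z : ι → Ω → ℝ} (hind : iIndepFun Z P)
    (hm : ∀ i, Measurable (Z i)) {c : ℝ} (hc : 0 < c) (hb : ∀ i, ∀ᵐ ω ∂P, |Z i ω| ≤ c)
    (h0 : ∀ i, ∫ ω, Z i ω ∂P = 0) {ε : ℝ} (hε : 0 ≤ ε) {m : ℝ} (hcard : Fintype.card ι ≤ m) :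
    P.real {ω | ε ≤ |∑ i, Z i ω|} ≤ 2 * Real.exp (-ε ^ 2 / (2 * (m * c ^ 2))) := by
  have one : ∀ Z' : ι → Ω → ℝ, iIndepFun Z' P → (∀ i, Measurable (Z' i)) →
      (∀ i, ∀ᵐ ω ∂P, |Z' i ω| ≤ c) → (∀ i, ∫ ω, Z' i ω ∂P = 0) →
      P.real {ω | ε ≤ ∑ i, Z' i ω} ≤ Real.exp (-ε ^ 2 / (2 * (m * c ^ 2))) := by
    intro Z' hind' hm' hb' h0'
    have hsub : ∀ i ∈ (Finset.univ : Finset ι),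
        HasSubgaussianMGF (Z' i) ((‖c - -c‖₊ / 2) ^ 2) P := fun i _ =>
      hasSubgaussianMGF_of_mem_Icc_of_integral_eq_zero (hm' i).aemeasurable
        ((hb' i).mono fun ω h => abs_le.1 h) (h0' i)
    have h := HasSubgaussianMGF.measure_sum_ge_le_of_iIndepFun hind' hsub hε
    refine h.trans (Real.exp_le_exp.2 ?_)
    have hval : ((∑ _i : ι, (‖c - -c‖₊ / 2) ^ 2 : NNReal) : ℝ) = Fintype.card ι * c ^ 2 := by
      push_cast
      rw [Finset.sum_const, Finset.card_univ, nsmul_eq_mul, Real.norm_eq_abs, div_pow, sq_abs]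
      ring
    rw [hval, neg_div, neg_div, neg_le_neg_iff]
    have hpos : (0 : ℝ) < Fintype.card ι := by exact_mod_cast Fintype.card_pos
    gcongr
  have h1 := one Z hind hm hb h0
  have h2 := one (fun i ω => -Z i ω) (hind.comp (fun _ => Neg.neg) fun _ => measurable_neg)
    (fun i => (hm i).neg) (fun i => by simpa only [abs_neg] using hb i)
    (fun i => by rw [integral_neg, h0, neg_zero])
  have hsub : {ω | ε ≤ |∑ i, Z i ω|} ⊆ {ω | ε ≤ ∑ i, Z i ω} ∪ {ω | ε ≤ ∑ i, -Z i ω} := by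
    intro ω hω
    rcases le_abs.1 (show ε ≤ |∑ i, Z i ω| from hω) with h | h
    · exact Or.inl h
    · right
      change ε ≤ ∑ i, -Z i ω
      rwa [Finset.sum_neg_distrib]
  have h3 := (measureReal_mono (μ := P) hsub).trans (measureReal_union_le _ _)
  linarith

/-- Uniformly over all parameters, a weighted sum of independent bounded outcomes is close to its
mean with high probability. -/
theorem measure_exists_fluctuation_le {Ω : Type*} [MeasurableSpace Ω] (P : Measure Ω)
    [IsProbabilityMeasure P] [Nonempty (Pair N)] (hT : 0 < T) (x : Regressors N T K)
    (Y : Pair N → Ω → Fin T → ℝ) (hind : iIndepFun Y P) (hm : ∀ p, Measurable (Y p))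
    {M F u : ℝ} (hM : 0 < M) (hF : 1 ≤ F) (hY : ∀ p, ∀ᵐ ω ∂P, ∀ t, Y p ω t ∈ Set.Icc 0 M)
    (w : Pair N → Fin T → ℝ) (hw : ∀ p t, 0 ≤ w p t) (hwF : ∀ p t, w p t ≤ F)
    {n : ℕ} (hn : 0 < n) (hu : 0 ≤ u)
    (hnet : (N : ℝ) ^ 2 * (T * (M * (F * Real.sqrt ((T + 2) / n)))) ≤ u / 2) :
    P {ω | ∃ v : Params N T K, u < |∑ p, ∑ t, (Y p ω t - ∫ ω', Y p ω' t ∂P) *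
        (w p t * Real.sqrt (prob x v p t) - 1)|} ≤
      ENNReal.ofReal (((N ^ 2 * T ^ 2 * (2 * n ^ 2 + 1) + 1) ^ (K + 2 * (N * T)) : ℕ) *
        (2 * Real.exp (-(u / 2) ^ 2 / (2 * ((N : ℝ) ^ 2 * (T * (M * F)) ^ 2))))) := by
  obtain ⟨G, hG, hGnet⟩ := exists_net x hn
  have hT0 : (0 : ℝ) < T := by exact_mod_cast hT
  have hF0 : 0 < F := by linarith
  have hmt : ∀ p t, Measurable fun ω => Y p ω t := fun p t => (measurable_pi_apply t).comp (hm p)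
  have hint : ∀ p t, Integrable (fun ω => Y p ω t) P := fun p t =>
    Integrable.of_mem_Icc 0 M (hmt p t).aemeasurable ((hY p).mono fun ω h => h t)
  have hmean : ∀ p t, ∫ ω, Y p ω t ∂P ∈ Set.Icc 0 M := by
    intro p t
    constructor
    · exact integral_nonneg_of_ae ((hY p).mono fun ω h => (h t).1)
    · have := integral_mono_ae (hint p t) (integrable_const M) ((hY p).mono fun ω h => (h t).2)
      simpa using this
  set e : Pair N → Ω → Fin T → ℝ := fun p ω t => Y p ω t - ∫ ω', Y p ω' t ∂P with he
  have heb : ∀ p, ∀ᵐ ω ∂P, ∀ t, |e p ω t| ≤ M := fun p => (hY p).mono fun ω h t => by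
    have h1 := hmean p t
    have h2 := h t
    rw [abs_le]; constructor <;> simp only [he] <;> linarith [h1.1, h1.2, h2.1, h2.2]
  set f : Params N T K → Pair N → Fin T → ℝ := fun v p t =>
    w p t * Real.sqrt (prob x v p t) - 1 with hf
  have hfb : ∀ v p t, |f v p t| ≤ F := fun v p t =>
    abs_mul_sqrt_sub_one_le (hw p t) (hwF p t) hF (softmax_le_one _ _)
  have hpoint : ∀ r : Params N T K,
      P.real {ω | u / 2 ≤ |∑ p, ∑ t, e p ω t * f r p t|} ≤
        2 * Real.exp (-(u / 2) ^ 2 / (2 * ((N : ℝ) ^ 2 * (T * (M * F)) ^ 2))) := by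
    intro r
    refine measureReal_abs_sum_ge_le (Z := fun p ω => ∑ t, e p ω t * f r p t) ?_ ?_
      (by positivity) ?_ ?_ (by positivity) (by exact_mod_cast card_pair_le)
    · exact hind.comp (fun p (z : Fin T → ℝ) => ∑ t, (z t - ∫ ω', Y p ω' t ∂P) * f r p t)
        fun p => Finset.measurable_sum _ fun t _ =>
          ((measurable_pi_apply t).sub measurable_const).mul measurable_const
    · exact fun p => Finset.measurable_sum _ fun t _ =>
        ((hmt p t).sub measurable_const).mul measurable_const
    · intro p
      filter_upwards [heb p] with ω hω
      calc |∑ t, e p ω t * f r p t| ≤ ∑ t, |e p ω t * f r p t| := Finset.abs_sum_le_sum_abs _ _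
        _ ≤ ∑ _t : Fin T, M * F := Finset.sum_le_sum fun t _ => by
            rw [abs_mul]; exact mul_le_mul (hω t) (hfb r p t) (abs_nonneg _) hM.le
        _ = T * (M * F) := by simp
    · intro p
      have hi : ∀ t, Integrable (fun ω => e p ω t * f r p t) P := fun t =>
        ((hint p t).sub (integrable_const _)).mul_const _
      rw [integral_finsetSum _ fun t _ => hi t]
      refine Finset.sum_eq_zero fun t _ => ?_
      have hz : ∫ ω, e p ω t ∂P = 0 := by
        simp only [he]
        rw [integral_sub (hint p t) (integrable_const _)]
        simp
      rw [integral_mul_const, hz, zero_mul]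
  -- Moving from `v` to its net point changes the sum by at most `u / 2`, so an exceedance of `u`
  -- anywhere forces one of `u / 2` on the net.
  have hsub : ∀ᵐ ω ∂P, (∃ v : Params N T K, u < |∑ p, ∑ t, e p ω t * f v p t|) →
      ω ∈ ⋃ r ∈ G, {ω | u / 2 ≤ |∑ p, ∑ t, e p ω t * f r p t|} := by
    filter_upwards [ae_all_iff.2 heb] with ω hω
    rintro ⟨v, hv⟩
    obtain ⟨r, hr, hvr⟩ := hGnet v
    refine Set.mem_biUnion hr ?_
    have hdiff : |∑ p, ∑ t, e p ω t * f v p t - ∑ p, ∑ t, e p ω t * f r p t| ≤ u / 2 := by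
      refine le_trans ?_ hnet
      rw [← Finset.sum_sub_distrib]
      calc |∑ p : Pair N, (∑ t, e p ω t * f v p t - ∑ t, e p ω t * f r p t)|
          ≤ ∑ p : Pair N, |∑ t, e p ω t * f v p t - ∑ t, e p ω t * f r p t| :=
            Finset.abs_sum_le_sum_abs _ _
        _ ≤ ∑ _p : Pair N, T * (M * (F * Real.sqrt ((T + 2) / n))) := by
            refine Finset.sum_le_sum fun p _ => ?_
            rw [← Finset.sum_sub_distrib]
            calc |∑ t, (e p ω t * f v p t - e p ω t * f r p t)|
                ≤ ∑ t, |e p ω t * f v p t - e p ω t * f r p t| := Finset.abs_sum_le_sum_abs _ _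
              _ ≤ ∑ _t : Fin T, M * (F * Real.sqrt ((T + 2) / n)) := by
                  refine Finset.sum_le_sum fun t _ => ?_
                  have : e p ω t * f v p t - e p ω t * f r p t = e p ω t * (w p t *
                    (Real.sqrt (prob x v p t) - Real.sqrt (prob x r p t))) := by
                      simp only [hf]; ring
                  rw [this, abs_mul, abs_mul, abs_of_nonneg (hw p t)]
                  gcongr
                  · exact mul_nonneg (hw p t) (abs_nonneg _)
                  · exact hω p t
                  · exact hwF p t
                  · exact hvr p t
              _ = T * (M * (F * Real.sqrt ((T + 2) / n))) := by simp
        _ = Fintype.card (Pair N) * (T * (M * (F * Real.sqrt ((T + 2) / n)))) := by simp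
        _ ≤ (N : ℝ) ^ 2 * (T * (M * (F * Real.sqrt ((T + 2) / n)))) := by
            gcongr
            exact_mod_cast card_pair_le
    have := abs_sub_abs_le_abs_sub (∑ p, ∑ t, e p ω t * f v p t) (∑ p, ∑ t, e p ω t * f r p t)
    change u / 2 ≤ |∑ p, ∑ t, e p ω t * f r p t|
    linarith
  calc P {ω | ∃ v : Params N T K, u < |∑ p, ∑ t, e p ω t * f v p t|}
      ≤ P (⋃ r ∈ G, {ω | u / 2 ≤ |∑ p, ∑ t, e p ω t * f r p t|}) := measure_mono_ae hsub
    _ ≤ ∑ r ∈ G, P {ω | u / 2 ≤ |∑ p, ∑ t, e p ω t * f r p t|} := measure_biUnion_finset_le _ _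
    _ ≤ ∑ _r ∈ G, ENNReal.ofReal
        (2 * Real.exp (-(u / 2) ^ 2 / (2 * ((N : ℝ) ^ 2 * (T * (M * F)) ^ 2)))) := by
        refine Finset.sum_le_sum fun r _ => ?_
        rw [← ofReal_measureReal]
        exact ENNReal.ofReal_le_ofReal (hpoint r)
    _ = ENNReal.ofReal (G.card *
        (2 * Real.exp (-(u / 2) ^ 2 / (2 * ((N : ℝ) ^ 2 * (T * (M * F)) ^ 2))))) := by
        rw [Finset.sum_const, nsmul_eq_mul, ENNReal.ofReal_mul (Nat.cast_nonneg _),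
          ENNReal.ofReal_natCast]
    _ ≤ _ := by
        refine ENNReal.ofReal_le_ofReal (mul_le_mul_of_nonneg_right ?_ (by positivity))
        exact_mod_cast hG

end Concentration

/-! ### From conditional to ordinary independence -/

section Conditioning

/-- Countability lets a single null set serve all product identities that define independence. -/
theorem exists_countable_isPiSystem (β : Type*) [m : MeasurableSpace β]
    [MeasurableSpace.CountablyGenerated β] :
    ∃ S : Set (Set β), S.Countable ∧ IsPiSystem S ∧ m = MeasurableSpace.generateFrom S := by
  classical
  set C := MeasurableSpace.countableGeneratingSet β with hC
  have hCc : Countable C :=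
    (MeasurableSpace.countable_countableGeneratingSet (α := β)).to_subtype
  refine ⟨Set.range fun F : Finset C => ⋂ c ∈ F, (c : Set β), Set.countable_range _, ?_, ?_⟩
  · rintro _ ⟨F, rfl⟩ _ ⟨F', rfl⟩ -
    refine ⟨F ∪ F', ?_⟩
    ext z
    simp only [Set.mem_iInter, Finset.mem_union, Set.mem_inter_iff]
    exact ⟨fun h => ⟨fun c hc => h c (Or.inl hc), fun c hc => h c (Or.inr hc)⟩,
      fun h c hc => hc.elim (h.1 c) (h.2 c)⟩
  · refine le_antisymm ?_ (MeasurableSpace.generateFrom_le ?_)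
    · conv_lhs => rw [← MeasurableSpace.generateFrom_countableGeneratingSet (α := β)]
      refine MeasurableSpace.generateFrom_mono fun c hc => ⟨{⟨c, hc⟩}, ?_⟩
      simp
    · rintro _ ⟨F, rfl⟩
      exact Finset.measurableSet_biInter _ fun c _ =>
        MeasurableSpace.measurableSet_countableGeneratingSet c.2

/-- Independence with respect to a kernel is independence for almost every measure of it. -/
theorem ae_iIndepFun_of_kernel {A Ω ι β : Type*} {_ : MeasurableSpace A}
    {_ : MeasurableSpace Ω} [Finite ι]
    [MeasurableSpace β] [MeasurableSpace.CountablyGenerated β] {κ : Kernel A Ω} {ν : Measure A}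
    {f : ι → Ω → β} (hf : ∀ i, Measurable (f i)) (h : Kernel.iIndepFun f κ ν) :
    ∀ᵐ a ∂ν, iIndepFun f (κ a) := by
  classical
  obtain ⟨S, hS, hpi, hgen⟩ := exists_countable_isPiSystem β
  have hSc : Countable S := hS.to_subtype
  have hSm : ∀ s ∈ S, MeasurableSet s := fun s hs => by
    rw [hgen]; exact MeasurableSpace.measurableSet_generateFrom hs
  have hall : ∀ᵐ a ∂ν, ∀ (F : Finset ι) (s : ι → S),
      κ a (⋂ i ∈ F, f i ⁻¹' (s i : Set β)) = ∏ i ∈ F, κ a (f i ⁻¹' (s i : Set β)) := by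
    rw [ae_all_iff]; intro F
    rw [ae_all_iff]; intro s
    exact Kernel.iIndepFun.measure_inter_preimage_eq_mul (fun _ => ‹MeasurableSpace β›) f h F (sets := fun i => (s i : Set β))
      fun i _ => hSm _ (s i).2
  filter_upwards [hall, h.ae_isProbabilityMeasure] with a ha hprob
  rw [iIndepFun_iff_iIndep]
  refine iIndepSets.iIndep (fun i => (hf i).comap_le) (fun i => {B | ∃ s ∈ S, f i ⁻¹' s = B})
    (fun i => hpi.comap (f i)) (fun i => ?_) ?_
  · conv_lhs => rw [hgen]
    rw [MeasurableSpace.comap_generateFrom]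
    rfl
  · rw [iIndepSets_iff]
    intro F B hB
    choose! s hs hsB using hB
    rcases F.eq_empty_or_nonempty with rfl | ⟨i₀, hi₀⟩
    · simp
    -- The identities are indexed by functions on all of `ι`; outside `F` the value is arbitrary,
    -- and `i₀ ∈ F` provides one.
    have := ha F (fun i => if hi : i ∈ F then ⟨s i, hs i hi⟩ else ⟨s i₀, hs i₀ hi₀⟩)
    have e : ∀ i ∈ F, f i ⁻¹' ((if hi : i ∈ F then ⟨s i, hs i hi⟩ else ⟨s i₀, hs i₀ hi₀⟩ : S) :
      Set β) = B i := fun i hi => by simp only [dif_pos hi]; exact hsB i hi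
    rw [Set.iInter₂_congr e, Finset.prod_congr rfl fun i hi => by rw [e i hi]] at this
    exact this

end Conditioning

end Gravity

namespace Gravity

/-! ### Conditional expectation kernels -/

section Kernel

variable {Ω : Type*} {m mΩ : MeasurableSpace Ω} [StandardBorelSpace Ω] {μ : Measure Ω}
  [IsFiniteMeasure μ]

theorem ae_ae_condExpKernel (hm : m ≤ mΩ) {q : Ω → Prop} (h : ∀ᵐ ω ∂μ, q ω) :
    ∀ᵐ ω ∂μ, ∀ᵐ ω' ∂condExpKernel μ m ω, q ω' := by
  refine ae_of_ae_trim hm (Measure.ae_ae_of_ae_comp ?_)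
  rwa [condExpKernel_comp_trim]

/-- The conditional probability of an `m`-measurable event is its indicator, hence zero or one.
Applied to `f < q` for the countably many rational `q`, this pins down `f`. -/
theorem ae_ae_condExpKernel_eq (hm : m ≤ mΩ) {f : Ω → ℝ} (hf : Measurable[m] f) :
    ∀ᵐ ω ∂μ, ∀ᵐ ω' ∂condExpKernel μ m ω, f ω' = f ω := by
  have key : ∀ q : ℚ, ∀ᵐ ω ∂μ, ∀ᵐ ω' ∂condExpKernel μ m ω, (f ω' < q ↔ f ω < q) := by
    intro q
    have hs : MeasurableSet[m] (f ⁻¹' Set.Iio (q : ℝ)) := hf measurableSet_Iio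
    have h1 := condExpKernel_ae_eq_condExp (μ := μ) hm (hm _ hs)
    have h2 : μ⟦f ⁻¹' Set.Iio (q : ℝ) | m⟧ = (f ⁻¹' Set.Iio (q : ℝ)).indicator fun _ => (1 : ℝ) :=
      condExp_of_stronglyMeasurable hm (stronglyMeasurable_const.indicator hs)
        ((integrable_const 1).indicator (hm _ hs))
    rw [h2] at h1
    filter_upwards [h1] with ω hω
    have : IsProbabilityMeasure (condExpKernel μ m ω) := by
      have : Nonempty Ω := ⟨ω⟩
      infer_instance
    by_cases hq : f ω < q
    · rw [Set.indicator_of_mem (show ω ∈ f ⁻¹' Set.Iio (q : ℝ) from hq)] at hω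
      have h3 : ∀ᵐ ω' ∂condExpKernel μ m ω, ω' ∈ f ⁻¹' Set.Iio (q : ℝ) := by
        exact mem_ae_iff.2 ((prob_compl_eq_zero_iff (hm _ hs)).2
          ((ENNReal.toReal_eq_one_iff _).1 hω))
      filter_upwards [h3] with ω' hω'
      exact ⟨fun _ => hq, fun _ => hω'⟩
    · rw [Set.indicator_of_notMem (show ω ∉ f ⁻¹' Set.Iio (q : ℝ) from hq),
        measureReal_eq_zero_iff] at hω
      filter_upwards [measure_eq_zero_iff_ae_notMem.1 hω] with ω' hω'
      exact ⟨fun h => absurd h hω', fun h => absurd h hq⟩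
  filter_upwards [ae_all_iff.2 key] with ω hω
  filter_upwards [ae_all_iff.2 hω] with ω' hω'
  by_contra hne
  rcases lt_or_gt_of_ne hne with h | h
  · obtain ⟨q, h1, h2⟩ := exists_rat_btwn h
    exact absurd ((hω' q).1 h1) (not_lt.2 h2.le)
  · obtain ⟨q, h1, h2⟩ := exists_rat_btwn h
    exact absurd ((hω' q).2 h1) (not_lt.2 h2.le)

theorem measure_le_of_condExpKernel_le {μ : Measure Ω} [IsProbabilityMeasure μ] (hm : m ≤ mΩ)
    {s : Set Ω} (hs : MeasurableSet s)
    {c : ENNReal} (h : ∀ᵐ ω ∂μ, condExpKernel μ m ω s ≤ c) : μ s ≤ c := by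
  have hmeas : Measurable[m] fun ω => condExpKernel μ m ω s := measurable_condExpKernel hs
  have h1 : μ s = ∫⁻ ω, condExpKernel μ m ω s ∂μ.trim hm := by
    conv_lhs => rw [← condExpKernel_comp_trim (μ := μ) hm]
    exact Measure.bind_apply hs (Kernel.aemeasurable _)
  rw [h1, lintegral_trim hm hmeas]
  calc ∫⁻ ω, condExpKernel μ m ω s ∂μ ≤ ∫⁻ _, c ∂μ := lintegral_mono_ae h
    _ = c := by simp

/-- By continuity a strict inequality that holds at some `θ` holds at a member of a countable dense
set. -/
theorem measurableSet_exists_lt {Ω Θ : Type*} [MeasurableSpace Ω] [TopologicalSpace Θ]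
    [TopologicalSpace.SeparableSpace Θ]
    {F : Ω → Θ → ℝ} (hm : ∀ θ, Measurable fun ω => F ω θ) (hc : ∀ ω, Continuous (F ω)) (c : ℝ) :
    MeasurableSet {ω | ∃ θ, c < F ω θ} := by
  obtain ⟨S, hS, hSd⟩ := TopologicalSpace.exists_countable_dense Θ
  have : {ω | ∃ θ, c < F ω θ} = ⋃ θ ∈ S, {ω | c < F ω θ} := by
    ext ω
    simp only [Set.mem_iUnion]
    constructor
    · rintro ⟨θ, hθ⟩
      obtain ⟨θ', h1, h2⟩ := hSd.exists_mem_open (isOpen_lt continuous_const (hc ω)) ⟨θ, hθ⟩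
      exact ⟨θ', h1, h2⟩
    · rintro ⟨θ, -, hθ⟩
      exact ⟨θ, hθ⟩
  rw [this]
  exact MeasurableSet.biUnion hS fun θ _ => measurableSet_lt measurable_const (hm θ)

end Kernel

end Gravity

namespace Gravity

/-! ### Continuity and measurability of the logit probabilities -/

section Continuity

variable {N T K : ℕ}

theorem continuous_index (p : Pair N) (t : Fin T) :
    Continuous fun q : Regressors N T K × Params N T K =>
      index q.1 q.2.1 q.2.2.1 q.2.2.2 p t := by
  unfold index
  fun_prop

theorem continuous_prob (p : Pair N) (t : Fin T) :
    Continuous fun q : Regressors N T K × Params N T K => prob q.1 q.2 p t := by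
  have : Nonempty (Fin T) := ⟨t⟩
  unfold prob softmax
  refine Continuous.div (Real.continuous_exp.comp (continuous_index p t))
    (continuous_finsetSum _ fun s _ => Real.continuous_exp.comp (continuous_index p s))
    fun q => (sum_exp_pos _).ne'

theorem measurable_prob {A : Type*} {_ : MeasurableSpace A} {x : A → Regressors N T K}
    {v : A → Params N T K} (hx : Measurable x) (hv : Measurable v) (p : Pair N) (t : Fin T) :
    Measurable fun a => prob (x a) (v a) p t := by
  have e : (fun a => prob (x a) (v a) p t) =
    (fun q : Regressors N T K × Params N T K => prob q.1 q.2 p t) ∘ fun a => (x a, v a) := rfl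
  rw [e]
  exact (continuous_prob p t).measurable.comp (hx.prodMk hv)

theorem continuous_prob_right (x : Regressors N T K) (p : Pair N) (t : Fin T) :
    Continuous fun v : Params N T K => prob x v p t := by
  have e : (fun v : Params N T K => prob x v p t) =
    (fun q : Regressors N T K × Params N T K => prob q.1 q.2 p t) ∘ fun v => (x, v) := rfl
  rw [e]
  exact (continuous_prob p t).comp (Continuous.prodMk_right x)

theorem inv_le_softmax {ι : Type*} [Fintype ι] {u : ι → ℝ} {B : ℝ} {t : ι}
    (h : ∀ s, |u s - u t| ≤ B) : (Fintype.card ι * Real.exp B)⁻¹ ≤ softmax u t := by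
  have : Nonempty ι := ⟨t⟩
  rw [softmax_eq_inv]
  refine inv_anti₀ (Finset.sum_pos (fun _ _ => Real.exp_pos _) Finset.univ_nonempty) ?_
  calc ∑ s, Real.exp (-(u t - u s)) ≤ ∑ _s : ι, Real.exp B :=
        Finset.sum_le_sum fun s _ => Real.exp_le_exp.2 (by
          rw [neg_sub]; exact (le_abs_self _).trans (h s))
    _ = Fintype.card ι * Real.exp B := by simp

end Continuity

/-! ### The panel at the truth, and the noise of truncated outcomes -/

namespace Panel

variable {Ω : Type*} [mΩ : MeasurableSpace Ω] {T K : ℕ}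

/-- The true parameters of the profile pseudo-log-likelihood. -/
def truth (D : Panel Ω T K) (β₀ : EuclideanSpace ℝ (Fin K)) (N : ℕ) (ω : Ω) : Params N T K :=
  (β₀, D.α N ω, D.γ N ω)

/-- The logit probabilities at the true parameters. -/
noncomputable def trueProb (D : Panel Ω T K) (β₀ : EuclideanSpace ℝ (Fin K)) (N : ℕ) (ω : Ω)
    (p : Pair N) (t : Fin T) : ℝ :=
  prob (D.x N ω) (D.truth β₀ N ω) p t

theorem trueLam_eq_exp (D : Panel Ω T K) (β₀ : EuclideanSpace ℝ (Fin K)) (N : ℕ) (ω : Ω)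
    (p : Pair N) (t : Fin T) :
    D.trueLam β₀ N ω p t =
      Real.exp (index (D.x N ω) β₀ (D.α N ω) (D.γ N ω) p t) * Real.exp (D.η N ω p) := by
  rw [trueLam, lam_eq, Real.exp_add]

theorem trueLam_pos (D : Panel Ω T K) (β₀ : EuclideanSpace ℝ (Fin K)) (N : ℕ) (ω : Ω)
    (p : Pair N) (t : Fin T) : 0 < D.trueLam β₀ N ω p t := Real.exp_pos _

theorem share_eq_trueProb (D : Panel Ω T K) (β₀ : EuclideanSpace ℝ (Fin K)) (N : ℕ) (ω : Ω)
    (p : Pair N) (t : Fin T) : D.share β₀ N ω p t = D.trueProb β₀ N ω p t := by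
  simp only [share, trueLam_eq_exp, ← Finset.sum_mul]
  rw [mul_div_mul_right _ _ (Real.exp_pos _).ne']
  rfl

theorem trueLam_eq_sum_mul (D : Panel Ω T K) (β₀ : EuclideanSpace ℝ (Fin K)) (N : ℕ) (ω : Ω)
    (p : Pair N) (t : Fin T) :
    D.trueLam β₀ N ω p t = (∑ s, D.trueLam β₀ N ω p s) * D.trueProb β₀ N ω p t := by
  have : Nonempty (Fin T) := ⟨t⟩
  rw [← share_eq_trueProb, share, mul_div_cancel₀]
  exact (Finset.sum_pos (fun s _ => D.trueLam_pos β₀ N ω p s) Finset.univ_nonempty).ne'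

theorem measurable_data (D : Panel Ω T K) (N : ℕ) :
    Measurable[D.given N] fun ω => (D.x N ω, D.α N ω, D.γ N ω, D.η N ω) :=
  comap_measurable _

theorem measurable_x_given (D : Panel Ω T K) (N : ℕ) : Measurable[D.given N] (D.x N) :=
  measurable_fst.comp (D.measurable_data N)

theorem measurable_truth_given (D : Panel Ω T K) (β₀ : EuclideanSpace ℝ (Fin K)) (N : ℕ) :
    Measurable[D.given N] (D.truth β₀ N) := by
  have : Measurable fun q : Regressors N T K × CountryTime N T × CountryTime N T × (Pair N → ℝ) =>
      ((β₀, q.2.1, q.2.2.1) : Params N T K) := by fun_prop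
  exact this.comp (D.measurable_data N)

theorem measurable_trueProb_given (D : Panel Ω T K) (β₀ : EuclideanSpace ℝ (Fin K)) (N : ℕ)
    (p : Pair N) (t : Fin T) : Measurable[D.given N] fun ω => D.trueProb β₀ N ω p t := by
  unfold trueProb
  exact measurable_prob (D.measurable_x_given N) (D.measurable_truth_given β₀ N) p t

/-- Conditional means of the outcomes truncated at `M`. -/
noncomputable def truncMean (D : Panel Ω T K) (μ : Measure Ω) (M : ℝ) (N : ℕ) (ω : Ω)
    (p : Pair N) (t : Fin T) : ℝ :=
  (μ[fun ω' => min (D.y N ω' p t) M | D.given N]) ω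

theorem measurable_truncMean_given (D : Panel Ω T K) (μ : Measure Ω) (M : ℝ) (N : ℕ)
    (p : Pair N) (t : Fin T) : Measurable[D.given N] fun ω => D.truncMean μ M N ω p t :=
  stronglyMeasurable_condExp.measurable

/-- The weighted deviation of the truncated outcomes from their conditional means, as a function of
the parameters. -/
noncomputable def fluctuation (D : Panel Ω T K) (μ : Measure Ω) (β₀ : EuclideanSpace ℝ (Fin K))
    (M : ℝ) (N : ℕ) (ω : Ω) (v : Params N T K) : ℝ :=
  ∑ p, ∑ t, (min (D.y N ω p t) M - D.truncMean μ M N ω p t) *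
    ((Real.sqrt (D.trueProb β₀ N ω p t))⁻¹ * Real.sqrt (prob (D.x N ω) v p t) - 1)

theorem measurable_y_apply (D : Panel Ω T K) (N : ℕ) (p : Pair N) (t : Fin T) :
    Measurable fun ω => D.y N ω p t :=
  (measurable_pi_apply t).comp ((measurable_pi_apply p).comp (D.measurable_y N))

theorem measurableSet_fluctuation (D : Panel Ω T K) (μ : Measure Ω)
    (β₀ : EuclideanSpace ℝ (Fin K)) (M : ℝ) (N : ℕ) (u : ℝ) :
    MeasurableSet {ω | ∃ v, u < |D.fluctuation μ β₀ M N ω v|} := by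
  have h1 : ∀ p t, Measurable fun ω => D.truncMean μ M N ω p t := fun p t =>
    (D.measurable_truncMean_given μ M N p t).mono (D.given_le N) le_rfl
  have h2 : ∀ p t, Measurable fun ω => D.trueProb β₀ N ω p t := fun p t =>
    (D.measurable_trueProb_given β₀ N p t).mono (D.given_le N) le_rfl
  have h3 : ∀ p t v, Measurable fun ω => prob (D.x N ω) v p t := fun p t v =>
    measurable_prob (D.measurable_x N) measurable_const p t
  refine measurableSet_exists_lt (F := fun ω v => |D.fluctuation μ β₀ M N ω v|) ?_ ?_ u
  · intro v
    have : Measurable fun ω => D.fluctuation μ β₀ M N ω v := by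
      unfold fluctuation
      refine Finset.measurable_sum _ fun p _ => Finset.measurable_sum _ fun t _ => ?_
      exact (((D.measurable_y_apply N p t).min measurable_const).sub (h1 p t)).mul
        (((h2 p t).sqrt.inv.mul (h3 p t v).sqrt).sub measurable_const)
    exact continuous_abs.measurable.comp this
  · intro ω
    unfold fluctuation
    refine continuous_abs.comp (continuous_finsetSum _ fun p _ => continuous_finsetSum _
      fun t _ => ?_)
    exact continuous_const.mul ((continuous_const.mul
      (continuous_prob_right (D.x N ω) p t).sqrt).sub continuous_const)

variable [StandardBorelSpace Ω]

/-- Under the conditional kernel the regressors, true shares and conditional means are almost surely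
constant and the pairs independent, so the deterministic bound applies. It does not depend on `ω`
and thus integrates to itself. -/
theorem measure_fluctuation_le (D : Panel Ω T K) (μ : Measure Ω) [IsProbabilityMeasure μ]
    (β₀ : EuclideanSpace ℝ (Fin K)) (N : ℕ) [Nonempty (Pair N)] (hT : 0 < T)
    (hpos : ∀ p t, ∀ᵐ ω ∂μ, 0 ≤ D.y N ω p t)
    (hind : iCondIndepFun (D.given N) (D.given_le N) (fun (p : Pair N) (ω : Ω) => D.y N ω p) μ)
    {M F u : ℝ} (hM : 0 < M) (hF : 1 ≤ F)
    (hprob : ∀ᵐ ω ∂μ, ∀ p t, (Real.sqrt (D.trueProb β₀ N ω p t))⁻¹ ≤ F)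
    {n : ℕ} (hn : 0 < n) (hu : 0 ≤ u)
    (hnet : (N : ℝ) ^ 2 * (T * (M * (F * Real.sqrt ((T + 2) / n)))) ≤ u / 2) :
    μ {ω | ∃ v, u < |D.fluctuation μ β₀ M N ω v|} ≤
      ENNReal.ofReal (((N ^ 2 * T ^ 2 * (2 * n ^ 2 + 1) + 1) ^ (K + 2 * (N * T)) : ℕ) *
        (2 * Real.exp (-(u / 2) ^ 2 / (2 * ((N : ℝ) ^ 2 * (T * (M * F)) ^ 2))))) := by
  refine measure_le_of_condExpKernel_le (D.given_le N)
    (D.measurableSet_fluctuation μ β₀ M N u) ?_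
  have hy : ∀ p t, Measurable fun ω => min (D.y N ω p t) M := fun p t =>
    (D.measurable_y_apply N p t).min measurable_const
  have hyp : ∀ᵐ ω ∂μ, ∀ p t, 0 ≤ D.y N ω p t := ae_all_iff.2 fun p => ae_all_iff.2 (hpos p)
  have hint : ∀ p t, Integrable (fun ω => min (D.y N ω p t) M) μ := fun p t =>
    Integrable.of_mem_Icc 0 M (hy p t).aemeasurable
      (hyp.mono fun ω h => ⟨le_min (h p t) hM.le, min_le_right _ _⟩)
  have hind' : ∀ᵐ ω ∂μ, iIndepFun (fun (p : Pair N) (ω : Ω) => D.y N ω p)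
      (condExpKernel μ (D.given N) ω) :=
    ae_of_ae_trim (D.given_le N) (ae_iIndepFun_of_kernel
      (fun p => (measurable_pi_apply p).comp (D.measurable_y N)) hind)
  have hx : ∀ᵐ ω ∂μ, ∀ p t k, ∀ᵐ ω' ∂condExpKernel μ (D.given N) ω,
      D.x N ω' p t k = D.x N ω p t k := by
    simp only [ae_all_iff]
    intro p t k
    refine ae_ae_condExpKernel_eq (D.given_le N) (f := fun ω => D.x N ω p t k) ?_
    have : Measurable fun z : Regressors N T K => z p t k := by fun_prop
    exact this.comp (D.measurable_x_given N)
  have hϑ : ∀ᵐ ω ∂μ, ∀ p t, ∀ᵐ ω' ∂condExpKernel μ (D.given N) ω,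
      D.trueProb β₀ N ω' p t = D.trueProb β₀ N ω p t := by
    simp only [ae_all_iff]
    intro p t
    exact ae_ae_condExpKernel_eq (D.given_le N) (D.measurable_trueProb_given β₀ N p t)
  have hmean : ∀ᵐ ω ∂μ, ∀ p t, ∀ᵐ ω' ∂condExpKernel μ (D.given N) ω,
      D.truncMean μ M N ω' p t = D.truncMean μ M N ω p t := by
    simp only [ae_all_iff]
    intro p t
    exact ae_ae_condExpKernel_eq (D.given_le N) (D.measurable_truncMean_given μ M N p t)
  have hmean2 : ∀ᵐ ω ∂μ, ∀ p t, D.truncMean μ M N ω p t =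
      ∫ ω', min (D.y N ω' p t) M ∂condExpKernel μ (D.given N) ω := by
    simp only [ae_all_iff]
    intro p t
    exact condExp_ae_eq_integral_condExpKernel (D.given_le N) (hint p t)
  filter_upwards [ae_ae_condExpKernel (D.given_le N) hyp, hind', hx, hϑ, hmean, hmean2, hprob]
    with ω h1 h2 h3 h4 h5 h6 h7
  have : Nonempty Ω := ⟨ω⟩
  simp only [← ae_all_iff] at h3 h4 h5
  have hsub : ∀ᵐ ω' ∂condExpKernel μ (D.given N) ω,
      (∃ v, u < |D.fluctuation μ β₀ M N ω' v|) → ω' ∈ {ω' | ∃ v : Params N T K,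
        u < |∑ p, ∑ t, (min (D.y N ω' p t) M -
          ∫ ω'', min (D.y N ω'' p t) M ∂condExpKernel μ (D.given N) ω) *
        ((Real.sqrt (D.trueProb β₀ N ω p t))⁻¹ * Real.sqrt (prob (D.x N ω) v p t) - 1)|} := by
    filter_upwards [h3, h4, h5] with ω' e3 e4 e5
    rintro ⟨v, hv⟩
    refine ⟨v, ?_⟩
    have ex : D.x N ω' = D.x N ω := funext fun p => funext fun t => funext fun k => e3 p t k
    simpa only [fluctuation, ex, e4, e5, h6] using hv
  refine (measure_mono_ae hsub).trans ?_
  refine measure_exists_fluctuation_le (condExpKernel μ (D.given N) ω) hT (D.x N ω)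
    (fun p ω' t => min (D.y N ω' p t) M) ?_ (fun p => measurable_pi_iff.2 (hy p)) hM hF ?_ _
    (fun p t => inv_nonneg.2 (Real.sqrt_nonneg _)) h7 hn hu hnet
  · exact h2.comp (fun _ z t => min (z t) M) fun p => measurable_pi_iff.2 fun t =>
      (measurable_pi_apply t).min measurable_const
  · exact fun p => h1.mono fun ω' h t => ⟨le_min (h p t) hM.le, min_le_right _ _⟩

end Panel

end Gravity

namespace Gravity

/-! ### Consequences of boundedness, moments and exogeneity -/

namespace Panel

variable {Ω : Type*} [mΩ : MeasurableSpace Ω] {T K : ℕ}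

theorem givenCell_le_given (D : Panel Ω T K) (N : ℕ) (p : Pair N) (t : Fin T) :
    D.givenCell N p t ≤ D.given N := by
  have h : Measurable fun q : Regressors N T K × CountryTime N T × CountryTime N T ×
      (Pair N → ℝ) => (q.1 p t, q.2.1 p.1.1 t, q.2.2.1 p.1.2 t, q.2.2.2 p) := by fun_prop
  exact (h.comp (D.measurable_data N)).comap_le

theorem measurable_trueLam_givenCell (D : Panel Ω T K) (β₀ : EuclideanSpace ℝ (Fin K)) (N : ℕ)
    (p : Pair N) (t : Fin T) :
    Measurable[D.givenCell N p t] fun ω => D.trueLam β₀ N ω p t := by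
  have h : Measurable fun q : (Fin K → ℝ) × ℝ × ℝ × ℝ =>
      Real.exp ((∑ k, q.1 k * β₀ k) + q.2.1 + q.2.2.1 + q.2.2.2) := by fun_prop
  have e : (fun ω => D.trueLam β₀ N ω p t) = (fun q : (Fin K → ℝ) × ℝ × ℝ × ℝ =>
      Real.exp ((∑ k, q.1 k * β₀ k) + q.2.1 + q.2.2.1 + q.2.2.2)) ∘
      fun ω => (D.x N ω p t, D.α N ω p.1.1 t, D.γ N ω p.1.2 t, D.η N ω p) := rfl
  rw [e]
  exact h.comp (comap_measurable _)

theorem measurable_trueLam_given (D : Panel Ω T K) (β₀ : EuclideanSpace ℝ (Fin K)) (N : ℕ)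
    (p : Pair N) (t : Fin T) : Measurable[D.given N] fun ω => D.trueLam β₀ N ω p t :=
  (D.measurable_trueLam_givenCell β₀ N p t).mono (D.givenCell_le_given N p t) le_rfl

variable [StandardBorelSpace Ω]
  {D : Panel Ω T K} {μ : Measure Ω} [IsProbabilityMeasure μ] {β₀ : EuclideanSpace ℝ (Fin K)}

/-- The pair effect cancels from the shares, so bounds on `x`, `α` and `γ` suffice. -/
theorem Regular.exists_le_trueProb (hD : D.Regular μ β₀) :
    ∃ κ : ℝ, 0 < κ ∧ κ ≤ 1 ∧ ∀ N, ∀ᵐ ω ∂μ, ∀ p t, κ ≤ D.trueProb β₀ N ω p t := by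
  obtain ⟨M, hM⟩ := hD.bounded
  set B : ℝ := 2 * (∑ k, |M| * |β₀ k|) + 4 * |M| with hB
  have hB0 : 0 ≤ B := by positivity
  have hB1 : 1 ≤ Real.exp B := Real.one_le_exp hB0
  -- `T + 1` rather than `T` keeps the constant positive when `T = 0`.
  refine ⟨(((T : ℝ) + 1) * Real.exp B)⁻¹, by positivity, ?_, fun N => ?_⟩
  · refine inv_le_one_of_one_le₀ ?_
    nlinarith [(Nat.cast_nonneg T : (0 : ℝ) ≤ T)]
  filter_upwards [hM N] with ω hω p t
  obtain ⟨hx, hα, hγ⟩ := hω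
  have hidx : ∀ s, |index (D.x N ω) β₀ (D.α N ω) (D.γ N ω) p s| ≤
      (∑ k, |M| * |β₀ k|) + |M| + |M| := by
    intro s
    refine (abs_add_le _ _).trans (add_le_add ((abs_add_le _ _).trans (add_le_add ?_ ?_)) ?_)
    · refine (Finset.abs_sum_le_sum_abs _ _).trans (Finset.sum_le_sum fun k _ => ?_)
      rw [abs_mul]
      exact mul_le_mul_of_nonneg_right ((hx p s k).trans (le_abs_self M)) (abs_nonneg _)
    · exact (hα _ _).trans (le_abs_self M)
    · exact (hγ _ _).trans (le_abs_self M)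
  refine le_trans ?_ (inv_le_softmax (B := B) fun s =>
    (abs_sub _ _).trans ((add_le_add (hidx s) (hidx t)).trans (by rw [hB]; linarith)))
  have : Nonempty (Fin T) := ⟨t⟩
  refine inv_anti₀ (by have := Fintype.card_pos (α := Fin T); positivity) ?_
  rw [Fintype.card_fin]
  gcongr
  linarith

theorem Regular.integrable_trueLam (hD : D.Regular μ β₀) (N : ℕ) (p : Pair N) (t : Fin T) :
    Integrable (fun ω => D.trueLam β₀ N ω p t) μ :=
  integrable_condExp.congr (hD.exogenous N p t)

/-- `η` need not be bounded, so the moments are used: `λ` is measurable for the cell, whence by the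
tower property it is the cell-conditional mean of `y`, and `y ≤ 1 + y^(8 + ν)`. -/
theorem Regular.exists_trueLam_le (hD : D.Regular μ β₀) :
    ∃ C : ℝ, 0 ≤ C ∧ ∀ N, ∀ᵐ ω ∂μ, ∀ p t, D.trueLam β₀ N ω p t ≤ C := by
  obtain ⟨ν, hν, C, hC⟩ := hD.moments
  refine ⟨1 + |C|, by positivity, fun N => ?_⟩
  rw [ae_all_iff]; intro p
  rw [ae_all_iff]; intro t
  obtain ⟨hint, hbound⟩ := hC N p t
  have hcell := D.givenCell_le_given N p t
  have hcell' := hcell.trans (D.given_le N)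
  have h1 : μ[μ[fun ω => D.y N ω p t | D.given N] | D.givenCell N p t] =ᵐ[μ]
      μ[fun ω => D.y N ω p t | D.givenCell N p t] := condExp_condExp_of_le hcell (D.given_le N)
  have h2 := condExp_congr_ae (m := D.givenCell N p t) (hD.exogenous N p t)
  have h3 : μ[fun ω => D.trueLam β₀ N ω p t | D.givenCell N p t] =
      fun ω => D.trueLam β₀ N ω p t :=
    condExp_of_stronglyMeasurable hcell'
      (D.measurable_trueLam_givenCell β₀ N p t).stronglyMeasurable (hD.integrable_trueLam N p t)
  rw [h3] at h2
  have h4 : μ[fun ω => D.y N ω p t | D.givenCell N p t] ≤ᵐ[μ]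
      μ[(fun _ => (1 : ℝ)) + fun ω => D.y N ω p t ^ (8 + ν) | D.givenCell N p t] := by
    refine condExp_mono (hD.integrable N p t) ((integrable_const 1).add hint) ?_
    filter_upwards [hD.nonneg N p t] with ω hω
    simp only [Pi.add_apply]
    rcases le_total (D.y N ω p t) 1 with hy | hy
    · linarith [Real.rpow_nonneg hω (8 + ν)]
    · have := Real.rpow_le_rpow_of_exponent_le hy (show (1 : ℝ) ≤ 8 + ν by linarith)
      rw [Real.rpow_one] at this
      linarith
  have h5 := condExp_add (μ := μ) (integrable_const (1 : ℝ)) hint (D.givenCell N p t)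
  rw [condExp_const hcell'] at h5
  filter_upwards [h1, h2, h4, h5, hbound] with ω e1 e2 e4 e5 e6
  rw [e5] at e4
  rw [← e2, e1]
  exact e4.trans (add_le_add le_rfl (e6.trans (le_abs_self C)))

theorem Regular.exists_integral_excess_le (hD : D.Regular μ β₀) :
    ∃ C : ℝ, 0 ≤ C ∧ ∀ N p t, ∀ M : ℝ, 1 ≤ M →
      ∫ ω, (D.y N ω p t - min (D.y N ω p t) M) ∂μ ≤ C / M := by
  obtain ⟨ν, hν, C, hC⟩ := hD.moments
  refine ⟨|C|, abs_nonneg C, fun N p t M hM => ?_⟩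
  obtain ⟨hint, hbound⟩ := hC N p t
  have hcell' := (D.givenCell_le_given N p t).trans (D.given_le N)
  have h1 : ∫ ω, D.y N ω p t ^ (8 + ν) ∂μ ≤ |C| := by
    rw [← integral_condExp hcell']
    calc _ ≤ ∫ _, |C| ∂μ := integral_mono_ae integrable_condExp (integrable_const _)
          (hbound.mono fun ω h => h.trans (le_abs_self C))
      _ = |C| := by simp
  have hmin : Integrable (fun ω => min (D.y N ω p t) M) μ :=
    (hD.integrable N p t).inf (integrable_const M)
  calc ∫ ω, (D.y N ω p t - min (D.y N ω p t) M) ∂μ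
      ≤ ∫ ω, D.y N ω p t ^ (8 + ν) / M ∂μ := by
        refine integral_mono_ae ((hD.integrable N p t).sub hmin) (hint.div_const M) ?_
        filter_upwards [hD.nonneg N p t] with ω hω
        rcases le_total (D.y N ω p t) M with hy | hy
        · rw [min_eq_left hy, sub_self]
          have := Real.rpow_nonneg hω (8 + ν)
          positivity
        · rw [min_eq_right hy, le_div_iff₀ (by linarith)]
          -- For `y ≥ M ≥ 1` one has `y ≤ y²/M ≤ y^(8 + ν)/M`.
          have h2 := Real.rpow_le_rpow_of_exponent_le (hM.trans hy)
            (show (2 : ℝ) ≤ 8 + ν by linarith)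
          rw [Real.rpow_two] at h2
          nlinarith
    _ = (∫ ω, D.y N ω p t ^ (8 + ν) ∂μ) / M := integral_div _ _
    _ ≤ |C| / M := by gcongr

/-- The outcomes in excess of `M` and their conditional means, summed over the panel. -/
noncomputable def excess (D : Panel Ω T K) (μ : Measure Ω) (β₀ : EuclideanSpace ℝ (Fin K))
    (M : ℝ) (N : ℕ) (ω : Ω) : ℝ :=
  ∑ p, ∑ t, ((D.y N ω p t - min (D.y N ω p t) M) +
    (D.trueLam β₀ N ω p t - D.truncMean μ M N ω p t))

theorem Regular.trueLam_sub_truncMean (hD : D.Regular μ β₀) (M : ℝ) (N : ℕ) (p : Pair N)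
    (t : Fin T) : (fun ω => D.trueLam β₀ N ω p t - D.truncMean μ M N ω p t) =ᵐ[μ]
      μ[fun ω => D.y N ω p t - min (D.y N ω p t) M | D.given N] := by
  have h := condExp_sub (hD.integrable N p t)
    ((hD.integrable N p t).inf (integrable_const (μ := μ) M)) (D.given N)
  filter_upwards [h, hD.exogenous N p t] with ω h1 h2
  refine Eq.trans ?_ h1.symm
  rw [Pi.sub_apply, h2]
  rfl

theorem Regular.excess_terms_nonneg (hD : D.Regular μ β₀) (M : ℝ) (N : ℕ) :
    ∀ᵐ ω ∂μ, ∀ p t, 0 ≤ D.trueLam β₀ N ω p t - D.truncMean μ M N ω p t := by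
  simp only [ae_all_iff]
  intro p t
  have h : 0 ≤ᵐ[μ] μ[fun ω => D.y N ω p t - min (D.y N ω p t) M | D.given N] :=
    condExp_nonneg (ae_of_all _ fun ω => sub_nonneg.2 (min_le_left _ _))
  filter_upwards [h, hD.trueLam_sub_truncMean M N p t] with ω h1 h2
  rw [h2]; exact h1

/-- Markov's inequality: `λ - truncMean` is the conditional mean of `y - min y M`, so both parts of
each term have the same integral. -/
theorem Regular.exists_measure_excess_le (hD : D.Regular μ β₀) :
    ∃ C : ℝ, 0 ≤ C ∧ ∀ N, ∀ M u : ℝ, 1 ≤ M → 0 < u →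
      μ {ω | u ≤ D.excess μ β₀ M N ω} ≤ ENNReal.ofReal ((N : ℝ) ^ 2 * C / (M * u)) := by
  obtain ⟨C, hC0, hC⟩ := hD.exists_integral_excess_le
  refine ⟨T * (2 * C), by positivity, fun N M u hM hu => ?_⟩
  have hM0 : 0 < M := by linarith
  have hi1 : ∀ p t, Integrable (fun ω => D.y N ω p t - min (D.y N ω p t) M) μ := fun p t =>
    (hD.integrable N p t).sub ((hD.integrable N p t).inf (integrable_const M))
  have hi2 : ∀ p t, Integrable (fun ω => D.trueLam β₀ N ω p t - D.truncMean μ M N ω p t) μ :=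
    fun p t => integrable_condExp.congr (hD.trueLam_sub_truncMean M N p t).symm
  have hi3 : ∀ p t, Integrable (fun ω => (D.y N ω p t - min (D.y N ω p t) M) +
      (D.trueLam β₀ N ω p t - D.truncMean μ M N ω p t)) μ := fun p t => (hi1 p t).add (hi2 p t)
  have hi4 : ∀ p, Integrable (fun ω => ∑ t, ((D.y N ω p t - min (D.y N ω p t) M) +
      (D.trueLam β₀ N ω p t - D.truncMean μ M N ω p t))) μ := fun p =>
    integrable_finsetSum _ fun t _ => hi3 p t
  have hint : Integrable (D.excess μ β₀ M N) μ := integrable_finsetSum _ fun p _ => hi4 p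
  have hnn : 0 ≤ᵐ[μ] D.excess μ β₀ M N := by
    filter_upwards [hD.excess_terms_nonneg M N] with ω hω
    exact Finset.sum_nonneg fun p _ => Finset.sum_nonneg fun t _ =>
      add_nonneg (sub_nonneg.2 (min_le_left _ _)) (hω p t)
  have hval : ∫ ω, D.excess μ β₀ M N ω ∂μ ≤ (N : ℝ) ^ 2 * (T * (2 * C)) / M := by
    unfold excess
    rw [integral_finsetSum _ fun p _ => hi4 p]
    calc ∑ p, ∫ ω, ∑ t, ((D.y N ω p t - min (D.y N ω p t) M) +
          (D.trueLam β₀ N ω p t - D.truncMean μ M N ω p t)) ∂μ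
        ≤ ∑ _p : Pair N, T * (2 * C / M) := by
          refine Finset.sum_le_sum fun p _ => ?_
          rw [integral_finsetSum _ fun t _ => hi3 p t]
          calc _ ≤ ∑ _t : Fin T, 2 * C / M := by
                refine Finset.sum_le_sum fun t _ => ?_
                rw [integral_add (hi1 p t) (hi2 p t),
                  integral_congr_ae (hD.trueLam_sub_truncMean M N p t),
                  integral_condExp (D.given_le N)]
                have := hC N p t M hM
                have e : 2 * C / M = C / M + C / M := by ring
                rw [e]; exact add_le_add this this
            _ = T * (2 * C / M) := by simp
      _ = Fintype.card (Pair N) * (T * (2 * C / M)) := by simp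
      _ ≤ (N : ℝ) ^ 2 * (T * (2 * C / M)) := by
          gcongr; exact_mod_cast card_pair_le
      _ = (N : ℝ) ^ 2 * (T * (2 * C)) / M := by ring
  have hmk := mul_meas_ge_le_integral_of_nonneg hnn hint u
  rw [← ofReal_measureReal]
  refine ENNReal.ofReal_le_ofReal ?_
  rw [← div_div, le_div_iff₀ hu, mul_comm]
  exact hmk.trans hval

/-- The shares are measurable for the conditioning and factor out, and the pair total has
conditional mean `∑ λ`. The result is the multinomial covariance matrix scaled by the pair mean. -/
theorem Regular.expHess_eq (hD : D.Regular μ β₀) (N : ℕ) :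
    ∀ᵐ ω ∂μ, ∀ p t s, D.expHess μ β₀ N ω p t s = (∑ τ, D.trueLam β₀ N ω p τ) *
      ((if t = s then D.trueProb β₀ N ω p t else 0) -
        D.trueProb β₀ N ω p t * D.trueProb β₀ N ω p s) := by
  simp only [ae_all_iff]
  intro p t s
  set f : Ω → ℝ := fun ω => (if t = s then D.trueProb β₀ N ω p t else 0) -
    D.trueProb β₀ N ω p t * D.trueProb β₀ N ω p s with hf
  set Y : Ω → ℝ := fun ω => ∑ τ, D.y N ω p τ with hY
  have hhess : (fun ω => D.hess β₀ N ω p t s) = f * Y := by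
    funext ω
    simp only [hess, Matrix.of_apply, share_eq_trueProb, hf, hY, Pi.mul_apply]
    split_ifs with h
    · subst h; ring
    · ring
  have hfm : Measurable[D.given N] f := by
    have h1 := D.measurable_trueProb_given β₀ N p t
    have h2 := D.measurable_trueProb_given β₀ N p s
    refine Measurable.sub ?_ (h1.mul h2)
    split_ifs
    · exact h1
    · exact measurable_const
  have hYint : Integrable Y μ := integrable_finsetSum _ fun τ _ => hD.integrable N p τ
  have hp : ∀ ω r, 0 ≤ D.trueProb β₀ N ω p r ∧ D.trueProb β₀ N ω p r ≤ 1 := fun ω r =>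
    ⟨(softmax_pos _ _).le, softmax_le_one _ _⟩
  have hfY : Integrable (f * Y) μ := by
    refine hYint.bdd_mul (c := 1) ((hfm.mono (D.given_le N) le_rfl).aestronglyMeasurable)
      (ae_of_all _ fun ω => ?_)
    obtain ⟨h1, h2⟩ := hp ω t
    obtain ⟨h3, h4⟩ := hp ω s
    rw [Real.norm_eq_abs, abs_le, hf]
    have h5 := mul_nonneg h1 h3
    have h6 := mul_le_one₀ h2 h3 h4
    constructor <;> simp only <;> split_ifs <;> linarith
  have h1 := condExp_mul_of_stronglyMeasurable_left hfm.stronglyMeasurable hfY hYint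
  have h2 : μ[Y | D.given N] =ᵐ[μ] fun ω => ∑ τ, D.trueLam β₀ N ω p τ := by
    have h3 := condExp_finsetSum (μ := μ) (s := (Finset.univ : Finset (Fin T)))
      (f := fun τ ω => D.y N ω p τ) (fun τ _ => hD.integrable N p τ) (D.given N)
    have h4 : ∀ᵐ ω ∂μ, ∀ τ, (μ[fun ω => D.y N ω p τ | D.given N]) ω = D.trueLam β₀ N ω p τ :=
      ae_all_iff.2 fun τ => hD.exogenous N p τ
    have e : Y = ∑ τ, fun ω => D.y N ω p τ := by funext ω; simp [hY]
    rw [e]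
    filter_upwards [h3, h4] with ω e3 e4
    rw [e3, Finset.sum_apply]
    exact Finset.sum_congr rfl fun τ _ => e4 τ
  filter_upwards [h1, h2] with ω e1 e2
  simp only [expHess, Matrix.of_apply]
  rw [hhess, e1, Pi.mul_apply, e2, mul_comm]

end Panel

end Gravity

namespace Gravity

/-! ### Quadratic forms and positive definiteness -/

section LeastSquares

open Matrix

/-- Rank-one perturbations in a direction `b` reduce the matrix least squares problem to the scalar
problem for `x b`. -/
theorem trace_quadratic_add_vecMulVec {m n : Type*} [Fintype m] [Fintype n]
    (R : Matrix m n ℝ) {H : Matrix m m ℝ} (hH : Hᵀ = H) (d : m → ℝ) (b : n → ℝ) :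
    trace ((R + vecMulVec d b)ᵀ * H * (R + vecMulVec d b)) =
      trace (Rᵀ * H * R) + 2 * ((R *ᵥ b) ⬝ᵥ (H *ᵥ d)) + (b ⬝ᵥ b) * (d ⬝ᵥ (H *ᵥ d)) := by
  have e1 : trace (Rᵀ * H * vecMulVec d b) = (R *ᵥ b) ⬝ᵥ (H *ᵥ d) := by
    rw [mul_vecMulVec, trace_vecMulVec, ← mulVec_mulVec, mulVec_transpose, ← dotProduct_mulVec,
      dotProduct_comm]
  have e2 : trace (vecMulVec b d * H * R) = (R *ᵥ b) ⬝ᵥ (H *ᵥ d) := by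
    rw [← e1, ← trace_transpose]
    simp [transpose_mul, hH, Matrix.mul_assoc]
  have e3 : trace (vecMulVec b d * H * vecMulVec d b) = (b ⬝ᵥ b) * (d ⬝ᵥ (H *ᵥ d)) := by
    rw [Matrix.mul_assoc, mul_vecMulVec, vecMulVec_mul_vecMulVec, trace_vecMulVec, dotProduct_smul,
      smul_eq_mul, mul_comm]
  rw [transpose_add, transpose_vecMulVec]
  simp only [Matrix.add_mul, Matrix.mul_add, trace_add, e1, e2, e3]
  ring

theorem eq_zero_of_forall_quadratic_nonneg {c₁ c₂ : ℝ} (hc₂ : 0 ≤ c₂)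
    (h : ∀ s : ℝ, 0 ≤ 2 * s * c₁ + s ^ 2 * c₂) : c₁ = 0 := by
  -- Nearly the minimizer `-c₁ / c₂`; the `+ 1` also covers `c₂ = 0`.
  have h1 := h (-c₁ / (c₂ + 1))
  have h2 : 2 * (-c₁ / (c₂ + 1)) * c₁ + (-c₁ / (c₂ + 1)) ^ 2 * c₂ =
      -(c₁ ^ 2 * (c₂ + 2)) / (c₂ + 1) ^ 2 := by
    field_simp; ring
  rw [h2, le_div_iff₀ (by positivity), zero_mul] at h1
  have h3 : 0 ≤ c₁ ^ 2 * (c₂ + 2) := by positivity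
  have h4 : c₁ ^ 2 * (c₂ + 2) = 0 := by linarith
  rcases mul_eq_zero.1 h4 with h5 | h5
  · exact pow_eq_zero_iff two_ne_zero |>.1 h5
  · linarith

theorem dotProduct_sum_mulVec {ι m : Type*} [Fintype ι] [Fintype m] (A : ι → Matrix m m ℝ)
    (b : m → ℝ) : b ⬝ᵥ ((∑ i, A i) *ᵥ b) = ∑ i, b ⬝ᵥ (A i *ᵥ b) := by
  rw [sum_mulVec, dotProduct_sum]

theorem dotProduct_mulVec_add {m : Type*} [Fintype m] {H : Matrix m m ℝ} (hH : Hᵀ = H)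
    (r d : m → ℝ) : (r + d) ⬝ᵥ (H *ᵥ (r + d)) =
      r ⬝ᵥ (H *ᵥ r) + 2 * (r ⬝ᵥ (H *ᵥ d)) + d ⬝ᵥ (H *ᵥ d) := by
  have h : d ⬝ᵥ (H *ᵥ r) = r ⬝ᵥ (H *ᵥ d) := by
    conv_lhs => rw [← hH, mulVec_transpose, dotProduct_comm, ← dotProduct_mulVec]
  rw [mulVec_add, dotProduct_add, add_dotProduct, add_dotProduct, h]
  ring

theorem abs_dotProduct_mulVec_le {m : Type*} [Fintype m] (A : Matrix m m ℝ) (b : m → ℝ) :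
    |b ⬝ᵥ (A *ᵥ b)| ≤ (∑ k, ∑ l, |A k l|) * (b ⬝ᵥ b) := by
  have hsq : ∀ k, |b k| ^ 2 ≤ b ⬝ᵥ b := fun k => by
    rw [sq_abs, sq]
    exact Finset.single_le_sum (f := fun k => b k * b k) (fun k _ => mul_self_nonneg _)
      (Finset.mem_univ k)
  have hbb : ∀ k l, |b k| * |b l| ≤ b ⬝ᵥ b := fun k l => by
    nlinarith [hsq k, hsq l, sq_nonneg (|b k| - |b l|)]
  rw [dotProduct, Finset.sum_mul]
  refine (Finset.abs_sum_le_sum_abs _ _).trans (Finset.sum_le_sum fun k _ => ?_)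
  rw [mulVec, dotProduct, Finset.mul_sum, Finset.sum_mul]
  refine (Finset.abs_sum_le_sum_abs _ _).trans (Finset.sum_le_sum fun l _ => ?_)
  calc |b k * (A k l * b l)| = |A k l| * (|b k| * |b l|) := by
        rw [abs_mul, abs_mul]; ring
    _ ≤ |A k l| * (b ⬝ᵥ b) := mul_le_mul_of_nonneg_left (hbb k l) (abs_nonneg _)

theorem exists_le_dotProduct_of_posDef {K : ℕ} {W : Matrix (Fin K) (Fin K) ℝ} (hW : W.PosDef) :
    ∃ c : ℝ, 0 < c ∧ ∀ b : Fin K → ℝ, c * (b ⬝ᵥ b) ≤ b ⬝ᵥ (W *ᵥ b) := by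
  set f : EuclideanSpace ℝ (Fin K) → ℝ := fun b => b.ofLp ⬝ᵥ (W *ᵥ b.ofLp) with hf
  have hcont : Continuous f := by
    simp only [hf, dotProduct, mulVec]
    fun_prop
  have hhom : ∀ (r : ℝ) b, f (r • b) = r ^ 2 * f b := by
    intro r b
    simp only [hf, WithLp.ofLp_smul, mulVec_smul, smul_dotProduct, dotProduct_smul, smul_eq_mul]
    ring
  have hnorm : ∀ b : Fin K → ℝ, b ⬝ᵥ b = ‖WithLp.toLp 2 b‖ ^ 2 := by
    intro b
    rw [EuclideanSpace.norm_sq_eq]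
    simp [dotProduct, sq]
  rcases (Metric.sphere (0 : EuclideanSpace ℝ (Fin K)) 1).eq_empty_or_nonempty with h | h
  · refine ⟨1, one_pos, fun b => ?_⟩
    have hb : WithLp.toLp 2 b = 0 := by
      by_contra hne
      have : ‖WithLp.toLp 2 b‖⁻¹ • WithLp.toLp 2 b ∈
          Metric.sphere (0 : EuclideanSpace ℝ (Fin K)) 1 := by
        rw [mem_sphere_zero_iff_norm, norm_smul, norm_inv, norm_norm,
          inv_mul_cancel₀ (norm_ne_zero_iff.2 hne)]
      rw [h] at this
      exact this
    have hb' : b = 0 := by simpa using congrArg WithLp.ofLp hb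
    simp [hb']
  · obtain ⟨b₀, hb₀, hmin⟩ := (isCompact_sphere (0 : EuclideanSpace ℝ (Fin K)) 1).exists_isMinOn h
      hcont.continuousOn
    have hb₀n : ‖b₀‖ = 1 := mem_sphere_zero_iff_norm.1 hb₀
    have hpos : 0 < f b₀ := by
      have hne : b₀.ofLp ≠ 0 := fun h0 => by
        have : b₀ = 0 := by ext i; simpa using congrFun h0 i
        rw [this, norm_zero] at hb₀n
        exact zero_ne_one hb₀n
      simpa using hW.dotProduct_mulVec_pos hne
    refine ⟨f b₀, hpos, fun b => ?_⟩
    rw [hnorm]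
    rcases eq_or_ne (WithLp.toLp 2 b) 0 with h0 | hne
    · have hb' : b = 0 := by simpa using congrArg WithLp.ofLp h0
      simp [hb']
    · have hn := norm_ne_zero_iff.2 hne
      have hu : ‖WithLp.toLp 2 b‖⁻¹ • WithLp.toLp 2 b ∈
          Metric.sphere (0 : EuclideanSpace ℝ (Fin K)) 1 := by
        rw [mem_sphere_zero_iff_norm, norm_smul, norm_inv, norm_norm, inv_mul_cancel₀ hn]
      have h1 : f b₀ ≤ f (‖WithLp.toLp 2 b‖⁻¹ • WithLp.toLp 2 b) := hmin hu
      rw [hhom, inv_pow, inv_mul_eq_div, le_div_iff₀ (by positivity)] at h1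
      exact h1

theorem exists_eventually_le_dotProduct {K : ℕ} {W : Matrix (Fin K) (Fin K) ℝ} (hW : W.PosDef)
    {A : ℕ → Matrix (Fin K) (Fin K) ℝ} (hA : Tendsto A atTop (𝓝 W)) :
    ∃ c : ℝ, 0 < c ∧ ∀ᶠ N in atTop, ∀ b : Fin K → ℝ, c * (b ⬝ᵥ b) ≤ b ⬝ᵥ (A N *ᵥ b) := by
  obtain ⟨c, hc, hcW⟩ := exists_le_dotProduct_of_posDef hW
  refine ⟨c / 2, by positivity, ?_⟩
  have hlim : Tendsto (fun N => ∑ k, ∑ l, |A N k l - W k l|) atTop (𝓝 0) := by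
    have : ∀ k l, Tendsto (fun N => |A N k l - W k l|) atTop (𝓝 0) := by
      intro k l
      have h1 := (tendsto_pi_nhds.1 (tendsto_pi_nhds.1 hA k) l).sub_const (W k l)
      rw [sub_self] at h1
      simpa using h1.abs
    have h2 := tendsto_finsetSum (Finset.univ : Finset (Fin K)) fun k _ =>
      tendsto_finsetSum (Finset.univ : Finset (Fin K)) fun l _ => this k l
    simpa using h2
  filter_upwards [hlim.eventually (gt_mem_nhds (show (0 : ℝ) < c / 2 by positivity))] with N hN b
  have hdiff := abs_dotProduct_mulVec_le (A N - W) b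
  simp only [Matrix.sub_apply] at hdiff
  rw [sub_mulVec, dotProduct_sub] at hdiff
  have h1 := (abs_le.1 hdiff).1
  have h2 := hcW b
  have h3 : 0 ≤ b ⬝ᵥ b := Finset.sum_nonneg fun k _ => mul_self_nonneg _
  nlinarith

end LeastSquares

/-! ### The within-transformation as a projection -/

namespace Panel

open Matrix

variable {Ω : Type*} [mΩ : MeasurableSpace Ω] {T K : ℕ} {D : Panel Ω T K} {μ : Measure Ω}
  {β₀ : EuclideanSpace ℝ (Fin K)} {N : ℕ} {ω : Ω}

theorem residual_perturb (a g : Fin N → Matrix (Fin T) (Fin K) ℝ) (a₀ g₀ : CountryTime N T)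
    (b : Fin K → ℝ) (s : ℝ) (p : Pair N) :
    D.residual N ω (fun i => a i - s • vecMulVec (a₀ i) b) (fun j => g j - s • vecMulVec (g₀ j) b) p
      = D.residual N ω a g p + vecMulVec (s • (a₀ p.1.1 + g₀ p.1.2)) b := by
  ext t k
  simp only [residual, Matrix.sub_apply, Matrix.add_apply, Matrix.smul_apply, vecMulVec_apply, Pi.smul_apply,
    Pi.add_apply, smul_eq_mul]
  ring

/-- Normal equations: the criterion along a line of perturbations is a quadratic with its minimum at
zero, so its linear coefficient vanishes. -/
theorem IsProjection.orthogonal {a g : Fin N → Matrix (Fin T) (Fin K) ℝ}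
    (h : D.IsProjection μ β₀ N ω a g)
    (hsymm : ∀ p, (D.expHess μ β₀ N ω p)ᵀ = D.expHess μ β₀ N ω p)
    (hpsd : ∀ p d, 0 ≤ d ⬝ᵥ (D.expHess μ β₀ N ω p *ᵥ d)) (b : Fin K → ℝ)
    (a₀ g₀ : CountryTime N T) :
    ∑ p, (D.residual N ω a g p *ᵥ b) ⬝ᵥ
      (D.expHess μ β₀ N ω p *ᵥ (a₀ p.1.1 + g₀ p.1.2)) = 0 := by
  refine eq_zero_of_forall_quadratic_nonneg
    (c₂ := (b ⬝ᵥ b) * ∑ p : Pair N, (a₀ p.1.1 + g₀ p.1.2) ⬝ᵥ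
      (D.expHess μ β₀ N ω p *ᵥ (a₀ p.1.1 + g₀ p.1.2))) ?_ fun s => ?_
  · exact mul_nonneg (Finset.sum_nonneg fun k _ => mul_self_nonneg _)
      (Finset.sum_nonneg fun p _ => hpsd p _)
  · have h1 := h (fun i => a i - s • vecMulVec (a₀ i) b) (fun j => g j - s • vecMulVec (g₀ j) b)
    simp only [projCriterion, residual_perturb, trace_quadratic_add_vecMulVec _ (hsymm _),
      mulVec_smul, dotProduct_smul, smul_dotProduct, smul_eq_mul, Finset.sum_add_distrib,
      ← Finset.mul_sum] at h1
    nlinarith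

/-- Pythagoras: `x b + a₀ + g₀` is the projected residual `r` plus a two-way term `d`, which is
orthogonal to it and has nonnegative square. -/
theorem IsProjection.quadratic_le {a g : Fin N → Matrix (Fin T) (Fin K) ℝ}
    (h : D.IsProjection μ β₀ N ω a g)
    (hsymm : ∀ p, (D.expHess μ β₀ N ω p)ᵀ = D.expHess μ β₀ N ω p)
    (hpsd : ∀ p d, 0 ≤ d ⬝ᵥ (D.expHess μ β₀ N ω p *ᵥ d)) (b : Fin K → ℝ)
    (a₀ g₀ : CountryTime N T) :
    b ⬝ᵥ ((∑ p, (D.residual N ω a g p)ᵀ * D.expHess μ β₀ N ω p * D.residual N ω a g p) *ᵥ b) ≤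
      ∑ p : Pair N, (Matrix.of (D.x N ω p) *ᵥ b + a₀ p.1.1 + g₀ p.1.2) ⬝ᵥ
        (D.expHess μ β₀ N ω p *ᵥ (Matrix.of (D.x N ω p) *ᵥ b + a₀ p.1.1 + g₀ p.1.2)) := by
  have horth := h.orthogonal hsymm hpsd b (fun i => a₀ i + a i *ᵥ b) (fun j => g₀ j + g j *ᵥ b)
  rw [dotProduct_sum_mulVec]
  have key : ∀ p : Pair N, b ⬝ᵥ (((D.residual N ω a g p)ᵀ * D.expHess μ β₀ N ω p *
      D.residual N ω a g p) *ᵥ b) + 2 * ((D.residual N ω a g p *ᵥ b) ⬝ᵥ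
      (D.expHess μ β₀ N ω p *ᵥ (a₀ p.1.1 + a p.1.1 *ᵥ b + (g₀ p.1.2 + g p.1.2 *ᵥ b)))) ≤
      (Matrix.of (D.x N ω p) *ᵥ b + a₀ p.1.1 + g₀ p.1.2) ⬝ᵥ
        (D.expHess μ β₀ N ω p *ᵥ (Matrix.of (D.x N ω p) *ᵥ b + a₀ p.1.1 + g₀ p.1.2)) := by
    intro p
    set r := D.residual N ω a g p *ᵥ b with hr
    set d := a₀ p.1.1 + a p.1.1 *ᵥ b + (g₀ p.1.2 + g p.1.2 *ᵥ b) with hd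
    have hu : Matrix.of (D.x N ω p) *ᵥ b + a₀ p.1.1 + g₀ p.1.2 = r + d := by
      rw [hr, hd, residual, sub_mulVec, sub_mulVec]; abel
    have h1 : b ⬝ᵥ (((D.residual N ω a g p)ᵀ * D.expHess μ β₀ N ω p *
        D.residual N ω a g p) *ᵥ b) = r ⬝ᵥ (D.expHess μ β₀ N ω p *ᵥ r) := by
      rw [← mulVec_mulVec, ← mulVec_mulVec, ← hr, mulVec_transpose, dotProduct_comm,
        ← dotProduct_mulVec, dotProduct_comm]
    rw [hu, h1, dotProduct_mulVec_add (hsymm p)]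
    linarith [hpsd p d]
  have := Finset.sum_le_sum fun p (_ : p ∈ Finset.univ) => key p
  rw [Finset.sum_add_distrib, ← Finset.mul_sum] at this
  have horth' : ∑ p : Pair N, (D.residual N ω a g p *ᵥ b) ⬝ᵥ
      (D.expHess μ β₀ N ω p *ᵥ (a₀ p.1.1 + a p.1.1 *ᵥ b + (g₀ p.1.2 + g p.1.2 *ᵥ b))) = 0 := horth
  rw [horth', mul_zero, add_zero] at this
  exact this

end Panel

end Gravity

namespace Gravity

/-! ### The logit Hessian as a variance -/

section LogitVariance

variable {ι : Type*} [Fintype ι] {θ : ι → ℝ}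

open Matrix

theorem dotProduct_logitHess_mulVec [DecidableEq ι] (H : Matrix ι ι ℝ) (L : ℝ)
    (hH : ∀ t s, H t s = L * ((if t = s then θ t else 0) - θ t * θ s)) (d : ι → ℝ) :
    d ⬝ᵥ (H *ᵥ d) = L * (∑ t, θ t * d t ^ 2 - (∑ t, θ t * d t) ^ 2) := by
  have h1 : ∀ t, (H *ᵥ d) t = L * (θ t * d t - θ t * ∑ s, θ s * d s) := by
    intro t
    simp only [mulVec, dotProduct, hH, mul_sub, sub_mul, Finset.sum_sub_distrib, mul_ite, mul_zero,
      ite_mul, zero_mul, Finset.sum_ite_eq, Finset.mem_univ, if_true, Finset.mul_sum]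
    congr 1
    · ring
    · exact Finset.sum_congr rfl fun s _ => by ring
  simp only [dotProduct, h1]
  rw [sq, Finset.sum_mul, ← Finset.sum_sub_distrib, Finset.mul_sum]
  exact Finset.sum_congr rfl fun t _ => by ring

theorem logit_variance_eq (hθ : ∑ t, θ t = 1) (d : ι → ℝ) (e : ℝ) :
    ∑ t, θ t * d t ^ 2 - (∑ t, θ t * d t) ^ 2 =
      ∑ t, θ t * (d t + e) ^ 2 - (∑ t, θ t * d t + e) ^ 2 := by
  have : ∑ t, θ t * (d t + e) ^ 2 =
      ∑ t, θ t * d t ^ 2 + 2 * e * ∑ t, θ t * d t + e ^ 2 * ∑ t, θ t := by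
    simp only [Finset.mul_sum, ← Finset.sum_add_distrib]
    exact Finset.sum_congr rfl fun t _ => by ring
  rw [this, hθ]
  ring

theorem logit_variance_nonneg (h0 : ∀ t, 0 ≤ θ t) (hθ : ∑ t, θ t = 1) (d : ι → ℝ) :
    0 ≤ ∑ t, θ t * d t ^ 2 - (∑ t, θ t * d t) ^ 2 := by
  rw [logit_variance_eq hθ d (-∑ t, θ t * d t), add_neg_cancel, zero_pow two_ne_zero, sub_zero]
  exact Finset.sum_nonneg fun t _ => mul_nonneg (h0 t) (sq_nonneg _)

/-- A variance is at most the second moment about any point. The free centre `-e` is what brings the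
pair effects back into the fit. -/
theorem logit_variance_le (h0 : ∀ t, 0 ≤ θ t) (hθ : ∑ t, θ t = 1) (d : ι → ℝ) (e : ℝ) :
    ∑ t, θ t * d t ^ 2 - (∑ t, θ t * d t) ^ 2 ≤ ∑ t, (d t + e) ^ 2 := by
  rw [logit_variance_eq hθ d e]
  refine (sub_le_self _ (sq_nonneg _)).trans (Finset.sum_le_sum fun t _ => ?_)
  have : θ t ≤ 1 := hθ ▸ Finset.single_le_sum (fun s _ => h0 s) (Finset.mem_univ t)
  exact mul_le_of_le_one_left (sq_nonneg _) this

end LogitVariance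

/-! ### Non-collinearity bounds the divergence from below -/

namespace Panel

variable {Ω : Type*} [mΩ : MeasurableSpace Ω] {T K : ℕ}

theorem trueProb_pos (D : Panel Ω T K) (β₀ : EuclideanSpace ℝ (Fin K)) (N : ℕ) (ω : Ω)
    (p : Pair N) (t : Fin T) : 0 < D.trueProb β₀ N ω p t :=
  have : Nonempty (Fin T) := ⟨t⟩
  softmax_pos _ _

theorem sum_trueProb (D : Panel Ω T K) (β₀ : EuclideanSpace ℝ (Fin K)) (N : ℕ) (ω : Ω)
    (p : Pair N) (hT : 0 < T) : ∑ t, D.trueProb β₀ N ω p t = 1 :=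
  have : Nonempty (Fin T) := ⟨⟨0, hT⟩⟩
  sum_softmax _

/-- The divergence `∑_{i ≠ j} (∑_t λ_{ijt}) h(θ_{ij}, ϑ_{ij})` of the logit probabilities at `v`
from the true ones, for `h` the Hellinger divergence. -/
noncomputable def divergence (D : Panel Ω T K) (β₀ : EuclideanSpace ℝ (Fin K)) (N : ℕ) (ω : Ω)
    (v : Params N T K) : ℝ :=
  ∑ p, (∑ t, D.trueLam β₀ N ω p t) * hellinger (index (D.x N ω) v.1 v.2.1 v.2.2 p)
    (index (D.x N ω) β₀ (D.α N ω) (D.γ N ω) p)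

variable [StandardBorelSpace Ω]
  {D : Panel Ω T K} {μ : Measure Ω} [IsProbabilityMeasure μ] {β₀ : EuclideanSpace ℝ (Fin K)}

/-- `W_N` is eventually bounded below by a multiple of the identity, and its quadratic form is
minimal among two-way fits. Passing from variances to second moments admits arbitrary pair effects.
-/
theorem Regular.exists_eventually_quadratic (hD : D.Regular μ β₀) (hT : 0 < T) :
    ∀ᵐ ω ∂μ, ∃ c : ℝ, 0 < c ∧ ∀ᶠ N : ℕ in atTop, ∀ (b : Fin K → ℝ) (a₀ g₀ : CountryTime N T)
      (e : Pair N → ℝ), c * (b ⬝ᵥ b) * (N : ℝ) ^ 2 ≤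
        ∑ p, (∑ t, D.trueLam β₀ N ω p t) *
          ∑ t, (∑ k, D.x N ω p t k * b k + a₀ p.1.1 t + g₀ p.1.2 t + e p) ^ 2 := by
  filter_upwards [hD.noncollinear, ae_all_iff.2 fun N => hD.expHess_eq N] with ω hω hH
  obtain ⟨a, g, hproj, W, hW, hlim⟩ := hω
  obtain ⟨c, hc, hev⟩ := exists_eventually_le_dotProduct hW hlim
  refine ⟨c / 2, by positivity, ?_⟩
  filter_upwards [hev, eventually_ge_atTop 2] with N hN hN2 b a₀ g₀ e
  have hN2' : (2 : ℝ) ≤ N := by exact_mod_cast hN2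
  have hθ0 : ∀ p t, 0 ≤ D.trueProb β₀ N ω p t := fun p t => (D.trueProb_pos β₀ N ω p t).le
  have hθ1 := fun p => D.sum_trueProb β₀ N ω p hT
  have hL : ∀ p, 0 ≤ ∑ t, D.trueLam β₀ N ω p t := fun p =>
    Finset.sum_nonneg fun t _ => (D.trueLam_pos β₀ N ω p t).le
  have hq : ∀ p d, d ⬝ᵥ (Matrix.mulVec (D.expHess μ β₀ N ω p) d) = _ := fun p d =>
    dotProduct_logitHess_mulVec _ _ (hH N p) d
  have hsymm : ∀ p, (D.expHess μ β₀ N ω p).transpose = D.expHess μ β₀ N ω p := by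
    intro p
    ext t s
    rw [Matrix.transpose_apply, hH, hH]
    rcases eq_or_ne t s with rfl | hne
    · rfl
    · rw [if_neg hne, if_neg hne.symm, mul_comm (D.trueProb β₀ N ω p s)]
  have hle := (hproj N).quadratic_le hsymm (fun p d => by
    rw [hq]; exact mul_nonneg (hL p) (logit_variance_nonneg (hθ0 p) (hθ1 p) d)) b a₀ g₀
  have hWN := hN b
  rw [wMat, Matrix.smul_mulVec, dotProduct_smul, smul_eq_mul, inv_mul_eq_div,
    le_div_iff₀ (by nlinarith)] at hWN
  have hbb : 0 ≤ b ⬝ᵥ b := Finset.sum_nonneg fun k _ => mul_self_nonneg _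
  calc c / 2 * (b ⬝ᵥ b) * (N : ℝ) ^ 2 ≤ c * (b ⬝ᵥ b) * (N * (N - 1)) := by
        have h0 : 0 ≤ c * (b ⬝ᵥ b) := mul_nonneg hc.le hbb
        have h1 : (N : ℝ) ^ 2 / 2 ≤ N * (N - 1) := by nlinarith
        linarith [mul_le_mul_of_nonneg_left h1 h0]
    _ ≤ _ := hWN
    _ ≤ _ := hle
    _ ≤ _ := by
        refine Finset.sum_le_sum fun p _ => ?_
        rw [hq]
        exact mul_le_mul_of_nonneg_left (logit_variance_le (hθ0 p) (hθ1 p) _ (e p)) (hL p)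

/-- The Hellinger lower bound is applied to `z = x'(β - β₀)` and the deviations of the effects from
the true ones. `δ` depends on `ω` because the limit of `W_N` may be random. -/
theorem Regular.exists_eventually_le_divergence (hD : D.Regular μ β₀) (hT : 0 < T) {ε : ℝ}
    (hε : 0 < ε) :
    ∀ᵐ ω ∂μ, ∃ δ : ℝ, 0 < δ ∧ ∀ᶠ N : ℕ in atTop, ∀ v : Params N T K, ‖v.1 - β₀‖ = ε →
      δ * (N : ℝ) ^ 2 ≤ D.divergence β₀ N ω v := by
  obtain ⟨κ, hκ, -, hprob⟩ := hD.exists_le_trueProb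
  obtain ⟨C, hC, hlam⟩ := hD.exists_trueLam_le
  obtain ⟨M, hM⟩ := hD.bounded
  filter_upwards [hD.exists_eventually_quadratic hT, ae_all_iff.2 hprob, ae_all_iff.2 hlam,
    ae_all_iff.2 hM] with ω hω hprob hlam hM
  obtain ⟨c, hc, hev⟩ := hω
  obtain ⟨δ, hδ, hmain⟩ := exists_hellinger_lower_bound (T := T) ⟨0, hT⟩ hκ
    (X := K * (|M| * ε)) (by positivity) (Lb := T * C) (by positivity) (q := c * ε ^ 2)
    (by positivity)
  refine ⟨δ, hδ, ?_⟩
  filter_upwards [hev] with N hN v hv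
  have hcoord : ∀ k, |v.1 k - β₀ k| ≤ ε := fun k => by
    have := PiLp.norm_apply_le (v.1 - β₀) k
    rwa [hv, PiLp.sub_apply, Real.norm_eq_abs] at this
  have key := hmain N (fun p => ∑ t, D.trueLam β₀ N ω p t)
    (index (D.x N ω) β₀ (D.α N ω) (D.γ N ω))
    (fun p t => ∑ k, D.x N ω p t k * (v.1 k - β₀ k))
    (fun p => Finset.sum_nonneg fun t _ => (D.trueLam_pos β₀ N ω p t).le)
    (fun p => (Finset.sum_le_sum fun t _ => hlam N p t).trans (by simp))
    (hprob N)
    (fun p t => (Finset.abs_sum_le_sum_abs _ _).trans <|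
      (Finset.sum_le_sum fun k _ => show _ ≤ |M| * ε by
        rw [abs_mul]
        exact mul_le_mul (((hM N).1 p t k).trans (le_abs_self M)) (hcoord k) (abs_nonneg _)
          (abs_nonneg _)).trans (by simp))
    (fun a g e => by
      have h := hN (fun k => v.1 k - β₀ k) a g e
      have hn : (fun k => v.1 k - β₀ k) ⬝ᵥ (fun k => v.1 k - β₀ k) = ε ^ 2 := by
        rw [← hv, EuclideanSpace.norm_sq_eq]
        exact Finset.sum_congr rfl fun k _ => by
          rw [PiLp.sub_apply, Real.norm_eq_abs, sq_abs, sq]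
      rwa [hn] at h)
    (fun i t => v.2.1 i t - D.α N ω i t) (fun j t => v.2.2 j t - D.γ N ω j t)
  refine key.trans_eq (Finset.sum_congr rfl fun p _ => ?_)
  congr 2
  funext t
  simp only [index, mul_sub, Finset.sum_sub_distrib]
  ring

end Panel

end Gravity

namespace Gravity

/-! ### Deterministic comparison of noise and divergence -/

namespace Panel

variable {Ω : Type*} [mΩ : MeasurableSpace Ω] {T K : ℕ}

theorem divergence_eq (D : Panel Ω T K) (β₀ : EuclideanSpace ℝ (Fin K)) (N : ℕ) (ω : Ω)
    (v : Params N T K) : D.divergence β₀ N ω v = ∑ p, (∑ t, D.trueLam β₀ N ω p t) *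
      ∑ t, (Real.sqrt (prob (D.x N ω) v p t) - Real.sqrt (D.trueProb β₀ N ω p t)) ^ 2 := rfl

theorem measurableSet_exists_divergence_lt (D : Panel Ω T K) (β₀ : EuclideanSpace ℝ (Fin K))
    (N : ℕ) (ε r : ℝ) :
    MeasurableSet {ω | ∃ v : Params N T K, ‖v.1 - β₀‖ = ε ∧ D.divergence β₀ N ω v < r} := by
  have h1 : ∀ p t, Measurable fun ω => D.trueLam β₀ N ω p t := fun p t =>
    (D.measurable_trueLam_given β₀ N p t).mono (D.given_le N) le_rfl
  have h2 : ∀ p t, Measurable fun ω => D.trueProb β₀ N ω p t := fun p t =>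
    (D.measurable_trueProb_given β₀ N p t).mono (D.given_le N) le_rfl
  have h3 : ∀ p t v, Measurable fun ω => prob (D.x N ω) v p t := fun p t v =>
    measurable_prob (D.measurable_x N) measurable_const p t
  have e : {ω | ∃ v : Params N T K, ‖v.1 - β₀‖ = ε ∧ D.divergence β₀ N ω v < r} =
      {ω | ∃ v : {v : Params N T K // ‖v.1 - β₀‖ = ε}, -r < -D.divergence β₀ N ω v.1} := by
    ext ω
    constructor
    · rintro ⟨v, hv, h⟩
      exact ⟨⟨v, hv⟩, neg_lt_neg h⟩
    · rintro ⟨v, h⟩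
      exact ⟨v.1, v.2, neg_lt_neg_iff.1 h⟩
  rw [e]
  refine measurableSet_exists_lt (F := fun ω (v : {v : Params N T K // ‖v.1 - β₀‖ = ε}) =>
    -D.divergence β₀ N ω v.1) ?_ ?_ _
  · intro v
    simp only [divergence_eq]
    exact (Finset.measurable_sum _ fun p _ => (Finset.measurable_sum _ fun t _ => h1 p t).mul
      (Finset.measurable_sum _ fun t _ =>
        (((h3 p t v.1).sqrt).sub ((h2 p t).sqrt)).pow_const 2)).neg
  · intro ω
    simp only [divergence_eq]
    exact (continuous_finsetSum _ fun p _ => continuous_const.mul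
      (continuous_finsetSum _ fun t _ =>
        ((((continuous_prob_right (D.x N ω) p t).comp continuous_subtype_val).sqrt).sub
          continuous_const).pow 2)).neg

/-- `y - λ` is the centred truncated outcome plus `y - min y M` minus `λ - truncMean`. The last two
differences are nonnegative and the weights are at most `F` in size. -/
theorem sum_sub_trueLam_le (D : Panel Ω T K) (μ : Measure Ω) (β₀ : EuclideanSpace ℝ (Fin K))
    {M F : ℝ} {N : ℕ} {ω : Ω} (hF : 1 ≤ F)
    (hprob : ∀ p t, (Real.sqrt (D.trueProb β₀ N ω p t))⁻¹ ≤ F)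
    (hmean : ∀ p t, 0 ≤ D.trueLam β₀ N ω p t - D.truncMean μ M N ω p t) (v : Params N T K) :
    ∑ p, ∑ t, (D.y N ω p t - D.trueLam β₀ N ω p t) *
      (Real.sqrt (prob (D.x N ω) v p t / D.trueProb β₀ N ω p t) - 1) ≤
      D.fluctuation μ β₀ M N ω v + F * D.excess μ β₀ M N ω := by
  rw [fluctuation, excess, Finset.mul_sum, ← Finset.sum_add_distrib]
  refine Finset.sum_le_sum fun p _ => ?_
  rw [Finset.mul_sum, ← Finset.sum_add_distrib]
  refine Finset.sum_le_sum fun t _ => ?_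
  have hθ : 0 ≤ prob (D.x N ω) v p t := (softmax_pos _ _).le
  rw [Real.sqrt_div hθ, div_eq_inv_mul]
  set f := (Real.sqrt (D.trueProb β₀ N ω p t))⁻¹ * Real.sqrt (prob (D.x N ω) v p t) - 1
  have hf : |f| ≤ F := abs_mul_sqrt_sub_one_le (by positivity) (hprob p t) hF (softmax_le_one _ _)
  have h1 : 0 ≤ D.y N ω p t - min (D.y N ω p t) M := sub_nonneg.2 (min_le_left _ _)
  have h2 := hmean p t
  have h3 := mul_le_mul_of_nonneg_left (abs_le.1 hf).2 h1
  have h4 := mul_le_mul_of_nonneg_left (abs_le.1 hf).1 h2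
  nlinarith

/-- Twice the noise is at most `2(u + F u)`, so this divergence leaves a margin of `u`. -/
theorem isFEPPML_of_divergence (D : Panel Ω T K) (μ : Measure Ω) (β₀ : EuclideanSpace ℝ (Fin K))
    {M F ε u : ℝ} {N : ℕ} {ω : Ω} (hε : 0 < ε) (hu : 0 < u) (hF : 1 ≤ F)
    (hy : ∀ p t, 0 ≤ D.y N ω p t)
    (hprob : ∀ p t, (Real.sqrt (D.trueProb β₀ N ω p t))⁻¹ ≤ F)
    (hmean : ∀ p t, 0 ≤ D.trueLam β₀ N ω p t - D.truncMean μ M N ω p t)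
    (hfluct : ∀ v, |D.fluctuation μ β₀ M N ω v| ≤ u) (hexcess : D.excess μ β₀ M N ω ≤ u)
    (hdiv : ∀ v : Params N T K, ‖v.1 - β₀‖ = ε →
      (2 * (1 + F) + 1) * u ≤ D.divergence β₀ N ω v) :
    (∃ b, IsFEPPML (D.x N ω) (D.y N ω) b) ∧
      ∀ b, IsFEPPML (D.x N ω) (D.y N ω) b → ‖b - β₀‖ ≤ ε := by
  refine isFEPPML_of_profileLik_lt _ _ hy β₀ (D.α N ω) (D.γ N ω) hε hu fun β hβ α γ => ?_
  have h1 := profileLik_le_of_hellinger (D.x N ω) (D.y N ω) hy β β₀ α γ (D.α N ω) (D.γ N ω)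
    (D.trueLam β₀ N ω) (D.trueLam_eq_sum_mul β₀ N ω)
  have h2 := D.sum_sub_trueLam_le μ β₀ hF hprob hmean (β, α, γ)
  have h3 := hdiv (β, α, γ) hβ
  have h4 := (abs_le.1 (hfluct (β, α, γ))).2
  have h5 := mul_le_mul_of_nonneg_left hexcess (zero_le_one.trans hF)
  have h6 : profileLik (D.x N ω) (D.y N ω) β α γ ≤
      profileLik (D.x N ω) (D.y N ω) β₀ (D.α N ω) (D.γ N ω) +
      2 * ∑ p, ∑ t, (D.y N ω p t - D.trueLam β₀ N ω p t) *
        (Real.sqrt (prob (D.x N ω) (β, α, γ) p t / D.trueProb β₀ N ω p t) - 1) -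
      D.divergence β₀ N ω (β, α, γ) := h1
  linarith

end Panel

/-! ### Rates in powers of `s = N^(1/8)` -/

section Rates

/-- The eighth root of the number of countries, in powers of which all rates are expressed. -/
noncomputable def eighthRoot (N : ℕ) : ℝ := (N : ℝ) ^ (8⁻¹ : ℝ)

theorem eighthRoot_pow (N : ℕ) : eighthRoot N ^ 8 = N := by
  rw [eighthRoot, ← Real.rpow_natCast, ← Real.rpow_mul N.cast_nonneg]
  norm_num

theorem tendsto_eighthRoot : Tendsto eighthRoot atTop atTop :=
  (tendsto_rpow_atTop (by norm_num)).comp tendsto_natCast_atTop_atTop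

theorem sqrt_natCast_eq_eighthRoot (N : ℕ) : Real.sqrt N = eighthRoot N ^ 4 := by
  have h : (0 : ℝ) ≤ eighthRoot N ^ 4 := by rw [eighthRoot]; positivity
  rw [← eighthRoot_pow N, show eighthRoot N ^ 8 = (eighthRoot N ^ 4) ^ 2 by ring, Real.sqrt_sq h]

/-- Truncation at `s²`, mesh parameter `n = N` and noise level `s^15`: the net error is of order
`s^16 · s² / s^4 = s^14`. -/
theorem net_condition_of_le {T F s R : ℝ} (hs : 0 < s)
    (h : 2 * (T * F * Real.sqrt (T + 2)) ≤ s) (hR : R = s ^ 8) (hR4 : Real.sqrt R = s ^ 4) :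
    R ^ 2 * (T * (s ^ 2 * (F * Real.sqrt ((T + 2) / R)))) ≤ s ^ 15 / 2 := by
  rw [Real.sqrt_div' _ (by rw [hR]; positivity), hR4, hR]
  have e : (s ^ 8) ^ 2 * (T * (s ^ 2 * (F * (Real.sqrt (T + 2) / s ^ 4)))) =
      T * F * Real.sqrt (T + 2) * s ^ 14 := by
    field_simp
  rw [e]
  have h14 : (0 : ℝ) ≤ s ^ 14 := by positivity
  nlinarith

/-- The log-size of the net is at most `33 A s^9`, since each factor is at most `s^33 ≤ exp (33 s)`.
The Hoeffding exponent is `s^10 / (8 T² F²)`, larger by a factor of order `s`. -/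
theorem tail_bound_le {T F s : ℝ} {N n : ℕ} {A : ℝ} (hT : 1 ≤ T) (hs : 1 ≤ s)
    (hF : 1 ≤ F) (hN : (N : ℝ) = s ^ 8) (hs1 : 4 * T ^ 2 ≤ s)
    (hn : (n : ℝ) ≤ A * s ^ 8)
    (hs2 : (33 * A + 1) * (8 * T ^ 2 * F ^ 2) ≤ s) :
    ((N : ℝ) ^ 2 * T ^ 2 * (2 * (N : ℝ) ^ 2 + 1) + 1) ^ n *
      (2 * Real.exp (-(s ^ 15 / 2) ^ 2 / (2 * ((N : ℝ) ^ 2 * (T * (s ^ 2 * F)) ^ 2)))) ≤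
      2 * Real.exp (-s) := by
  have hs0 : 0 < s := by linarith
  have hT0 : 0 < T := by linarith
  have hF0 : 0 < F := by linarith
  rw [hN]
  have h1 : (s ^ 8) ^ 2 * T ^ 2 * (2 * (s ^ 8) ^ 2 + 1) + 1 ≤ s ^ 33 := by
    have e1 : (1 : ℝ) ≤ s ^ 16 := one_le_pow₀ hs
    have e2 : 1 ≤ T ^ 2 := one_le_pow₀ hT
    have e3 : T ^ 2 * s ^ 16 ≤ T ^ 2 * s ^ 32 := by
      gcongr
      norm_num
    have e4 : 1 ≤ T ^ 2 * s ^ 16 := one_le_mul_of_one_le_of_one_le e2 e1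
    have e5 : 4 * T ^ 2 * s ^ 32 ≤ s * s ^ 32 := by gcongr
    calc (s ^ 8) ^ 2 * T ^ 2 * (2 * (s ^ 8) ^ 2 + 1) + 1
        = 2 * (T ^ 2 * s ^ 32) + T ^ 2 * s ^ 16 + 1 := by ring
      _ ≤ 4 * T ^ 2 * s ^ 32 := by linarith
      _ ≤ s * s ^ 32 := e5
      _ = s ^ 33 := by ring
  have h2 : s ^ 33 ≤ Real.exp (33 * s) := by
    calc s ^ 33 ≤ Real.exp s ^ 33 := by
          gcongr; linarith [Real.add_one_le_exp s]
      _ = Real.exp (33 * s) := by rw [← Real.exp_nat_mul]; norm_num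
  have h3 : ((s ^ 8) ^ 2 * T ^ 2 * (2 * (s ^ 8) ^ 2 + 1) + 1) ^ n ≤
      Real.exp (33 * A * s ^ 9) := by
    calc _ ≤ Real.exp (33 * s) ^ n := by gcongr; exact h1.trans h2
      _ = Real.exp (n * (33 * s)) := by rw [← Real.exp_nat_mul]
      _ ≤ _ := by
        refine Real.exp_le_exp.2 ?_
        calc (n : ℝ) * (33 * s) ≤ A * s ^ 8 * (33 * s) := by gcongr
          _ = 33 * A * s ^ 9 := by ring
  have e : -(s ^ 15 / 2) ^ 2 / (2 * ((s ^ 8) ^ 2 * (T * (s ^ 2 * F)) ^ 2)) =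
      -(s ^ 10 / (8 * T ^ 2 * F ^ 2)) := by
    field_simp
    norm_num
  rw [e]
  calc _ ≤ Real.exp (33 * A * s ^ 9) * (2 * Real.exp (-(s ^ 10 / (8 * T ^ 2 * F ^ 2)))) := by
        gcongr
    _ = 2 * Real.exp (33 * A * s ^ 9 - s ^ 10 / (8 * T ^ 2 * F ^ 2)) := by
        rw [sub_eq_add_neg, Real.exp_add]; ring
    _ ≤ _ := by
        gcongr
        have h4 : (33 * A + 1) * s ^ 9 ≤ s ^ 10 / (8 * T ^ 2 * F ^ 2) := by
          rw [le_div_iff₀ (by positivity)]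
          calc (33 * A + 1) * s ^ 9 * (8 * T ^ 2 * F ^ 2) =
                (33 * A + 1) * (8 * T ^ 2 * F ^ 2) * s ^ 9 := by ring
            _ ≤ s * s ^ 9 := by gcongr
            _ = s ^ 10 := by ring
        have h5 : s ≤ s ^ 9 := le_self_pow₀ hs (by norm_num)
        linarith

end Rates

/-! ### Convergence in probability -/

namespace Panel

variable {Ω : Type*} [mΩ : MeasurableSpace Ω] {T K : ℕ} [StandardBorelSpace Ω]
  {D : Panel Ω T K} {μ : Measure Ω} [IsProbabilityMeasure μ] {β₀ : EuclideanSpace ℝ (Fin K)}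

theorem Regular.tendsto_measure_fluctuation (hD : D.Regular μ β₀) (hT : 0 < T) {F : ℝ}
    (hF : 1 ≤ F) (hprob : ∀ N, ∀ᵐ ω ∂μ, ∀ p t, (Real.sqrt (D.trueProb β₀ N ω p t))⁻¹ ≤ F) :
    Tendsto (fun N => μ {ω | ∃ v, eighthRoot N ^ 15 <
      |D.fluctuation μ β₀ (eighthRoot N ^ 2) N ω v|}) atTop (𝓝 0) := by
  have hT1 : (1 : ℝ) ≤ T := by exact_mod_cast hT
  have hlim : Tendsto (fun N => ENNReal.ofReal (2 * Real.exp (-eighthRoot N))) atTop (𝓝 0) := by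
    have h := (Real.tendsto_exp_neg_atTop_nhds_zero.comp tendsto_eighthRoot).const_mul 2
    rw [mul_zero] at h
    simpa using ENNReal.tendsto_ofReal h
  refine tendsto_of_tendsto_of_tendsto_of_le_of_le' tendsto_const_nhds hlim
    (Eventually.of_forall fun _ => zero_le) ?_
  filter_upwards [eventually_ge_atTop 2, tendsto_eighthRoot.eventually_ge_atTop 1,
    tendsto_eighthRoot.eventually_ge_atTop (2 * (T * F * Real.sqrt (T + 2))),
    tendsto_eighthRoot.eventually_ge_atTop (4 * (T : ℝ) ^ 2),
    tendsto_eighthRoot.eventually_ge_atTop ((33 * ((K : ℝ) + 2 * T) + 1) * (8 * T ^ 2 * F ^ 2))]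
    with N hN2 hs hs1 hs2 hs3
  have : Nonempty (Pair N) := ⟨⟨(⟨0, by omega⟩, ⟨1, hN2⟩), by simp⟩⟩
  have hs0 : 0 < eighthRoot N := by linarith
  refine (D.measure_fluctuation_le μ β₀ N hT (hD.nonneg N) (hD.condIndep N) (pow_pos hs0 2) hF
    (hprob N) (n := N) (by omega) (pow_pos hs0 15).le
    (net_condition_of_le hs0 hs1 (eighthRoot_pow N).symm (sqrt_natCast_eq_eighthRoot N))).trans
    (ENNReal.ofReal_le_ofReal ?_)
  push_cast
  refine tail_bound_le (A := (K : ℝ) + 2 * T) hT1 hs hF (eighthRoot_pow N).symm hs2 ?_ hs3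
  push_cast
  rw [eighthRoot_pow]
  have : (1 : ℝ) ≤ N := by exact_mod_cast (by omega : 1 ≤ N)
  nlinarith [mul_le_mul_of_nonneg_left this (Nat.cast_nonneg (α := ℝ) K)]

theorem Regular.tendsto_measure_excess (hD : D.Regular μ β₀) :
    Tendsto (fun N => μ {ω | eighthRoot N ^ 15 ≤ D.excess μ β₀ (eighthRoot N ^ 2) N ω})
      atTop (𝓝 0) := by
  obtain ⟨C, -, h⟩ := hD.exists_measure_excess_le
  have hlim : Tendsto (fun N => ENNReal.ofReal (C / eighthRoot N)) atTop (𝓝 0) := by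
    simpa using ENNReal.tendsto_ofReal (tendsto_eighthRoot.const_div_atTop C)
  refine tendsto_of_tendsto_of_tendsto_of_le_of_le' tendsto_const_nhds hlim
    (Eventually.of_forall fun _ => zero_le) ?_
  filter_upwards [tendsto_eighthRoot.eventually_ge_atTop 1] with N hs
  have hs0 : 0 < eighthRoot N := by linarith
  refine (h N _ _ (one_le_pow₀ hs) (pow_pos hs0 15)).trans_eq ?_
  congr 1
  -- `N² / (s² · s^15) = 1 / s`.
  rw [← eighthRoot_pow]
  field_simp

/-- `s^15` is negligible against `N² = s^16`. The lower bound holds almost surely from a random `N`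
on with a random `δ`; convergence of the indicators turns this into convergence of the
probabilities. -/
theorem Regular.tendsto_measure_divergence (hD : D.Regular μ β₀) (hT : 0 < T) {ε : ℝ}
    (hε : 0 < ε) (B : ℝ) :
    Tendsto (fun N => μ {ω | ∃ v : Params N T K, ‖v.1 - β₀‖ = ε ∧
      D.divergence β₀ N ω v < B * eighthRoot N ^ 15}) atTop (𝓝 0) := by
  rw [← measure_empty (μ := μ)]
  refine tendsto_measure_of_ae_tendsto_indicator_of_isFiniteMeasure atTop MeasurableSet.empty
    (fun N => D.measurableSet_exists_divergence_lt β₀ N ε _) ?_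
  filter_upwards [hD.exists_eventually_le_divergence hT hε] with ω hω
  obtain ⟨δ, hδ, hev⟩ := hω
  filter_upwards [hev, tendsto_eighthRoot.eventually_ge_atTop 1,
    tendsto_eighthRoot.eventually_ge_atTop (B / δ)] with N hN hs hB
  rw [Set.mem_empty_iff_false, iff_false]
  rintro ⟨v, hv, hlt⟩
  have h1 := hN v hv
  rw [← eighthRoot_pow] at h1
  rw [div_le_iff₀ hδ] at hB
  have h15 : 0 ≤ eighthRoot N ^ 15 := by positivity
  have h2 := mul_le_mul_of_nonneg_right hB h15
  have e : δ * (eighthRoot N ^ 8) ^ 2 = eighthRoot N * δ * eighthRoot N ^ 15 := by ring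
  linarith

/-- Without periods every `W_N` vanishes and cannot converge to a positive definite matrix. -/
theorem Regular.pos_of_pos (hD : D.Regular μ β₀) (hK : 0 < K) : 0 < T := by
  rcases Nat.eq_zero_or_pos T with rfl | h
  · obtain ⟨ω, a, g, -, W, hW, hlim⟩ := hD.noncollinear.exists
    have h0 : ∀ N, D.wMat μ β₀ N ω (a N) (g N) = 0 := by
      intro N
      rw [wMat, Finset.sum_eq_zero, smul_zero]
      intro p _
      ext k l
      simp [Matrix.mul_apply]
    simp only [h0] at hlim
    have hW0 := tendsto_nhds_unique hlim tendsto_const_nhds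
    have hd := hW.diag_pos (i := ⟨0, hK⟩)
    rw [hW0] at hd
    simp at hd
  · exact h

theorem Regular.tendsto_measure_not_near (hD : D.Regular μ β₀) {ε : ℝ} (hε : 0 < ε) :
    Tendsto (fun N => μ {ω | ¬((∃ b, IsFEPPML (D.x N ω) (D.y N ω) b) ∧
      ∀ b, IsFEPPML (D.x N ω) (D.y N ω) b → ‖b - β₀‖ ≤ ε)}) atTop (𝓝 0) := by
  have hy : ∀ N, ∀ᵐ ω ∂μ, ∀ p t, 0 ≤ D.y N ω p t := fun N => by
    simp only [ae_all_iff]; exact hD.nonneg N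
  -- For `K = 0` the sphere of radius `ε` is empty, so the comparison is vacuous.
  rcases Nat.eq_zero_or_pos K with rfl | hK
  · have h0 : ∀ N, μ {ω | ¬((∃ b, IsFEPPML (D.x N ω) (D.y N ω) b) ∧
        ∀ b, IsFEPPML (D.x N ω) (D.y N ω) b → ‖b - β₀‖ ≤ ε)} = 0 := by
      intro N
      refine ae_iff.1 ?_
      filter_upwards [hy N] with ω hω
      refine isFEPPML_of_profileLik_lt _ _ hω β₀ 0 0 hε one_pos fun β hβ => ?_
      rw [Subsingleton.elim β β₀, sub_self, norm_zero] at hβ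
      exact absurd hβ hε.ne
    simp only [h0]
    exact tendsto_const_nhds
  have hT := hD.pos_of_pos hK
  obtain ⟨κ, hκ, hκ1, hκp⟩ := hD.exists_le_trueProb
  set F : ℝ := (Real.sqrt κ)⁻¹ with hFdef
  have hF : 1 ≤ F := (one_le_inv₀ (Real.sqrt_pos.2 hκ)).2 (Real.sqrt_le_one.2 hκ1)
  have hprob : ∀ N, ∀ᵐ ω ∂μ, ∀ p t, (Real.sqrt (D.trueProb β₀ N ω p t))⁻¹ ≤ F := fun N => by
    filter_upwards [hκp N] with ω hω p t
    exact inv_anti₀ (Real.sqrt_pos.2 hκ) (Real.sqrt_le_sqrt (hω p t))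
  have hsum := ((hD.tendsto_measure_fluctuation hT hF hprob).add hD.tendsto_measure_excess).add
    (hD.tendsto_measure_divergence hT hε (2 * (1 + F) + 1))
  rw [add_zero, add_zero] at hsum
  refine tendsto_of_tendsto_of_tendsto_of_le_of_le' tendsto_const_nhds hsum
    (Eventually.of_forall fun _ => zero_le) ?_
  filter_upwards [tendsto_eighthRoot.eventually_ge_atTop 1] with N hs
  refine (measure_mono_ae ?_).trans ((measure_union_le _ _).trans
    (add_le_add_left (measure_union_le _ _) _))
  filter_upwards [hy N, hprob N, hD.excess_terms_nonneg (eighthRoot N ^ 2) N] with ω h1 h2 h3 hbad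
  by_contra hgood
  refine hbad (D.isFEPPML_of_divergence μ β₀ (u := eighthRoot N ^ 15) hε
    (pow_pos (by linarith) 15) hF h1 h2 h3 (fun v => ?_) ?_ fun v hv => ?_)
  · by_contra! h
    exact hgood (Or.inl (Or.inl ⟨v, h⟩))
  · by_contra! h
    exact hgood (Or.inl (Or.inr h.le))
  · by_contra! h
    exact hgood (Or.inr ⟨v, hv, h⟩)

end Panel

end Gravity

theorem proposition1 {Ω : Type*} [MeasurableSpace Ω] [StandardBorelSpace Ω]
    (μ : Measure Ω) [IsProbabilityMeasure μ] {T K : ℕ}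
    (D : Gravity.Panel Ω T K) (β₀ : EuclideanSpace ℝ (Fin K)) (hD : D.Regular μ β₀) :
    Tendsto (fun N : ℕ => μ {ω | ¬ ∃ b, Gravity.IsFEPPML (D.x N ω) (D.y N ω) b}) atTop (𝓝 0) ∧
    ∀ βhat : ℕ → Ω → EuclideanSpace ℝ (Fin K),
      (∀ N ω, (∃ b, Gravity.IsFEPPML (D.x N ω) (D.y N ω) b) →
        Gravity.IsFEPPML (D.x N ω) (D.y N ω) (βhat N ω)) →
      TendstoInMeasure μ βhat atTop (fun _ => β₀) := by
  refine ⟨?_, fun βhat hβ => tendstoInMeasure_of_ne_top fun ε hε hε' => ?_⟩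
  · exact tendsto_of_tendsto_of_tendsto_of_le_of_le tendsto_const_nhds
      (hD.tendsto_measure_not_near one_pos) (fun _ => zero_le)
      fun N => measure_mono fun ω hω h => hω h.1
  -- Radius `ε/2` is used because the event to exclude has the weak inequality `ε ≤ edist`.
  -- Monotonicity of `μ` as an outer measure is enough, as `βhat` need not be measurable.
  · have hr : 0 < ε.toReal := ENNReal.toReal_pos hε.ne' hε'
    refine tendsto_of_tendsto_of_tendsto_of_le_of_le tendsto_const_nhds
      (hD.tendsto_measure_not_near (half_pos hr)) (fun _ => zero_le)
      fun N => measure_mono fun ω hω h => ?_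
    have h1 := h.2 _ (hβ N ω h.1)
    have h2 : ε ≤ edist (βhat N ω) β₀ := hω
    rw [edist_dist, dist_eq_norm, ENNReal.le_ofReal_iff_toReal_le hε' (norm_nonneg _)] at h2
    linarith
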